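/- Let $d\ge 1$. Fix a Littlewood--Paley decomposition of $\mathbb{R}^d$: $\chi$ is a smooth, radial, radially nonincreasing function supported in the ball $|\xi|\le 4/3$ and equal to $1$ near the ball $|\xi|\le 3/4$, $\varphi(\xi)=\chi(\xi/2)-\chi(\xi)$ (supported in $3/4\le|\xi|\le 8/3$), and for $j\in\mathbb{Z}$, $\dot\Delta_j=\varphi(2^{-j}D)$, i.e. $\widehat{\dot\Delta_j f}(\xi)=\varphi(2^{-j}\xi)\widehat f(\xi)$ with $\widehat f(\xi)=\int e^{-ix\cdot\xi}f(x)\,dx$. Let $\phi(x)=(4\pi)^{-d/2}e^{-|x|^2/4}$ and $\phi_\varepsilon(x)=\varepsilon^{-d}\phi(x/\varepsilon)$, so that $\widehat{\phi_\varepsilon}(\xi)=e^{-\varepsilon^2|\xi|^2}$. There exist constants $C>0$ and $\varepsilon_0>0$, depending only on $d$, such that the following holds. Let $p>0$, $\kappa>0$, $\mu>0$ and $\lambda\in\mathbb{R}$ be such that $\nu:=\lambda+2\mu>0$, and set $\nu_0=\min(\nu,\mu)$. Let $0<\varepsilon\le\varepsilon_0$, let $I=[0,T)$ with $T>0$ or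 $I=[0,+\infty)$, and let $(q,u)$ be a solution on $I$ of the linear system $$ (L_\varepsilon)\qquad \begin{cases} \partial_t q+\operatorname{div}u=F,\\ \partial_t u-\mu\Delta u-(\lambda+\mu)\nabla\operatorname{div}u+p\nabla q-\dfrac{\kappa}{\varepsilon^2}\nabla(\phi_\varepsilon*q-q)=G, \end{cases} $$ where $q$ and $u$ are continuous on $I$ with values in the tempered distributions on $\mathbb{R}^d$, $F$ and $G$ are locally integrable on $I$ with values in the tempered distributions (both tested against each fixed Schwartz function), and the equations hold in the time-integrated sense of distributions; put $q_0=q(0)$ and $u_0=u(0)$. Then for all $t\in I$ and all $j\in\mathbb{Z}$, $$ \begin{aligned} &\|\dot\Delta_j u\|_{L^\infty_tL^2}+\nu_0 2^{2j}\|\dot\Delta_j u\|_{L^1_tL^2}+(1+\nu 2^j)\Big(\|\dot\Delta_j q\|_{L^\infty_tL^2}+\nu\min\big(\tfrac1{\varepsilon^2},2^{2j}\big)\|\dot\Delta_j q\|_{L^1_tL^2}\Big)\\ &\le C\max\Big(\sqrt p,\frac1{\sqrt p}\Big)\max\Big(\frac{4\kappa}{\nu^2},\Big(\frac{\nu^2}{4\kappa}\Big)^2\Big)\\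 &\quad\times\Big((1+\nu 2^j)\|\dot\Delta_j q_0\|_{L^2}+\|\dot\Delta_j u_0\|_{L^2}+(1+\nu 2^j)\|\dot\Delta_j F\|_{L^1_tL^2}+\|\dot\Delta_j G\|_{L^1_tL^2}\Big), \end{aligned} $$ where $L^r_tL^2=L^r([0,t];L^2(\mathbb{R}^d))$ and the $L^2$ norm of a distribution which is not an $L^2$ function is $+\infty$ (so the estimate says in particular that the left-hand side is finite when the right-hand side is). -/

import Mathlib

namespace Korteweg

open scoped SchwartzMap ENNReal FourierTransform LineDeriv Laplacian ContDiff

/-- The space `ℝ^d` with its Euclidean norm. -/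
abbrev Space (d : ℕ) := EuclideanSpace ℝ (Fin d)

/-- Tempered distributions on `ℝ^d`. -/
abbrev Distr (d : ℕ) := 𝓢'(Space d, ℂ)

/-! ### The interaction kernel and the convolution with it -/

/-- The Gaussian interaction potential `φ(x) = (4π)^{-d/2} exp(-|x|²/4)`, of integral one. -/
noncomputable def kernel (d : ℕ) (x : Space d) : ℝ :=
  (4 * Real.pi) ^ (-(d : ℝ) / 2) * Real.exp (-(‖x‖ ^ 2 / 4))

/-- The rescaled kernel `φ_ε(x) = ε^{-d} φ(x/ε)`. -/
noncomputable def kernelEps (d : ℕ) (ε : ℝ) (x : Space d) : ℝ :=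
  (ε ^ d)⁻¹ * kernel d (ε⁻¹ • x)

/-- The Fourier transform of the kernel, in the normalization `∫ e^{-2πi x·η} φ_ε(x) dx`. -/
noncomputable def kernelSymbol (d : ℕ) (ε : ℝ) : Space d → ℂ :=
  𝓕 (fun x : Space d => (kernelEps d ε x : ℂ))

/-- The convolution `φ_ε * T` of the (Schwartz) kernel with a tempered distribution: the tempered
distribution whose Fourier transform is the product of the Fourier transforms. -/
noncomputable def kernelConv (d : ℕ) (ε : ℝ) (T : Distr d) : Distr d :=
  TemperedDistribution.fourierMultiplierCLM ℂ (kernelSymbol d ε) T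

/-! ### The Littlewood-Paley decomposition -/

/-- The admissible low frequency cut-off functions: smooth and radially nonincreasing, supported in
the ball of radius `4/3` and equal to `1` in a neighbourhood of the ball of radius `3/4`. -/
structure IsCutoff {d : ℕ} (χ : Space d → ℝ) : Prop where
  smooth : ContDiff ℝ ∞ χ
  radial : ∀ x y, ‖x‖ = ‖y‖ → χ x = χ y
  antitone : ∀ x y, ‖x‖ ≤ ‖y‖ → χ y ≤ χ x
  support : tsupport χ ⊆ Metric.closedBall 0 (4 / 3)
  eq_one : ∀ᶠ x in nhdsSet (Metric.closedBall 0 (3 / 4)), χ x = 1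

/-- The function `φ(ξ) = χ(ξ/2) - χ(ξ)`, supported in the annulus `3/4 ≤ |ξ| ≤ 8/3`. -/
noncomputable def annulusFun {d : ℕ} (χ : Space d → ℝ) (ξ : Space d) : ℝ :=
  χ ((2 : ℝ)⁻¹ • ξ) - χ ξ

/-- The symbol `φ(2^{-j} ξ)` at the frequency `ξ = 2πη`, where `η` is the variable of the Fourier
transform normalized as `∫ e^{-2πi x·η} f(x) dx`. -/
noncomputable def blockSymbol {d : ℕ} (χ : Space d → ℝ) (j : ℤ) (η : Space d) : ℂ :=
  (annulusFun χ ((2 : ℝ) ^ (-j) • (2 * Real.pi) • η) : ℂ)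

/-- The homogeneous dyadic block `Δ̇_j = φ(2^{-j} D)` on tempered distributions. -/
noncomputable def block {d : ℕ} (χ : Space d → ℝ) (j : ℤ) (T : Distr d) : Distr d :=
  TemperedDistribution.fourierMultiplierCLM ℂ (blockSymbol χ j) T

/-! ### Norms -/

/-- The `L²` norm of a tempered distribution, infinite if it is not given by an `L²` function. -/
noncomputable def normL2 {d : ℕ} (T : Distr d) : ℝ≥0∞ :=
  ⨅ (f : MeasureTheory.Lp ℂ 2 (MeasureTheory.volume : MeasureTheory.Measure (Space d)))
    (_ : MeasureTheory.Lp.toTemperedDistribution f = T), ‖f‖ₑ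

/-- The `L²` norm of a vector field with tempered distribution components. -/
noncomputable def normL2Vec {d : ℕ} (U : Fin d → Distr d) : ℝ≥0∞ :=
  (∑ i, normL2 (U i) ^ 2) ^ (1 / 2 : ℝ)

/-- The norm of `L^r([0, t])` of the function `s ↦ N s` with values in `[0, ∞]`. -/
noncomputable def timeNorm (r : ℝ≥0∞) (t : ℝ) (N : ℝ → ℝ≥0∞) : ℝ≥0∞ :=
  MeasureTheory.eLpNorm N r (MeasureTheory.volume.restrict (Set.Icc 0 t))

/-! ### The linear system -/

/-- The partial derivative `∂_i`, in the sense of distributions. -/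
noncomputable def partialD {d : ℕ} (i : Fin d) (T : Distr d) : Distr d :=
  ∂_{(EuclideanSpace.single i (1 : ℝ) : Space d)} T

/-- The divergence of a vector field, in the sense of distributions. -/
noncomputable def divergence {d : ℕ} (U : Fin d → Distr d) : Distr d :=
  ∑ i, partialD i (U i)

/-- The `i`-th component of `𝓐 U = μ Δ U + (λ + μ) ∇ div U` (with `lam` for `λ`). -/
noncomputable def diffusion {d : ℕ} (μ lam : ℝ) (U : Fin d → Distr d) (i : Fin d) : Distr d :=
  (μ : ℂ) • Δ (U i) + ((lam + μ : ℝ) : ℂ) • partialD i (divergence U)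

/-- The `i`-th component of the nonlocal capillary term `(κ/ε²) ∇ (φ_ε * q - q)`. -/
noncomputable def capillary {d : ℕ} (κ ε : ℝ) (q : Distr d) (i : Fin d) : Distr d :=
  ((κ / ε ^ 2 : ℝ) : ℂ) • partialD i (kernelConv d ε q - q)

/-- `(q, u)` is a solution on the time interval `I` (with left end point `0`) of the linear system
`∂_t q + div u = F`, `∂_t u - 𝓐 u + p ∇ q - (κ/ε²) ∇ (φ_ε * q - q) = G`:
`q` and `u` are continuous in time with values in the tempered distributions, the forces are
locally integrable in time with values in the tempered distributions, and both equations hold in the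
sense of distributions, in time-integrated form. -/
structure IsSolution {d : ℕ} (p μ lam κ ε : ℝ) (I : Set ℝ)
    (q : ℝ → Distr d) (u : ℝ → Fin d → Distr d)
    (F : ℝ → Distr d) (G : ℝ → Fin d → Distr d) : Prop where
  continuous_q : ∀ ψ : 𝓢(Space d, ℂ), ContinuousOn (fun t => q t ψ) I
  continuous_u : ∀ (i : Fin d) (ψ : 𝓢(Space d, ℂ)), ContinuousOn (fun t => u t i ψ) I
  integrable_F : ∀ ψ : 𝓢(Space d, ℂ), ∀ t ∈ I,
    IntervalIntegrable (fun s => F s ψ) MeasureTheory.volume 0 t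
  integrable_G : ∀ (i : Fin d) (ψ : 𝓢(Space d, ℂ)), ∀ t ∈ I,
    IntervalIntegrable (fun s => G s i ψ) MeasureTheory.volume 0 t
  mass : ∀ ψ : 𝓢(Space d, ℂ), ∀ t ∈ I,
    q t ψ = q 0 ψ + ∫ s in (0 : ℝ)..t, (F s - divergence (u s)) ψ
  momentum : ∀ (i : Fin d) (ψ : 𝓢(Space d, ℂ)), ∀ t ∈ I,
    u t i ψ = u 0 i ψ + ∫ s in (0 : ℝ)..t,
      (G s i + diffusion μ lam (u s) i - (p : ℂ) • partialD i (q s) + capillary κ ε (q s) i) ψ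

/-! ### The symbols are admissible Fourier multipliers -/

theorem kernelSymbol_apply (d : ℕ) {ε : ℝ} (hε : 0 < ε) (η : Space d) :
    kernelSymbol d ε η = (Real.exp (-(ε ^ 2 * ‖(2 * Real.pi) • η‖ ^ 2)) : ℂ) := by
  have hb : 0 < (((1 / (4 * ε ^ 2) : ℝ) : ℂ)).re := by
    rw [Complex.ofReal_re]; positivity
  have hpi := Real.pi_pos
  have key := fourier_gaussian_innerProductSpace (V := Space d) hb η
  have hfun : (fun x : Space d => (kernelEps d ε x : ℂ)) =
      (((ε ^ d)⁻¹ * (4 * Real.pi) ^ (-(d : ℝ) / 2) : ℝ) : ℂ) •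
        (fun x : Space d => Complex.exp (-((1 / (4 * ε ^ 2) : ℝ) : ℂ) * (‖x‖ : ℂ) ^ 2)) := by
    funext x
    simp only [kernelEps, kernel, Pi.smul_apply, smul_eq_mul, norm_smul, norm_inv,
      Real.norm_eq_abs, abs_of_pos hε]
    rw [← mul_assoc, Complex.ofReal_mul, Complex.ofReal_exp]
    congr 2
    push_cast
    field_simp
  have hsmul : 𝓕 ((((ε ^ d)⁻¹ * (4 * Real.pi) ^ (-(d : ℝ) / 2) : ℝ) : ℂ) •
        (fun x : Space d => Complex.exp (-((1 / (4 * ε ^ 2) : ℝ) : ℂ) * (‖x‖ : ℂ) ^ 2))) η =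
      (((ε ^ d)⁻¹ * (4 * Real.pi) ^ (-(d : ℝ) / 2) : ℝ) : ℂ) *
        𝓕 (fun x : Space d => Complex.exp (-((1 / (4 * ε ^ 2) : ℝ) : ℂ) * (‖x‖ : ℂ) ^ 2)) η := by
    simp only [Real.fourier_eq, Pi.smul_apply, smul_eq_mul]
    rw [← MeasureTheory.integral_const_mul]
    refine MeasureTheory.integral_congr_ae (Filter.Eventually.of_forall fun x => ?_)
    simp only [Circle.smul_def, smul_eq_mul]
    ring
  rw [kernelSymbol, hfun, hsmul, key, ← mul_assoc]
  have hconst : (((ε ^ d)⁻¹ * (4 * Real.pi) ^ (-(d : ℝ) / 2) : ℝ) : ℂ) *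
      ((Real.pi : ℂ) / ((1 / (4 * ε ^ 2) : ℝ) : ℂ)) ^
        ((Module.finrank ℝ (Space d) : ℂ) / 2) = 1 := by
    have h1 : (Real.pi : ℂ) / ((1 / (4 * ε ^ 2) : ℝ) : ℂ) = ((4 * Real.pi * ε ^ 2 : ℝ) : ℂ) := by
      push_cast
      field_simp
    have h2 : ((Module.finrank ℝ (Space d) : ℂ) / 2) = (((d : ℝ) / 2 : ℝ) : ℂ) := by
      simp
    rw [h1, h2, ← Complex.ofReal_cpow (by positivity), ← Complex.ofReal_mul,
      Complex.ofReal_eq_one,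
      Real.mul_rpow (x := 4 * Real.pi) (y := ε ^ 2) (by positivity) (by positivity),
      ← Real.rpow_natCast_mul hε.le, neg_div, Real.rpow_neg (by positivity)]
    have h3 : ((2 : ℕ) : ℝ) * ((d : ℝ) / 2) = (d : ℝ) := by push_cast; ring
    rw [h3, Real.rpow_natCast]
    have h4 : (0 : ℝ) < (4 * Real.pi) ^ ((d : ℝ) / 2) := by positivity
    field_simp
  rw [hconst, one_mul, Complex.ofReal_exp, norm_smul]
  congr 1
  rw [Real.norm_eq_abs, abs_of_pos (by positivity)]
  push_cast
  field_simp
  ring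

theorem kernelSymbol_hasTemperateGrowth (d : ℕ) {ε : ℝ} (hε : 0 < ε) :
    (kernelSymbol d ε).HasTemperateGrowth := by
  have hin : (fun η : Space d => ε ^ 2 * ‖(2 * Real.pi) • η‖ ^ 2).HasTemperateGrowth := by
    have h : (fun η : Space d => ε ^ 2 * ‖(2 * Real.pi) • η‖ ^ 2) =
        fun η : Space d => (ε ^ 2 * (2 * Real.pi) ^ 2) * ‖η‖ ^ 2 := by
      funext η
      rw [norm_smul, mul_pow, Real.norm_eq_abs, sq_abs, mul_assoc]
    rw [h]
    exact (Function.HasTemperateGrowth.const _).mul (Function.hasTemperateGrowth_norm_sq _)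
  have hexp : ((fun y : ℝ => Real.exp (-y)) ∘
      (fun η : Space d => ε ^ 2 * ‖(2 * Real.pi) • η‖ ^ 2)).HasTemperateGrowth := by
    have hcd : ContDiff ℝ ∞ (fun y : ℝ => Real.exp (-y)) := by fun_prop
    have hder : ∀ n : ℕ, iteratedDeriv n (fun y : ℝ => Real.exp (-y)) =
        fun y => (-1) ^ n * Real.exp (-y) := by
      intro n
      induction n with
      | zero => simp
      | succ n ih =>
        rw [iteratedDeriv_succ, ih]
        funext y
        have h : HasDerivAt (fun y : ℝ => (-1) ^ n * Real.exp (-y))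
            ((-1) ^ n * (Real.exp (-y) * (-1))) y :=
          ((hasDerivAt_neg y).exp).const_mul _
        rw [h.deriv]
        ring
    refine hin.comp' (t := Set.Ioi (-1 : ℝ)) ?_ isOpen_Ioi.uniqueDiffOn hcd.contDiffOn ?_
    · rintro _ ⟨η, rfl⟩
      exact lt_of_lt_of_le (by norm_num) (by positivity : 0 ≤ ε ^ 2 * ‖(2 * Real.pi) • η‖ ^ 2)
    · intro N
      refine ⟨0, Real.exp 1, (Real.exp_pos 1).le, fun n _ y hy => ?_⟩
      rw [norm_iteratedFDerivWithin_eq_norm_iteratedDerivWithin,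
        iteratedDerivWithin_of_isOpen isOpen_Ioi hy, hder]
      simp only [norm_mul, norm_pow, norm_neg, norm_one, one_pow, one_mul, pow_zero, mul_one,
        Real.norm_eq_abs, Real.abs_exp]
      exact Real.exp_le_exp.mpr (by have := Set.mem_Ioi.mp hy; linarith)
  have h : kernelSymbol d ε = Complex.ofReal ∘ ((fun y : ℝ => Real.exp (-y)) ∘
      (fun η : Space d => ε ^ 2 * ‖(2 * Real.pi) • η‖ ^ 2)) := by
    funext η
    exact kernelSymbol_apply d hε η
  rw [h]
  exact Function.Complex.hasTemperateGrowth_ofReal.comp hexp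

theorem blockSymbol_hasTemperateGrowth {d : ℕ} {χ : Space d → ℝ} (hχ : IsCutoff χ) (j : ℤ) :
    (blockSymbol χ j).HasTemperateGrowth := by
  have hcs : HasCompactSupport χ :=
    HasCompactSupport.of_support_subset_isCompact (isCompact_closedBall (0 : Space d) (4 / 3))
      (subset_tsupport χ |>.trans hχ.support)
  have hχg : χ.HasTemperateGrowth := hcs.hasTemperateGrowth hχ.smooth
  have hlin : ∀ c : ℝ, (fun η : Space d => c • η).HasTemperateGrowth := fun c =>
    (c • ContinuousLinearMap.id ℝ (Space d)).hasTemperateGrowth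
  have h : blockSymbol χ j = Complex.ofReal ∘
      ((χ ∘ fun η : Space d => ((2 : ℝ)⁻¹ * ((2 : ℝ) ^ (-j) * (2 * Real.pi))) • η) -
        (χ ∘ fun η : Space d => ((2 : ℝ) ^ (-j) * (2 * Real.pi)) • η)) := by
    funext η
    simp only [blockSymbol, annulusFun, Function.comp_apply, Pi.sub_apply, smul_smul]
  rw [h]
  exact Function.Complex.hasTemperateGrowth_ofReal.comp ((hχg.comp (hlin _)).sub (hχg.comp (hlin _)))

end Korteweg

namespace Korteweg

open scoped SchwartzMap ENNReal FourierTransform LineDeriv Laplacian ContDiff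
open MeasureTheory

/-! ### The `L²` norm of a tempered distribution by duality -/

/-! At a fixed frequency `ξ = 2πη` with `r = |ξ|` the system is an ODE with constant coefficients.
The divergence-free part of the velocity decays like `exp(-μ r² t)`. The density and the
longitudinal velocity `v` form a closed pair `q' = -r v`, `v' = r P q - ν r² v`, where `P = p +
(κ/ε²)(1 - exp(-ε² r²))` is comparable to `Q = p + κ min(1/ε², ρ²)` on the annulus `r ~ ρ = 2^j`.
With `x = ν r q`, `c = ν r²` and `θ = P/(ν² r²)` the pair becomes `x' = -c v`, `v' = -c v + cθ x`.
For `θ ≥ 1/2` everything decays at rate `c/2` (`damped_norm_le_of_half_le`). For `θ ≤ 1/2` there is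
a slow mode of rate `cθ = P/ν`, which `v` feels only with a factor `θ` (`damped_norm_right_le`), so
that `v` still gains the parabolic `1/(ν ρ²)` in `L¹` in time. The density gains `1/(ν ρ²) + ν/Q`,
whence the weight `ν min(1/ε², ρ²)`. `frequency_bound` collects this uniformly over the annulus.

The passage to the PDE is delicate because the solution is only a weakly continuous curve of
tempered distributions: neither finiteness of the `L²` norms of its blocks nor their measurability
in time is known. The Duhamel formula is therefore proved by duality. On the support of the block
the symbol matrix agrees with a matrix of Schwartz functions. Testing against its powers applied to
a test function gives a hierarchy of scalar integral equations, whose iterated integration yields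
Taylor polynomials of the exponential and a remainder (`hierarchy_taylor`). The remainder vanishes
by a uniform boundedness argument (`exists_uniform_norm_apply_le`). The polynomials converge
uniformly to the matrix exponential, whose entries are bounded in `norm_exp_systemSymbol_le`; this
gives `enorm_apply_le_of_duhamel`, and duality turns it into an `L²` bound. Young's inequality in
time then concludes (`IsSolution.block_estimate`). -/

theorem normL2_le_of_forall_norm_apply_le {d : ℕ} {T : Distr d} {C : ℝ} (hC : 0 ≤ C)
    (h : ∀ ψ : 𝓢(Space d, ℂ), ‖T ψ‖ ≤ C * ‖ψ.toLp 2‖) : normL2 T ≤ ENNReal.ofReal C := by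
  set e : 𝓢(Space d, ℂ) →ₗ[ℂ] Lp ℂ 2 (volume : Measure (Space d)) :=
    (SchwartzMap.toLpCLM ℂ ℂ 2 (volume : Measure (Space d))).toLinearMap with he
  have hd : DenseRange e := SchwartzMap.denseRange_toLpCLM (p := 2) (by simp)
  set T₀ : 𝓢(Space d, ℂ) →ₗ[ℂ] ℂ :=
    { toFun := fun ψ => T ψ
      map_add' := fun a b => map_add T a b
      map_smul' := fun c a => map_smul T c a } with hT₀
  have hb : ∀ ψ, ‖T₀ ψ‖ ≤ C * ‖e ψ‖ := h
  set ℓ := T₀.extendOfNorm e with hℓ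
  have hext : ∀ ψ, ℓ (e ψ) = T ψ := fun ψ => LinearMap.extendOfNorm_eq hd ⟨C, hb⟩ ψ
  have hnorm : ‖ℓ‖ ≤ C := LinearMap.opNorm_extendOfNorm_le hd hC hb
  -- Riesz represents the functional sesquilinearly, whereas a function acts on Schwartz functions
  -- bilinearly; the representing function is hence the conjugate `star g`.
  set g := (InnerProductSpace.toDual ℂ (Lp ℂ 2 (volume : Measure (Space d)))).symm ℓ with hg
  have hgn : ‖star g‖ = ‖ℓ‖ := by
    rw [← (InnerProductSpace.toDual ℂ (Lp ℂ 2 (volume : Measure (Space d)))).symm.norm_map ℓ, ← hg,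
      Lp.norm_def, Lp.norm_def]
    congr 1
    refine eLpNorm_congr_norm_ae ?_
    filter_upwards [Lp.coeFn_star g] with x hx
    simp [hx]
  have hT : Lp.toTemperedDistribution (star g) = T := by
    ext ψ
    rw [Lp.toTemperedDistribution_apply, ← hext ψ]
    have : ℓ (e ψ) = inner ℂ g (e ψ) := by
      rw [hg, InnerProductSpace.toDual_symm_apply]
    rw [this, L2.inner_def]
    refine integral_congr_ae ?_
    filter_upwards [Lp.coeFn_star g, ψ.coeFn_toLp 2 volume] with x h1 h2
    have h2' : (e ψ : Space d → ℂ) x = ψ x := h2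
    simp [h1, h2']
  refine (iInf₂_le (star g) hT).trans ?_
  rw [← ofReal_norm, hgn]
  exact ENNReal.ofReal_le_ofReal hnorm

/-- This is Cauchy–Schwarz. The infimum defining `normL2` runs over at most one function, by
injectivity of the embedding of `L²`; if there is none the bound is infinite, except for `ψ = 0`,
where both sides vanish. -/
theorem enorm_apply_le_normL2_mul {d : ℕ} (T : Distr d) (ψ : 𝓢(Space d, ℂ)) :
    ‖T ψ‖ₑ ≤ normL2 T * ‖ψ.toLp 2‖ₑ := by
  have key : ∀ f : Lp ℂ 2 (volume : Measure (Space d)), Lp.toTemperedDistribution f = T →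
      ‖T ψ‖ₑ ≤ ‖f‖ₑ * ‖ψ.toLp 2‖ₑ := by
    rintro f rfl
    have h1 : Lp.toTemperedDistribution f ψ = inner ℂ (star (ψ.toLp 2)) f := by
      rw [Lp.toTemperedDistribution_apply, L2.inner_def]
      refine integral_congr_ae ?_
      filter_upwards [Lp.coeFn_star (ψ.toLp 2 volume), ψ.coeFn_toLp 2 volume] with x h1 h2
      simp [h1, h2, mul_comm]
    have h2 : ‖star (ψ.toLp 2 (volume : Measure (Space d)))‖ = ‖ψ.toLp 2 volume‖ := by
      rw [Lp.norm_def, Lp.norm_def]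
      congr 1
      refine eLpNorm_congr_norm_ae ?_
      filter_upwards [Lp.coeFn_star (ψ.toLp 2 volume)] with x hx
      simp [hx]
    rw [h1, ← ofReal_norm, ← ofReal_norm f, ← ofReal_norm,
      ← ENNReal.ofReal_mul (norm_nonneg _)]
    refine ENNReal.ofReal_le_ofReal ((norm_inner_le_norm _ _).trans ?_)
    rw [h2, mul_comm]
  rw [normL2]
  by_cases hne : ∃ f : Lp ℂ 2 (volume : Measure (Space d)), Lp.toTemperedDistribution f = T
  · obtain ⟨f, hf⟩ := hne
    have huniq : ∀ g : Lp ℂ 2 (volume : Measure (Space d)),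
        Lp.toTemperedDistribution g = T → g = f := by
      intro g hg
      have hker := Lp.ker_toTemperedDistributionCLM_eq_bot
        (F := ℂ) (p := 2) (μ := (volume : Measure (Space d)))
      have := LinearMap.ker_eq_bot.mp hker
      exact this (hg.trans hf.symm)
    have : (⨅ (g : Lp ℂ 2 (volume : Measure (Space d)))
        (_ : Lp.toTemperedDistribution g = T), ‖g‖ₑ) = ‖f‖ₑ := by
      refine le_antisymm (iInf₂_le f hf) (le_iInf₂ fun g hg => ?_)
      rw [huniq g hg]
    rw [this]
    exact key f hf
  · push Not at hne
    have : (⨅ (g : Lp ℂ 2 (volume : Measure (Space d)))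
        (_ : Lp.toTemperedDistribution g = T), ‖g‖ₑ) = ⊤ := by
      simp [hne]
    rw [this]
    by_cases h0 : ψ.toLp 2 (volume : Measure (Space d)) = 0
    · have : ψ = 0 := by
        refine SchwartzMap.injective_toLp 2 (volume : Measure (Space d)) ?_
        simpa using h0.trans (SchwartzMap.toLpCLM ℂ ℂ 2 (volume : Measure (Space d))).map_zero.symm
      simp [this]
    · rw [ENNReal.top_mul (by simpa using h0)]
      exact le_top

/-! ### Fourier multipliers on the frequency side -/

/-- By Plancherel, testing `b(D) T` on `𝓕 φ` is testing `𝓕 T` on `b φ`. This and the converse below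
let the whole argument run on the frequency side. -/
theorem enorm_fourier_apply_smul_le {d : ℕ} (b : Space d → ℂ) (T : Distr d)
    (φ : 𝓢(Space d, ℂ)) :
    ‖𝓕 T (SchwartzMap.smulLeftCLM ℂ b φ)‖ₑ
      ≤ normL2 (TemperedDistribution.fourierMultiplierCLM ℂ b T) * ‖φ.toLp 2‖ₑ := by
  have h := enorm_apply_le_normL2_mul (TemperedDistribution.fourierMultiplierCLM ℂ b T) (𝓕 φ)
  rw [TemperedDistribution.fourierMultiplierCLM_apply_apply,
    FourierTransform.fourierInv_fourier_eq] at h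
  rwa [← ofReal_norm (SchwartzMap.toLp (𝓕 φ) 2 volume), SchwartzMap.norm_fourier_toL2_eq,
    ofReal_norm] at h

theorem normL2_fourierMultiplier_le {d : ℕ} {b : Space d → ℂ} {T : Distr d} {C : ℝ} (hC : 0 ≤ C)
    (h : ∀ φ : 𝓢(Space d, ℂ), ‖𝓕 T (SchwartzMap.smulLeftCLM ℂ b φ)‖ ≤ C * ‖φ.toLp 2‖) :
    normL2 (TemperedDistribution.fourierMultiplierCLM ℂ b T) ≤ ENNReal.ofReal C := by
  refine normL2_le_of_forall_norm_apply_le hC fun ψ => ?_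
  rw [TemperedDistribution.fourierMultiplierCLM_apply_apply]
  refine (h (𝓕⁻ ψ)).trans (le_of_eq ?_)
  rw [← SchwartzMap.norm_fourier_toL2_eq (𝓕⁻ ψ), FourierTransform.fourier_fourierInv_eq]

theorem norm_toLp_le_of_forall_norm_le {d : ℕ} {f g : 𝓢(Space d, ℂ)} {c : ℝ}
    (h : ∀ x, ‖f x‖ ≤ c * ‖g x‖) : ‖f.toLp 2‖ ≤ c * ‖g.toLp 2‖ := by
  refine Lp.norm_le_mul_norm_of_ae_le_mul ?_
  filter_upwards [f.coeFn_toLp 2 volume, g.coeFn_toLp 2 volume] with x h1 h2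
  rw [h1, h2]
  exact h x

theorem fourier_fourierMultiplier_apply {d : ℕ} (g : Space d → ℂ) (T : Distr d)
    (φ : 𝓢(Space d, ℂ)) :
    𝓕 (TemperedDistribution.fourierMultiplierCLM ℂ g T) φ
      = 𝓕 T (SchwartzMap.smulLeftCLM ℂ g φ) := by
  rw [TemperedDistribution.fourierMultiplierCLM_apply, FourierTransform.fourier_fourierInv_eq]
  rfl

/-! ### Uniform boundedness along series of Schwartz functions -/

section Series

variable {E : Type*} [NormedAddCommGroup E] [NormedSpace ℝ E]

theorem summable_seminorm_bound {Φ : ℕ → 𝓢(E, ℂ)}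
    (hΦ : ∀ k n, Summable fun m => SchwartzMap.seminorm ℂ k n (Φ m))
    (c : BoundedContinuousFunction ℕ ℂ) (k n : ℕ) :
    Summable fun m => ‖c‖ * SchwartzMap.seminorm ℂ k n (Φ m) :=
  (hΦ k n).mul_left _

theorem norm_iteratedFDeriv_coeff_smul_le {Φ : ℕ → 𝓢(E, ℂ)} (c : BoundedContinuousFunction ℕ ℂ)
    (k n m : ℕ) (x : E) :
    ‖x‖ ^ k * ‖iteratedFDeriv ℝ n (fun y => (c m • Φ m) y) x‖
      ≤ ‖c‖ * SchwartzMap.seminorm ℂ k n (Φ m) := by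
  refine (SchwartzMap.le_seminorm ℂ k n (c m • Φ m) x).trans ?_
  rw [map_smul_eq_mul]
  exact mul_le_mul_of_nonneg_right (c.norm_coe_le_norm m) (apply_nonneg _ _)

theorem norm_iteratedFDeriv_coeff_smul_le' {Φ : ℕ → 𝓢(E, ℂ)}
    (c : BoundedContinuousFunction ℕ ℂ) (n m : ℕ) (x : E) :
    ‖iteratedFDeriv ℝ n (fun y => (c m • Φ m) y) x‖ ≤ ‖c‖ * SchwartzMap.seminorm ℂ 0 n (Φ m) := by
  have h := norm_iteratedFDeriv_coeff_smul_le (Φ := Φ) c 0 n m x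
  rwa [pow_zero, one_mul] at h

/-- The sum of a series of Schwartz functions with bounded coefficients. -/
noncomputable def schwartzSeries {Φ : ℕ → 𝓢(E, ℂ)}
    (hΦ : ∀ k n, Summable fun m => SchwartzMap.seminorm ℂ k n (Φ m))
    (c : BoundedContinuousFunction ℕ ℂ) : 𝓢(E, ℂ) where
  toFun x := ∑' m, (c m • Φ m) x
  smooth' := by
    refine contDiff_tsum (N := (⊤ : ℕ∞)) (v := fun n m => ‖c‖ * SchwartzMap.seminorm ℂ 0 n (Φ m))
      (fun m => (c m • Φ m).smooth ⊤) (fun n _ => summable_seminorm_bound hΦ c 0 n) ?_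
    intro n m x _
    exact norm_iteratedFDeriv_coeff_smul_le' c n m x
  decay' := by
    intro k n
    refine ⟨∑' m, ‖c‖ * SchwartzMap.seminorm ℂ k n (Φ m), fun x => ?_⟩
    rw [iteratedFDeriv_tsum_apply (N := (⊤ : ℕ∞))
      (v := fun n m => ‖c‖ * SchwartzMap.seminorm ℂ 0 n (Φ m))
      (fun m => (c m • Φ m).smooth ⊤) (fun n _ => summable_seminorm_bound hΦ c 0 n)
      (fun n m x _ => norm_iteratedFDeriv_coeff_smul_le' c n m x)
      (by exact_mod_cast le_top)]
    have hs : Summable fun m => ‖iteratedFDeriv ℝ n (fun y => (c m • Φ m) y) x‖ :=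
      Summable.of_nonneg_of_le (fun _ => norm_nonneg _)
        (fun m => norm_iteratedFDeriv_coeff_smul_le' c n m x)
        (summable_seminorm_bound hΦ c 0 n)
    refine (mul_le_mul_of_nonneg_left (norm_tsum_le_tsum_norm hs) (by positivity)).trans ?_
    rw [← tsum_mul_left]
    exact Summable.tsum_le_tsum (fun m => norm_iteratedFDeriv_coeff_smul_le c k n m x)
      (hs.mul_left _) (summable_seminorm_bound hΦ c k n)

theorem schwartzSeries_apply {Φ : ℕ → 𝓢(E, ℂ)}
    (hΦ : ∀ k n, Summable fun m => SchwartzMap.seminorm ℂ k n (Φ m))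
    (c : BoundedContinuousFunction ℕ ℂ) (x : E) :
    schwartzSeries hΦ c x = ∑' m, c m * Φ m x := rfl

theorem summable_coeff_mul_apply {Φ : ℕ → 𝓢(E, ℂ)}
    (hΦ : ∀ k n, Summable fun m => SchwartzMap.seminorm ℂ k n (Φ m))
    (c : BoundedContinuousFunction ℕ ℂ) (x : E) : Summable fun m => c m * Φ m x := by
  refine Summable.of_norm_bounded (summable_seminorm_bound hΦ c 0 0) fun m => ?_
  simpa using norm_iteratedFDeriv_coeff_smul_le (Φ := Φ) c 0 0 m x

theorem seminorm_schwartzSeries_le {Φ : ℕ → 𝓢(E, ℂ)}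
    (hΦ : ∀ k n, Summable fun m => SchwartzMap.seminorm ℂ k n (Φ m))
    (c : BoundedContinuousFunction ℕ ℂ) (k n : ℕ) :
    SchwartzMap.seminorm ℂ k n (schwartzSeries hΦ c)
      ≤ (∑' m, SchwartzMap.seminorm ℂ k n (Φ m)) * ‖c‖ := by
  refine SchwartzMap.seminorm_le_bound ℂ k n _
    (mul_nonneg (tsum_nonneg fun _ => apply_nonneg _ _) (norm_nonneg _)) fun x => ?_
  have hD : iteratedFDeriv ℝ n (schwartzSeries hΦ c) x
      = ∑' m, iteratedFDeriv ℝ n (fun y => (c m • Φ m) y) x :=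
    iteratedFDeriv_tsum_apply (N := (⊤ : ℕ∞))
      (v := fun n m => ‖c‖ * SchwartzMap.seminorm ℂ 0 n (Φ m))
      (fun m => (c m • Φ m).smooth ⊤) (fun n _ => summable_seminorm_bound hΦ c 0 n)
      (fun n m x _ => norm_iteratedFDeriv_coeff_smul_le' c n m x)
      (by exact_mod_cast le_top) x
  rw [hD]
  have hs : Summable fun m => ‖iteratedFDeriv ℝ n (fun y => (c m • Φ m) y) x‖ :=
    Summable.of_nonneg_of_le (fun _ => norm_nonneg _)
      (fun m => norm_iteratedFDeriv_coeff_smul_le' c n m x)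
      (summable_seminorm_bound hΦ c 0 n)
  refine (mul_le_mul_of_nonneg_left (norm_tsum_le_tsum_norm hs) (by positivity)).trans ?_
  rw [← tsum_mul_left, mul_comm, ← tsum_mul_left]
  exact Summable.tsum_le_tsum (fun m => norm_iteratedFDeriv_coeff_smul_le c k n m x)
    (hs.mul_left _) (summable_seminorm_bound hΦ c k n)

/-- The sum of a series of Schwartz functions as a linear function of the coefficients. -/
noncomputable def schwartzSeriesLM {Φ : ℕ → 𝓢(E, ℂ)}
    (hΦ : ∀ k n, Summable fun m => SchwartzMap.seminorm ℂ k n (Φ m)) :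
    BoundedContinuousFunction ℕ ℂ →ₗ[ℂ] 𝓢(E, ℂ) where
  toFun := schwartzSeries hΦ
  map_add' a b := by
    ext x
    rw [add_apply]
    simp only [schwartzSeries_apply, BoundedContinuousFunction.coe_add, Pi.add_apply, add_mul]
    exact (summable_coeff_mul_apply hΦ a x).tsum_add (summable_coeff_mul_apply hΦ b x)
  map_smul' r a := by
    ext x
    rw [RingHom.id_apply, smul_apply]
    simp only [schwartzSeries_apply, BoundedContinuousFunction.coe_smul, smul_eq_mul, mul_assoc]
    exact tsum_mul_left

theorem continuous_schwartzSeriesLM {Φ : ℕ → 𝓢(E, ℂ)}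
    (hΦ : ∀ k n, Summable fun m => SchwartzMap.seminorm ℂ k n (Φ m)) :
    Continuous (schwartzSeriesLM hΦ) := by
  refine WithSeminorms.continuous_normedSpace_dom _ (schwartz_withSeminorms ℂ E ℂ) _ fun i => ?_
  refine ⟨⟨∑' m, SchwartzMap.seminorm ℂ i.1 i.2 (Φ m), tsum_nonneg fun _ => apply_nonneg _ _⟩, ?_⟩
  intro c
  exact seminorm_schwartzSeries_le hΦ c i.1 i.2

/-- Summability of all seminorms makes `c ↦ ∑ c_m Φ_m` continuous from bounded sequences to Schwartz
functions. Composing with `V s` gives functionals on a Banach space, pointwise bounded because `K`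
is compact; Banach–Steinhaus bounds them uniformly, and unit sequences recover each `Φ m`. -/
theorem exists_uniform_norm_apply_le {Φ : ℕ → 𝓢(E, ℂ)}
    (hΦ : ∀ k n, Summable fun m => SchwartzMap.seminorm ℂ k n (Φ m)) {K : Set ℝ} (hK : IsCompact K)
    {V : ℝ → 𝓢'(E, ℂ)} (hV : ∀ ψ : 𝓢(E, ℂ), ContinuousOn (fun s => V s ψ) K) :
    ∃ C, ∀ s ∈ K, ∀ m, ‖V s (Φ m)‖ ≤ C := by
  let W : K → (BoundedContinuousFunction ℕ ℂ →L[ℂ] ℂ) := fun s =>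
    { toFun := fun c => V s (schwartzSeriesLM hΦ c)
      map_add' := fun a b => by rw [map_add, map_add]
      map_smul' := fun r a => by rw [map_smul, map_smul, RingHom.id_apply]
      cont := (map_continuous (V s)).comp (continuous_schwartzSeriesLM hΦ) }
  obtain ⟨C, hC⟩ := banach_steinhaus (g := W) fun c => by
    obtain ⟨C, hC⟩ := hK.exists_bound_of_continuousOn (hV (schwartzSeriesLM hΦ c))
    exact ⟨C, fun s => hC s s.2⟩
  refine ⟨C, fun s hs m => ?_⟩
  let e : BoundedContinuousFunction ℕ ℂ :=
    BoundedContinuousFunction.ofNormedAddCommGroupDiscrete (Pi.single m 1) 1 fun i => by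
      by_cases h : i = m
      · subst h; simp
      · simp [h]
  have he : ‖e‖ ≤ 1 :=
    BoundedContinuousFunction.norm_ofNormedAddCommGroup_le _ zero_le_one _
  have hval : schwartzSeriesLM hΦ e = Φ m := by
    ext x
    change ∑' i, e i * Φ i x = Φ m x
    rw [tsum_eq_single m]
    · simp [e]
    · intro i hi
      simp [e, hi]
  have h := (W ⟨s, hs⟩).le_of_opNorm_le (hC ⟨s, hs⟩) e
  have h0 : 0 ≤ C := (norm_nonneg _).trans (hC ⟨s, hs⟩)
  have h' : ‖V s (Φ m)‖ ≤ C * ‖e‖ := by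
    rw [← hval]
    exact h
  exact h'.trans (by nlinarith)

/-- The sum of the weighted `C^l` seminorms of a Schwartz function. -/
noncomputable def seminormSum (k l : ℕ) (φ : 𝓢(E, ℂ)) : ℝ :=
  ∑ i ∈ Finset.range (l + 1), SchwartzMap.seminorm ℂ k i φ

theorem seminorm_le_seminormSum (k : ℕ) {i l : ℕ} (hi : i ≤ l) (φ : 𝓢(E, ℂ)) :
    SchwartzMap.seminorm ℂ k i φ ≤ seminormSum k l φ :=
  Finset.single_le_sum (f := fun i => SchwartzMap.seminorm ℂ k i φ) (fun _ _ => apply_nonneg _ _)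
    (Finset.mem_range.mpr (Nat.lt_succ_of_le hi))

theorem seminormSum_nonneg (k l : ℕ) (φ : 𝓢(E, ℂ)) : 0 ≤ seminormSum k l φ :=
  Finset.sum_nonneg fun _ _ => apply_nonneg _ _

theorem seminormSum_sum_le (k l : ℕ) {ι : Type*} (s : Finset ι) (φ : ι → 𝓢(E, ℂ)) :
    seminormSum k l (∑ i ∈ s, φ i) ≤ ∑ i ∈ s, seminormSum k l (φ i) := by
  unfold seminormSum
  rw [Finset.sum_comm]
  refine Finset.sum_le_sum fun n _ => ?_
  exact Finset.le_sum_of_subadditive _ (map_zero _).le (fun a b => map_add_le_add _ a b) _ _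

/-- By Leibniz, multiplication by `g` loses neither weight nor derivatives in this norm, since all
orders up to `l` are summed. The bound can thus be iterated, giving geometric growth for the powers
of a symbol. -/
theorem exists_seminormSum_smul_le (g : 𝓢(E, ℂ)) (k l : ℕ) :
    ∃ C, 0 ≤ C ∧ ∀ φ : 𝓢(E, ℂ),
      seminormSum k l (SchwartzMap.smulLeftCLM ℂ g φ) ≤ C * seminormSum k l φ := by
  refine ⟨(l + 1) * (2 ^ l * seminormSum 0 l g), by
    have := seminormSum_nonneg 0 l g
    positivity, fun φ => ?_⟩
  have hG := seminormSum_nonneg 0 l g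
  have hS := seminormSum_nonneg k l φ
  have key : ∀ n ∈ Finset.range (l + 1), SchwartzMap.seminorm ℂ k n
      (SchwartzMap.smulLeftCLM ℂ g φ) ≤ 2 ^ l * seminormSum 0 l g * seminormSum k l φ := by
    intro n hn
    have hnl : n ≤ l := Nat.lt_succ_iff.mp (Finset.mem_range.mp hn)
    refine SchwartzMap.seminorm_le_bound ℂ k n _ (by positivity) fun x => ?_
    rw [SchwartzMap.smulLeftCLM_apply g.hasTemperateGrowth]
    simp only [smul_eq_mul]
    have h := norm_iteratedFDeriv_mul_le (g.smooth ⊤) (φ.smooth ⊤) x (n := n)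
      (by exact_mod_cast le_top)
    calc ‖x‖ ^ k * ‖iteratedFDeriv ℝ n (fun x => g x * φ x) x‖
        ≤ ‖x‖ ^ k * ∑ i ∈ Finset.range (n + 1), (n.choose i : ℝ) * ‖iteratedFDeriv ℝ i g x‖ *
            ‖iteratedFDeriv ℝ (n - i) φ x‖ := by gcongr
      _ = ∑ i ∈ Finset.range (n + 1), (n.choose i : ℝ) * (‖iteratedFDeriv ℝ i g x‖ *
            (‖x‖ ^ k * ‖iteratedFDeriv ℝ (n - i) φ x‖)) := by
          rw [Finset.mul_sum]
          exact Finset.sum_congr rfl fun i _ => by ring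
      _ ≤ ∑ i ∈ Finset.range (n + 1), (n.choose i : ℝ) *
            (seminormSum 0 l g * seminormSum k l φ) := by
          refine Finset.sum_le_sum fun i hi => ?_
          have hil : i ≤ l := (Nat.lt_succ_iff.mp (Finset.mem_range.mp hi)).trans hnl
          have h1 := (SchwartzMap.norm_iteratedFDeriv_le_seminorm ℂ g i x).trans
            (seminorm_le_seminormSum 0 hil g)
          have h2 := (SchwartzMap.le_seminorm ℂ k (n - i) φ x).trans
            (seminorm_le_seminormSum k ((Nat.sub_le n i).trans hnl) φ)
          gcongr
      _ = 2 ^ n * (seminormSum 0 l g * seminormSum k l φ) := by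
          rw [← Finset.sum_mul]
          congr 1
          exact_mod_cast Nat.sum_range_choose n
      _ ≤ 2 ^ l * (seminormSum 0 l g * seminormSum k l φ) := by
          gcongr
          norm_num
      _ = _ := by ring
  refine (Finset.sum_le_sum key).trans (le_of_eq ?_)
  rw [Finset.sum_const, Finset.card_range, nsmul_eq_mul]
  push_cast
  ring

end Series

/-! ### Iterated integration of a hierarchy of integral equations -/

/-- Fubini on the triangle `0 < σ ≤ s ≤ t`. It replaces integration by parts, as `g` is merely
integrable. -/
theorem integral_mul_primitive_eq {f g : ℝ → ℂ} {t : ℝ} (ht : 0 ≤ t) (hf : Continuous f)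
    (hg : IntervalIntegrable g volume 0 t) :
    ∫ s in (0 : ℝ)..t, f s * ∫ σ in (0 : ℝ)..s, g σ
      = ∫ σ in (0 : ℝ)..t, (∫ s in σ..t, f s) * g σ := by
  set μ : Measure ℝ := volume.restrict (Set.Ioc 0 t) with hμ
  have hfi : Integrable f μ := (hf.intervalIntegrable 0 t).1
  have hgi : Integrable g μ := hg.1
  set D : Set (ℝ × ℝ) := {p | p.2 ≤ p.1} with hD
  have hDm : MeasurableSet D := measurableSet_le measurable_snd measurable_fst
  have hint : Integrable (D.indicator fun p : ℝ × ℝ => f p.1 * g p.2) (μ.prod μ) :=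
    (hfi.mul_prod hgi).indicator hDm
  have hswap := integral_integral_swap (f := fun s σ => D.indicator
    (fun p : ℝ × ℝ => f p.1 * g p.2) (s, σ)) hint
  have hL : ∀ s ∈ Set.Ioc 0 t, ∫ σ, D.indicator (fun p : ℝ × ℝ => f p.1 * g p.2) (s, σ) ∂μ
      = f s * ∫ σ in (0 : ℝ)..s, g σ := by
    intro s hs
    have : ∀ σ, D.indicator (fun p : ℝ × ℝ => f p.1 * g p.2) (s, σ)
        = (Set.Iic s).indicator (fun σ => f s * g σ) σ := by
      intro σ
      simp only [Set.indicator, hD, Set.mem_ofPred_eq, Set.mem_Iic]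
    simp only [this]
    rw [integral_indicator measurableSet_Iic, hμ, Measure.restrict_restrict measurableSet_Iic,
      integral_const_mul, intervalIntegral.integral_of_le hs.1.le]
    congr 3
    ext σ
    simp only [Set.mem_inter_iff, Set.mem_Iic, Set.mem_Ioc]
    exact ⟨fun h => ⟨h.2.1, h.1⟩, fun h => ⟨h.2, h.1, h.2.trans hs.2⟩⟩
  have hR : ∀ σ ∈ Set.Ioc 0 t, ∫ s, D.indicator (fun p : ℝ × ℝ => f p.1 * g p.2) (s, σ) ∂μ
      = (∫ s in σ..t, f s) * g σ := by
    intro σ hσ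
    have : ∀ s, D.indicator (fun p : ℝ × ℝ => f p.1 * g p.2) (s, σ)
        = (Set.Ici σ).indicator (fun s => f s * g σ) s := by
      intro s
      simp only [Set.indicator, hD, Set.mem_ofPred_eq, Set.mem_Ici]
    simp only [this]
    rw [integral_indicator measurableSet_Ici, hμ, Measure.restrict_restrict measurableSet_Ici,
      integral_mul_const, intervalIntegral.integral_of_le hσ.2, ← integral_Icc_eq_integral_Ioc]
    congr 3
    ext s
    simp only [Set.mem_inter_iff, Set.mem_Ici, Set.mem_Ioc, Set.mem_Icc]
    exact ⟨fun h => ⟨h.1, h.2.2⟩, fun h => ⟨h.1, hσ.1.trans_le h.1, h.2⟩⟩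
  rw [intervalIntegral.integral_of_le ht, intervalIntegral.integral_of_le ht,
    ← setIntegral_congr_fun measurableSet_Ioc hL, ← setIntegral_congr_fun measurableSet_Ioc hR]
  exact hswap

/-- The kernel `(t - s)^n / n!` of the remainder in Taylor's formula. -/
noncomputable def taylorKernel (t : ℝ) (n : ℕ) (s : ℝ) : ℂ :=
  (((t - s) ^ n / (n.factorial : ℝ) : ℝ) : ℂ)

theorem continuous_taylorKernel (t : ℝ) (n : ℕ) : Continuous (taylorKernel t n) := by
  unfold taylorKernel
  fun_prop

theorem integral_taylorKernel (t : ℝ) (n : ℕ) (σ : ℝ) :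
    ∫ s in σ..t, taylorKernel t n s = taylorKernel t (n + 1) σ := by
  have h : ∀ s ∈ Set.uIcc σ t, HasDerivAt (fun s => -taylorKernel t (n + 1) s)
      (taylorKernel t n s) s := by
    intro s _
    have h1 : HasDerivAt (fun s : ℝ => -((t - s) ^ (n + 1) / ((n + 1).factorial : ℝ)))
        ((t - s) ^ n / (n.factorial : ℝ)) s := by
      have h2 := ((((hasDerivAt_id s).const_sub t).pow (n + 1)).div_const
        ((n + 1).factorial : ℝ)).neg
      convert! h2 using 1
      rw [Nat.factorial_succ]
      have : (n.factorial : ℝ) ≠ 0 := by positivity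
      push_cast
      have h3 : (n : ℝ) + 1 ≠ 0 := by positivity
      simp only [id]
      field_simp
    have := h1.ofReal_comp
    simpa [taylorKernel] using this
  rw [intervalIntegral.integral_eq_sub_of_hasDerivAt h
    ((continuous_taylorKernel t n).intervalIntegrable _ _)]
  simp [taylorKernel]

/-- Taylor's formula for a hierarchy `a n` with `(a n)' = h n + a (n + 1)`. -/
theorem hierarchy_taylor {a h : ℕ → ℝ → ℂ} {t : ℝ} (ht : 0 ≤ t)
    (ha : ∀ n, ContinuousOn (a n) (Set.Icc 0 t))
    (hh : ∀ n, IntervalIntegrable (h n) volume 0 t)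
    (heq : ∀ n, ∀ s ∈ Set.Icc 0 t, a n s = a n 0 + ∫ σ in (0 : ℝ)..s, (h n σ + a (n + 1) σ))
    (n : ℕ) :
    a 0 t = ∑ k ∈ Finset.range (n + 1), taylorKernel t k 0 * a k 0
      + (∫ s in (0 : ℝ)..t, ∑ k ∈ Finset.range (n + 1), taylorKernel t k s * h k s)
      + ∫ s in (0 : ℝ)..t, taylorKernel t n s * a (n + 1) s := by
  have hai : ∀ n, IntervalIntegrable (a n) volume 0 t := fun n =>
    ContinuousOn.intervalIntegrable_of_Icc ht (ha n)
  have hK : ∀ n (g : ℝ → ℂ), IntervalIntegrable g volume 0 t →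
      IntervalIntegrable (fun s => taylorKernel t n s * g s) volume 0 t := fun n g hg =>
    hg.continuousOn_mul (continuous_taylorKernel t n).continuousOn
  have hsum : ∀ n, IntervalIntegrable
      (fun s => ∑ k ∈ Finset.range n, taylorKernel t k s * h k s) volume 0 t := fun n => by
    have := IntervalIntegrable.sum (Finset.range n) fun k _ => hK k _ (hh k)
    convert! this using 1
    ext s
    simp
  induction n with
  | zero =>
    rw [heq 0 t ⟨ht, le_rfl⟩, intervalIntegral.integral_add (hh 0) (hai 1)]
    simp [taylorKernel, add_assoc]
  | succ n ih =>
    -- The remainder is expanded once more: inserting the equation for `a (n + 1)` and exchanging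
    -- integrals raises the order of the kernel by one.
    have hstep : ∫ s in (0 : ℝ)..t, taylorKernel t n s * a (n + 1) s
        = taylorKernel t (n + 1) 0 * a (n + 1) 0
          + (∫ s in (0 : ℝ)..t, taylorKernel t (n + 1) s * h (n + 1) s)
          + ∫ s in (0 : ℝ)..t, taylorKernel t (n + 1) s * a (n + 2) s := by
      have h1 : ∫ s in (0 : ℝ)..t, taylorKernel t n s * a (n + 1) s
          = ∫ s in (0 : ℝ)..t, (taylorKernel t n s * a (n + 1) 0
            + taylorKernel t n s * ∫ σ in (0 : ℝ)..s, (h (n + 1) σ + a (n + 2) σ)) := by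
        refine intervalIntegral.integral_congr fun s hs => ?_
        rw [Set.uIcc_of_le ht] at hs
        rw [heq (n + 1) s hs, mul_add]
      have hgi : IntervalIntegrable (fun σ => h (n + 1) σ + a (n + 2) σ) volume 0 t :=
        (hh _).add (hai _)
      have hprim : ContinuousOn (fun s => ∫ σ in (0 : ℝ)..s, (h (n + 1) σ + a (n + 2) σ))
          (Set.Icc 0 t) := by
        have := intervalIntegral.continuousOn_primitive_interval
          (μ := volume) (f := fun σ => h (n + 1) σ + a (n + 2) σ) (a := 0) (b := t)
          ((intervalIntegrable_iff_integrableOn_Icc_of_le ht).mp hgi |> fun h => by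
            rwa [Set.uIcc_of_le ht])
        rwa [Set.uIcc_of_le ht] at this
      rw [h1, intervalIntegral.integral_add (hK n _ intervalIntegrable_const)
        (hK n _ (ContinuousOn.intervalIntegrable_of_Icc ht hprim)),
        intervalIntegral.integral_mul_const, integral_taylorKernel,
        integral_mul_primitive_eq ht (continuous_taylorKernel t n) hgi]
      simp only [integral_taylorKernel, mul_add]
      rw [intervalIntegral.integral_add (hK _ _ (hh _)) (hK _ _ (hai _)), add_assoc]
    rw [ih, hstep, Finset.sum_range_succ _ (n + 1)]
    simp only [Finset.sum_range_succ _ (n + 1)]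
    rw [intervalIntegral.integral_add (hsum _) (hK _ _ (hh _))]
    ring

theorem norm_taylorKernel_le {t s : ℝ} (hs : s ∈ Set.Icc 0 t) (n : ℕ) :
    ‖taylorKernel t n s‖ ≤ t ^ n / (n.factorial : ℝ) := by
  rw [taylorKernel, Complex.norm_real, Real.norm_eq_abs, abs_of_nonneg]
  · have := hs.1
    have := hs.2
    gcongr
    linarith
  · have : 0 ≤ t - s := by linarith [hs.2]
    positivity

/-- The hypothesis allows `a n` to grow like `n!/(2(t+1))^n`. Against the kernel `t^n/n!` there
remains at most `C (n+1) 2^(-n)`; the base `2(t+1)` is chosen so that `t/(2(t+1)) ≤ 1/2` and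
`1/(2(t+1)) ≤ 1`. -/
theorem tendsto_hierarchy_remainder {a : ℕ → ℝ → ℂ} {t C : ℝ} (ht : 0 ≤ t)
    (hC : ∀ s ∈ Set.Icc 0 t, ∀ n, ‖a n s‖ * ((2 * (t + 1)) ^ n / (n.factorial : ℝ)) ≤ C) :
    Filter.Tendsto (fun n => ∫ s in (0 : ℝ)..t, taylorKernel t n s * a (n + 1) s)
      Filter.atTop (nhds 0) := by
  have hC0 : 0 ≤ C := by
    have := hC 0 ⟨le_rfl, ht⟩ 0
    simp only [pow_zero, Nat.factorial_zero, Nat.cast_one, div_one, mul_one] at this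
    exact (norm_nonneg _).trans this
  have hlim : Filter.Tendsto (fun n : ℕ => C * t * (((n : ℝ) * (1 / 2) ^ n) + (1 / 2) ^ n))
      Filter.atTop (nhds 0) := by
    have h1 := tendsto_self_mul_const_pow_of_lt_one (r := (1 / 2 : ℝ)) (by norm_num) (by norm_num)
    have h2 := tendsto_pow_atTop_nhds_zero_of_lt_one (r := (1 / 2 : ℝ)) (by norm_num) (by norm_num)
    simpa using (h1.add h2).const_mul (C * t)
  refine squeeze_zero_norm (fun n => ?_) hlim
  have hb : ∀ s ∈ Set.uIoc 0 t, ‖taylorKernel t n s * a (n + 1) s‖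
      ≤ C * (((n : ℝ) * (1 / 2) ^ n) + (1 / 2) ^ n) := by
    intro s hs
    rw [Set.uIoc_of_le ht] at hs
    have hs' : s ∈ Set.Icc 0 t := ⟨hs.1.le, hs.2⟩
    have h1 := norm_taylorKernel_le hs' n
    have h2 := hC s hs' (n + 1)
    have hT : 0 < (2 * (t + 1)) ^ (n + 1) / ((n + 1).factorial : ℝ) := by positivity
    have h3 : ‖a (n + 1) s‖ ≤ C / ((2 * (t + 1)) ^ (n + 1) / ((n + 1).factorial : ℝ)) :=
      (le_div_iff₀ hT).mpr h2
    rw [norm_mul]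
    calc ‖taylorKernel t n s‖ * ‖a (n + 1) s‖
        ≤ (t ^ n / (n.factorial : ℝ)) * (C / ((2 * (t + 1)) ^ (n + 1) / ((n + 1).factorial : ℝ))) :=
          mul_le_mul h1 h3 (norm_nonneg _) (by positivity)
      _ = C * ((n + 1) * ((t / (2 * (t + 1))) ^ n * (1 / (2 * (t + 1))))) := by
          rw [Nat.factorial_succ, div_pow, pow_succ]
          have : (n.factorial : ℝ) ≠ 0 := by positivity
          have : t + 1 ≠ 0 := by positivity
          push_cast
          field_simp
      _ ≤ C * ((n + 1) * ((1 / 2) ^ n * 1)) := by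
          have h4 : t / (2 * (t + 1)) ≤ 1 / 2 := by
            rw [div_le_div_iff₀ (by positivity) (by norm_num)]
            linarith
          have h5 : 1 / (2 * (t + 1)) ≤ 1 := by
            rw [div_le_one (by positivity)]
            linarith
          gcongr
      _ = _ := by ring
  refine (intervalIntegral.norm_integral_le_of_norm_le_const hb).trans (le_of_eq ?_)
  rw [sub_zero, abs_of_nonneg ht]
  ring

/-! ### Duhamel's formula for tempered distributions -/

/-- For a non-measurable `N` the integral is a lower integral, attained by some measurable `M ≤ N`.
If a measurable `g` lies below `N`, so does `max M g` almost everywhere; its integral cannot exceed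
the finite integral of `M`, which forces `g ≤ M` almost everywhere. It serves for `N` the block norm
of the forces. -/
theorem exists_measurable_minorant {α : Type*} [MeasurableSpace α] (μ : Measure α)
    {N : α → ℝ≥0∞} (hN : ∫⁻ x, N x ∂μ ≠ ⊤) :
    ∃ M : α → ℝ≥0∞, Measurable M ∧ ∫⁻ x, M x ∂μ = ∫⁻ x, N x ∂μ ∧
      ∀ g : α → ℝ≥0∞, AEMeasurable g μ → (∀ᵐ x ∂μ, g x ≤ N x) → g ≤ᵐ[μ] M := by
  obtain ⟨M, hMm, hMN, hint⟩ := exists_measurable_le_lintegral_eq μ N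
  refine ⟨M, hMm, hint.symm, fun g hg hgN => ?_⟩
  have hle : ∫⁻ x, max (M x) (g x) ∂μ ≤ ∫⁻ x, M x ∂μ := by
    rw [← hint]
    refine lintegral_mono_ae ?_
    filter_upwards [hgN] with x hx
    exact max_le (hMN x) hx
  have heq := ae_eq_of_ae_le_of_lintegral_le (f := M) (g := fun x => max (M x) (g x))
    (Filter.Eventually.of_forall fun x => le_max_left _ _) (hint ▸ hN)
    (hMm.aemeasurable.max hg) hle
  filter_upwards [heq] with x hx
  rw [hx]
  exact le_max_right _ _

/-! ### Uniform convergence of the matrix exponential series on bounded sets. -/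

section Exponential

open scoped Matrix.Norms.Operator

variable {ι : Type*} [Fintype ι] [DecidableEq ι]

theorem norm_entry_le_norm (M : Matrix ι ι ℂ) (i j : ι) : ‖M i j‖ ≤ ‖M‖ := by
  have h : ‖M i j‖₊ ≤ ‖M‖₊ := by
    rw [Matrix.linfty_opNNNorm_def]
    refine le_trans ?_ (Finset.le_sup (f := fun i => ∑ j, ‖M i j‖₊) (Finset.mem_univ i))
    exact Finset.single_le_sum (f := fun j => ‖M i j‖₊) (fun _ _ => zero_le) (Finset.mem_univ j)
  exact h

theorem norm_lt_of_forall_entry_le {M : Matrix ι ι ℂ} {R : ℝ} (hR : 0 ≤ R)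
    (h : ∀ i j, ‖M i j‖ ≤ R) : ‖M‖ < Fintype.card ι * R + 1 := by
  lift R to NNReal using hR
  have h' : ‖M‖₊ ≤ Fintype.card ι * R := by
    rw [Matrix.linfty_opNNNorm_def]
    refine Finset.sup_le fun i _ => ?_
    refine (Finset.sum_le_card_nsmul _ _ R fun j _ => h i j).trans (le_of_eq ?_)
    rw [nsmul_eq_mul, Finset.card_univ]
  have h'' : ‖M‖ ≤ Fintype.card ι * R := by exact_mod_cast h'
  linarith

theorem eventually_norm_exp_series_sub_lt (R : ℝ) (hR : 0 ≤ R) {ε : ℝ} (hε : 0 < ε) :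
    ∀ᶠ n : ℕ in Filter.atTop, ∀ M : Matrix ι ι ℂ, (∀ i j, ‖M i j‖ ≤ R) → ∀ i j,
      ‖∑ k ∈ Finset.range n, ((k.factorial : ℂ))⁻¹ * (M ^ k) i j‖
        ≤ ‖NormedSpace.exp M i j‖ + ε := by
  have h := (NormedSpace.exp_hasFPowerSeriesOnBall (𝕂 := ℂ) (𝔸 := Matrix ι ι ℂ)).tendstoUniformlyOn
    -- Entries bounded by `R` give row sums at most `card ι * R`; the extra `1` puts the matrix
    -- inside the open ball.
    (r' := ⟨Fintype.card ι * R + 1, by positivity⟩) ENNReal.coe_lt_top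
  rw [Metric.tendstoUniformlyOn_iff] at h
  filter_upwards [h ε hε] with n hn M hM i j
  have h1 := hn M (by
    rw [mem_ball_zero_iff]
    exact norm_lt_of_forall_entry_le hR hM)
  rw [zero_add, dist_eq_norm] at h1
  have h2 : (FormalMultilinearSeries.partialSum (NormedSpace.expSeries ℂ (Matrix ι ι ℂ)) n M) i j
      = ∑ k ∈ Finset.range n, ((k.factorial : ℂ))⁻¹ * (M ^ k) i j := by
    simp only [FormalMultilinearSeries.partialSum, NormedSpace.expSeries_apply_eq]
    rw [Matrix.sum_apply]
    rfl
  have h3 : ‖NormedSpace.exp M i j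
      - ∑ k ∈ Finset.range n, ((k.factorial : ℂ))⁻¹ * (M ^ k) i j‖ ≤ ε := by
    rw [← h2]
    exact (norm_entry_le_norm (NormedSpace.exp M
      - FormalMultilinearSeries.partialSum (NormedSpace.expSeries ℂ (Matrix ι ι ℂ)) n M) i j).trans
      h1.le
  have h4 := norm_sub_norm_le (∑ k ∈ Finset.range n, ((k.factorial : ℂ))⁻¹ * (M ^ k) i j)
    (NormedSpace.exp M i j)
  rw [norm_sub_rev] at h4
  linarith

end Exponential

/-! ### Powers of the symbol matrix acting on test functions. -/

section Iterates

variable {d : ℕ} {ι : Type*} [Fintype ι] [DecidableEq ι]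

/-- The row vectors obtained from the `α`-th multiple of `φ` by the powers of the matrix `g`. -/
noncomputable def symbolIterate (g : ι → ι → 𝓢(Space d, ℂ)) (α : ι) (φ : 𝓢(Space d, ℂ)) :
    ℕ → ι → 𝓢(Space d, ℂ)
  | 0 => Pi.single α φ
  | n + 1 => fun γ => ∑ β, SchwartzMap.smulLeftCLM ℂ (g β γ) (symbolIterate g α φ n β)

/-- The matrix of values of the symbols. -/
noncomputable def symbolMatrix (g : ι → ι → 𝓢(Space d, ℂ)) (x : Space d) : Matrix ι ι ℂ :=
  Matrix.of fun i j => g i j x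

theorem symbolIterate_apply (g : ι → ι → 𝓢(Space d, ℂ)) (α : ι) (φ : 𝓢(Space d, ℂ)) (n : ℕ)
    (β : ι) (x : Space d) :
    symbolIterate g α φ n β x = (symbolMatrix g x ^ n) α β * φ x := by
  induction n generalizing β with
  | zero =>
    by_cases h : β = α
    · subst h; simp [symbolIterate]
    · simp [symbolIterate, h, Matrix.one_apply_ne (Ne.symm h)]
  | succ n ih =>
    rw [symbolIterate, sum_apply, pow_succ, Matrix.mul_apply, Finset.sum_mul]
    refine Finset.sum_congr rfl fun γ _ => ?_
    rw [SchwartzMap.smulLeftCLM_apply_apply (g γ β).hasTemperateGrowth, ih, symbolMatrix,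
      Matrix.of_apply, smul_eq_mul]
    ring

theorem exists_seminormSum_symbolIterate_le (g : ι → ι → 𝓢(Space d, ℂ)) (k l : ℕ) :
    ∃ C, 0 ≤ C ∧ ∀ (α : ι) (φ : 𝓢(Space d, ℂ)) (n : ℕ) (β : ι),
      seminormSum k l (symbolIterate g α φ n β) ≤ C ^ n * seminormSum k l φ := by
  choose C hC0 hC using fun β γ => exists_seminormSum_smul_le (g β γ) k l
  have hCs : ∀ γ, ∑ β, C β γ ≤ ∑ γ, ∑ β, C β γ := fun γ =>
    Finset.single_le_sum (f := fun γ => ∑ β, C β γ)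
      (fun _ _ => Finset.sum_nonneg fun _ _ => hC0 _ _) (Finset.mem_univ γ)
  have hC1 : 0 ≤ ∑ γ, ∑ β, C β γ := Finset.sum_nonneg fun _ _ => Finset.sum_nonneg fun _ _ => hC0 _ _
  refine ⟨∑ γ, ∑ β, C β γ, hC1, fun α φ n => ?_⟩
  have hφ := seminormSum_nonneg k l φ
  induction n with
  | zero =>
    intro β
    by_cases h : β = α
    · subst h; simp [symbolIterate]
    · simpa [symbolIterate, h, seminormSum] using hφ
  | succ n ih =>
    intro γ
    rw [symbolIterate]
    calc _ ≤ ∑ β, seminormSum k l (SchwartzMap.smulLeftCLM ℂ (g β γ) (symbolIterate g α φ n β)) :=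
          seminormSum_sum_le _ _ _ _
      _ ≤ ∑ β, C β γ * ((∑ γ, ∑ β, C β γ) ^ n * seminormSum k l φ) :=
          Finset.sum_le_sum fun β _ => (hC β γ _).trans
            (mul_le_mul_of_nonneg_left (ih β) (hC0 _ _))
      _ = (∑ β, C β γ) * ((∑ γ, ∑ β, C β γ) ^ n * seminormSum k l φ) := by rw [Finset.sum_mul]
      _ ≤ (∑ γ, ∑ β, C β γ) * ((∑ γ, ∑ β, C β γ) ^ n * seminormSum k l φ) := by
          exact mul_le_mul_of_nonneg_right (hCs γ) (mul_nonneg (pow_nonneg hC1 _) hφ)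
      _ = _ := by ring

/-- The iterates grow at most geometrically in each seminorm, so the factor `T^n / n!` makes the
series converge as an exponential series. This is the input of `exists_uniform_norm_apply_le`. -/
theorem summable_seminorm_symbolIterate (g : ι → ι → 𝓢(Space d, ℂ)) (b : 𝓢(Space d, ℂ)) (α β : ι)
    (φ : 𝓢(Space d, ℂ)) (T : ℝ) (hT : 0 ≤ T) (k l : ℕ) :
    Summable fun n : ℕ => SchwartzMap.seminorm ℂ k l
      (((T ^ n / (n.factorial : ℝ) : ℝ) : ℂ) • SchwartzMap.smulLeftCLM ℂ b
        (symbolIterate g α φ n β)) := by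
  obtain ⟨C, hC0, hC⟩ := exists_seminormSum_symbolIterate_le g k l
  obtain ⟨B, hB0, hB⟩ := exists_seminormSum_smul_le b k l
  have hs : Summable fun n : ℕ => (B * seminormSum k l φ) * ((T * C) ^ n / (n.factorial : ℝ)) :=
    (Real.summable_pow_div_factorial (T * C)).mul_left _
  refine Summable.of_nonneg_of_le (fun _ => apply_nonneg _ _) (fun n => ?_) hs
  rw [map_smul_eq_mul, Complex.norm_real, Real.norm_eq_abs, abs_of_nonneg (by positivity)]
  calc _ ≤ T ^ n / (n.factorial : ℝ) * (B * (C ^ n * seminormSum k l φ)) := by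
        gcongr
        exact (seminorm_le_seminormSum k le_rfl _).trans ((hB _).trans
          (mul_le_mul_of_nonneg_left (hC α φ n β) hB0))
    _ = _ := by rw [mul_pow]; ring

end Iterates

/-! ### Partial sums of the propagator and the hierarchy of integral equations. -/

section Duhamel

open scoped Matrix.Norms.Operator

theorem exists_norm_symbolMatrix_le {d : ℕ} {ι : Type*} [Fintype ι]
    (g : ι → ι → 𝓢(Space d, ℂ)) :
    ∃ R, 0 ≤ R ∧ ∀ x i j, ‖symbolMatrix g x i j‖ ≤ R := by
  refine ⟨∑ i, ∑ j, SchwartzMap.seminorm ℂ 0 0 (g i j),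
    Finset.sum_nonneg fun _ _ => Finset.sum_nonneg fun _ _ => apply_nonneg _ _, fun x i j => ?_⟩
  rw [symbolMatrix, Matrix.of_apply]
  refine (SchwartzMap.norm_le_seminorm ℂ (g i j) x).trans ?_
  refine (Finset.single_le_sum (f := fun j => SchwartzMap.seminorm ℂ 0 0 (g i j))
    (fun _ _ => apply_nonneg _ _) (Finset.mem_univ j)).trans ?_
  exact Finset.single_le_sum (f := fun i => ∑ j, SchwartzMap.seminorm ℂ 0 0 (g i j))
    (fun _ _ => Finset.sum_nonneg fun _ _ => apply_nonneg _ _) (Finset.mem_univ i)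

variable {d : ℕ} {ι : Type*} [Fintype ι] [DecidableEq ι]

/-- The partial sum of order `n` of the exponential of `(t - s) g`, applied to `φ`. -/
noncomputable def propagatorSum (g : ι → ι → 𝓢(Space d, ℂ)) (α : ι) (φ : 𝓢(Space d, ℂ)) (t : ℝ)
    (n : ℕ) (s : ℝ) (β : ι) : 𝓢(Space d, ℂ) :=
  ∑ k ∈ Finset.range n, taylorKernel t k s • symbolIterate g α φ k β

theorem propagatorSum_apply (g : ι → ι → 𝓢(Space d, ℂ)) (α : ι) (φ : 𝓢(Space d, ℂ)) (t : ℝ)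
    (n : ℕ) (s : ℝ) (β : ι) (x : Space d) :
    propagatorSum g α φ t n s β x
      = (∑ k ∈ Finset.range n, ((k.factorial : ℂ))⁻¹ *
          (((t - s) • symbolMatrix g x) ^ k) α β) * φ x := by
  rw [propagatorSum, sum_apply, Finset.sum_mul]
  refine Finset.sum_congr rfl fun k _ => ?_
  rw [smul_apply, symbolIterate_apply, smul_pow, Matrix.smul_apply, taylorKernel,
    Complex.real_smul, smul_eq_mul]
  push_cast
  ring

/-- The cut-off `c` confines the test function to frequencies where the exponential is controlled;
there the partial sums differ from it by at most `ε`, uniformly in frequency and time because the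
symbols are bounded. -/
theorem eventually_norm_propagatorSum_le (g : ι → ι → 𝓢(Space d, ℂ)) (α : ι)
    {c : 𝓢(Space d, ℂ)} (hc : ∀ x, ‖c x‖ ≤ 1) (φ : 𝓢(Space d, ℂ)) {t : ℝ}
    {k : ι → ℝ → ℝ} (hk0 : ∀ β, ∀ τ ∈ Set.Icc 0 t, 0 ≤ k β τ)
    (hk : ∀ x, c x ≠ 0 → ∀ τ ∈ Set.Icc 0 t, ∀ β,
      ‖NormedSpace.exp (τ • symbolMatrix g x) α β‖ ≤ k β τ) {ε : ℝ} (hε : 0 < ε) :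
    ∀ᶠ n : ℕ in Filter.atTop, ∀ s ∈ Set.Icc 0 t, ∀ β,
      ‖(propagatorSum g α (SchwartzMap.smulLeftCLM ℂ c φ) t n s β).toLp 2‖
        ≤ (k β (t - s) + ε) * ‖φ.toLp 2‖ := by
  obtain ⟨R, hR0, hR⟩ := exists_norm_symbolMatrix_le g
  filter_upwards [eventually_norm_exp_series_sub_lt (ι := ι) (|t| * R) (by positivity) hε]
    with n hn s hs β
  have hτ : t - s ∈ Set.Icc 0 t := ⟨by linarith [hs.2], by linarith [hs.1]⟩
  refine norm_toLp_le_of_forall_norm_le fun x => ?_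
  rw [propagatorSum_apply, norm_mul, SchwartzMap.smulLeftCLM_apply_apply c.hasTemperateGrowth,
    smul_eq_mul, norm_mul]
  have hk0' := hk0 β _ hτ
  by_cases hcx : c x = 0
  · rw [hcx]
    simp only [norm_zero, zero_mul, mul_zero]
    positivity
  · have h1 := hn ((t - s) • symbolMatrix g x) (fun i j => by
      rw [Matrix.smul_apply, norm_smul, Real.norm_eq_abs, abs_of_nonneg hτ.1]
      gcongr
      · exact hτ.2.trans (le_abs_self t)
      · exact hR x i j) α β
    have h2 := hk x hcx _ hτ β
    have h3 : ‖c x‖ * ‖φ x‖ ≤ ‖φ x‖ := mul_le_of_le_one_left (norm_nonneg _) (hc x)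
    exact mul_le_mul (by linarith) h3 (by positivity) (by positivity)

/-- Each use of the equation multiplies the row of test functions by `A` on the right. In front of
`b` the symbol `A` may be replaced by the Schwartz matrix `g`, which produces the next iterate. -/
theorem symbolIterate_hierarchy {t : ℝ} {V H : ℝ → ι → Distr d} {A : ι → ι → Space d → ℂ}
    (hA : ∀ i j, (A i j).HasTemperateGrowth)
    (hVc : ∀ i (ψ : 𝓢(Space d, ℂ)), ContinuousOn (fun s => V s i ψ) (Set.Icc 0 t))
    (hH : ∀ i (ψ : 𝓢(Space d, ℂ)), IntervalIntegrable (fun s => H s i ψ) volume 0 t)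
    (heq : ∀ i (ψ : 𝓢(Space d, ℂ)), ∀ s ∈ Set.Icc 0 t, V s i ψ = V 0 i ψ
      + ∫ σ in (0 : ℝ)..s, (H σ i ψ + ∑ j, V σ j (SchwartzMap.smulLeftCLM ℂ (A i j) ψ)))
    {g : ι → ι → 𝓢(Space d, ℂ)} {b : 𝓢(Space d, ℂ)}
    (hbA : ∀ i j x, b x * A i j x = b x * g i j x) (α : ι) (φ : 𝓢(Space d, ℂ)) (n : ℕ)
    {s : ℝ} (hs : s ∈ Set.Icc 0 t) :
    ∑ β, V s β (SchwartzMap.smulLeftCLM ℂ b (symbolIterate g α φ n β))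
      = ∑ β, V 0 β (SchwartzMap.smulLeftCLM ℂ b (symbolIterate g α φ n β))
        + ∫ σ in (0 : ℝ)..s,
          (∑ β, H σ β (SchwartzMap.smulLeftCLM ℂ b (symbolIterate g α φ n β))
          + ∑ β, V σ β (SchwartzMap.smulLeftCLM ℂ b (symbolIterate g α φ (n + 1) β))) := by
  have hsub : Set.uIcc 0 s ⊆ Set.uIcc 0 t := by
    rw [Set.uIcc_of_le hs.1, Set.uIcc_of_le (hs.1.trans hs.2)]
    exact Set.Icc_subset_Icc_right hs.2
  have hVi : ∀ j (ψ : 𝓢(Space d, ℂ)), IntervalIntegrable (fun σ => V σ j ψ) volume 0 s :=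
    fun j ψ => ContinuousOn.intervalIntegrable_of_Icc hs.1
      ((hVc j ψ).mono (Set.Icc_subset_Icc_right hs.2))
  have hint : ∀ i (ψ : 𝓢(Space d, ℂ)), IntervalIntegrable
      (fun σ => H σ i ψ + ∑ j, V σ j (SchwartzMap.smulLeftCLM ℂ (A i j) ψ)) volume 0 s := by
    intro i ψ
    refine ((hH i ψ).mono_set hsub).add ?_
    have := IntervalIntegrable.sum (Finset.univ : Finset ι)
      fun j _ => hVi j (SchwartzMap.smulLeftCLM ℂ (A i j) ψ)
    convert! this using 1
    ext σ
    simp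
  rw [Finset.sum_congr rfl fun β _ => heq β _ s hs, Finset.sum_add_distrib,
    ← intervalIntegral.integral_finsetSum fun β _ => hint β _]
  congr 1
  refine intervalIntegral.integral_congr fun σ _ => ?_
  simp only [Finset.sum_add_distrib]
  congr 1
  rw [Finset.sum_comm]
  refine Finset.sum_congr rfl fun γ _ => ?_
  rw [symbolIterate, map_sum, map_sum]
  refine Finset.sum_congr rfl fun β _ => ?_
  congr 1
  ext x
  rw [SchwartzMap.smulLeftCLM_apply_apply (hA β γ),
    SchwartzMap.smulLeftCLM_apply_apply b.hasTemperateGrowth,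
    SchwartzMap.smulLeftCLM_apply_apply b.hasTemperateGrowth,
    SchwartzMap.smulLeftCLM_apply_apply (g β γ).hasTemperateGrowth]
  simp only [smul_eq_mul]
  linear_combination (symbolIterate g α φ n β x) * hbA β γ x

end Duhamel

/-! ### The Duhamel bound for tempered distributions, by duality. -/

section DuhamelBound

open scoped Matrix.Norms.Operator

variable {d : ℕ} {ι : Type*} [Fintype ι] [DecidableEq ι]

theorem sum_taylorKernel_mul_apply (W : ι → Distr d) (g : ι → ι → 𝓢(Space d, ℂ))
    (b : 𝓢(Space d, ℂ)) (α : ι) (φ : 𝓢(Space d, ℂ)) (t : ℝ) (n : ℕ) (s : ℝ) :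
    ∑ k ∈ Finset.range n, taylorKernel t k s *
        ∑ β, W β (SchwartzMap.smulLeftCLM ℂ b (symbolIterate g α φ k β))
      = ∑ β, W β (SchwartzMap.smulLeftCLM ℂ b (propagatorSum g α φ t n s β)) := by
  simp only [propagatorSum, map_sum, map_smul, Finset.mul_sum, smul_eq_mul]
  rw [Finset.sum_comm]

theorem tendsto_symbolIterate_remainder {t : ℝ} (ht : 0 ≤ t) {V : ℝ → ι → Distr d}
    (hVc : ∀ i (ψ : 𝓢(Space d, ℂ)), ContinuousOn (fun s => V s i ψ) (Set.Icc 0 t))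
    (g : ι → ι → 𝓢(Space d, ℂ)) (b : 𝓢(Space d, ℂ)) (α : ι) (φ : 𝓢(Space d, ℂ)) :
    Filter.Tendsto (fun n => ∫ s in (0 : ℝ)..t, taylorKernel t n s *
        ∑ β, V s β (SchwartzMap.smulLeftCLM ℂ b (symbolIterate g α φ (n + 1) β)))
      Filter.atTop (nhds 0) := by
  have hT : (0 : ℝ) ≤ 2 * (t + 1) := by positivity
  have hC : ∀ β, ∃ C, ∀ s ∈ Set.Icc 0 t, ∀ n : ℕ,
      ‖V s β ((((2 * (t + 1)) ^ n / (n.factorial : ℝ) : ℝ) : ℂ) •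
        SchwartzMap.smulLeftCLM ℂ b (symbolIterate g α φ n β))‖ ≤ C := fun β =>
    exists_uniform_norm_apply_le (summable_seminorm_symbolIterate g b α β φ (2 * (t + 1)) hT)
      isCompact_Icc (V := fun s => V s β) (hVc β)
  choose C hC using hC
  refine tendsto_hierarchy_remainder (C := ∑ β, C β) (t := t)
    (a := fun n s => ∑ β, V s β (SchwartzMap.smulLeftCLM ℂ b (symbolIterate g α φ n β)))
    ht fun s hs n => ?_
  refine (mul_le_mul_of_nonneg_right (norm_sum_le _ _) (by positivity)).trans ?_
  rw [Finset.sum_mul]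
  refine Finset.sum_le_sum fun β _ => ?_
  refine le_trans (le_of_eq ?_) (hC β s hs n)
  rw [map_smul, norm_smul, Complex.norm_real, Real.norm_eq_abs, abs_of_nonneg (by positivity),
    mul_comm]

theorem enorm_apply_le_of_duhamel {t : ℝ} (ht : 0 ≤ t) {V H : ℝ → ι → Distr d}
    {A : ι → ι → Space d → ℂ} (hA : ∀ i j, (A i j).HasTemperateGrowth)
    (hVc : ∀ i (ψ : 𝓢(Space d, ℂ)), ContinuousOn (fun s => V s i ψ) (Set.Icc 0 t))
    (hH : ∀ i (ψ : 𝓢(Space d, ℂ)), IntervalIntegrable (fun s => H s i ψ) volume 0 t)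
    (heq : ∀ i (ψ : 𝓢(Space d, ℂ)), ∀ s ∈ Set.Icc 0 t, V s i ψ = V 0 i ψ
      + ∫ σ in (0 : ℝ)..s, (H σ i ψ + ∑ j, V σ j (SchwartzMap.smulLeftCLM ℂ (A i j) ψ)))
    {g : ι → ι → 𝓢(Space d, ℂ)} {b c : 𝓢(Space d, ℂ)}
    (hbA : ∀ i j x, b x * A i j x = b x * g i j x) (hbc : ∀ x, b x * c x = b x)
    (hc : ∀ x, ‖c x‖ ≤ 1) (α : ι) {k : ι → ℝ → ℝ}
    (hkm : ∀ β, Measurable (k β)) (hk0 : ∀ β, ∀ τ ∈ Set.Icc 0 t, 0 ≤ k β τ)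
    (hk : ∀ x, c x ≠ 0 → ∀ τ ∈ Set.Icc 0 t, ∀ β,
      ‖NormedSpace.exp (τ • symbolMatrix g x) α β‖ ≤ k β τ)
    {N₀ : ι → ℝ≥0∞} (hN₀ : ∀ β (φ : 𝓢(Space d, ℂ)),
      ‖V 0 β (SchwartzMap.smulLeftCLM ℂ b φ)‖ₑ ≤ N₀ β * ‖φ.toLp 2‖ₑ) (hN₀f : ∀ β, N₀ β ≠ ⊤)
    {N M : ι → ℝ → ℝ≥0∞} (hN : ∀ β s (φ : 𝓢(Space d, ℂ)),
      ‖H s β (SchwartzMap.smulLeftCLM ℂ b φ)‖ₑ ≤ N β s * ‖φ.toLp 2‖ₑ)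
    (hMm : ∀ β, Measurable (M β))
    (hMf : ∀ β, ∫⁻ s in Set.Ioc 0 t, M β s ≠ ⊤)
    (hM : ∀ β (f : ℝ → ℝ≥0∞), AEMeasurable f (volume.restrict (Set.Ioc 0 t)) →
      (∀ᵐ s ∂(volume.restrict (Set.Ioc 0 t)), f s ≤ N β s) →
      f ≤ᵐ[volume.restrict (Set.Ioc 0 t)] M β)
    (φ : 𝓢(Space d, ℂ)) :
    ‖V t α (SchwartzMap.smulLeftCLM ℂ b φ)‖ₑ
      ≤ (∑ β, (N₀ β * ENNReal.ofReal (k β t)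
          + ∫⁻ s in Set.Ioc 0 t, M β s * ENNReal.ofReal (k β (t - s)))) * ‖φ.toLp 2‖ₑ := by
  set μ : Measure ℝ := volume.restrict (Set.Ioc 0 t) with hμ
  set φc : 𝓢(Space d, ℂ) := SchwartzMap.smulLeftCLM ℂ c φ with hφc
  set X : ℝ≥0∞ := ‖φ.toLp 2 (volume : Measure (Space d))‖ₑ with hX
  have hXf : X ≠ ⊤ := enorm_ne_top
  -- Since `c = 1` wherever `b ≠ 0`, the test function can be localized in frequency at no cost.
  have hbφ : SchwartzMap.smulLeftCLM ℂ b φ = SchwartzMap.smulLeftCLM ℂ b φc := by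
    ext x
    rw [hφc, SchwartzMap.smulLeftCLM_apply_apply b.hasTemperateGrowth,
      SchwartzMap.smulLeftCLM_apply_apply b.hasTemperateGrowth,
      SchwartzMap.smulLeftCLM_apply_apply c.hasTemperateGrowth]
    simp only [smul_eq_mul]
    rw [← mul_assoc, hbc]
  set D : ℝ≥0∞ := (∑ β, (N₀ β + ∫⁻ s, M β s ∂μ)) * X + 1 with hD
  have hDf : D ≠ ⊤ := by
    refine ENNReal.add_ne_top.mpr ⟨ENNReal.mul_ne_top ?_ hXf, ENNReal.one_ne_top⟩
    exact ENNReal.sum_ne_top.mpr fun β _ => ENNReal.add_ne_top.mpr ⟨hN₀f β, hMf β⟩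
  -- One order `n` makes both the Taylor remainder and the error of the exponential series at most
  -- `ε`. The finite constant `D` gathers everything multiplied by `ε`, which then tends to `0`.
  have key : ∀ ε : ℝ, 0 < ε → ‖V t α (SchwartzMap.smulLeftCLM ℂ b φ)‖ₑ
      ≤ (∑ β, (N₀ β * ENNReal.ofReal (k β t)
          + ∫⁻ s, M β s * ENNReal.ofReal (k β (t - s)) ∂μ)) * X + ENNReal.ofReal ε * D := by
    intro ε hε
    have hrem := tendsto_symbolIterate_remainder ht hVc g b α φc
    have hprop := eventually_norm_propagatorSum_le g α hc φ hk0 hk hε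
    have hev := (Metric.tendsto_nhds.mp hrem ε hε).and
      ((Filter.tendsto_add_atTop_nat 1).eventually hprop)
    obtain ⟨n, hn1, hn2⟩ := hev.exists
    rw [dist_zero_right] at hn1
    have hnorm : ∀ s ∈ Set.Icc 0 t, ∀ β, ‖(propagatorSum g α φc t (n + 1) s β).toLp 2‖ₑ
        ≤ (ENNReal.ofReal (k β (t - s)) + ENNReal.ofReal ε) * X := by
      intro s hs β
      have hk0' := hk0 β (t - s) ⟨by linarith [hs.2], by linarith [hs.1]⟩
      rw [hX, ← ofReal_norm, ← ofReal_norm, ← ENNReal.ofReal_add hk0' hε.le,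
        ← ENNReal.ofReal_mul (by positivity)]
      exact ENNReal.ofReal_le_ofReal (hn2 s hs β)
    have htaylor := hierarchy_taylor (t := t) ht
      (a := fun n s => ∑ β, V s β (SchwartzMap.smulLeftCLM ℂ b (symbolIterate g α φc n β)))
      (h := fun n s => ∑ β, H s β (SchwartzMap.smulLeftCLM ℂ b (symbolIterate g α φc n β)))
      (fun n => continuousOn_finsetSum _ fun β _ => hVc β _)
      (fun n => by
        have := IntervalIntegrable.sum (Finset.univ : Finset ι)
          fun β _ => hH β (SchwartzMap.smulLeftCLM ℂ b (symbolIterate g α φc n β))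
        convert! this using 1
        ext σ
        simp)
      (fun n s hs => symbolIterate_hierarchy hA hVc hH heq hbA α φc n hs) n
    have h0 : ∑ β, V t β (SchwartzMap.smulLeftCLM ℂ b (symbolIterate g α φc 0 β))
        = V t α (SchwartzMap.smulLeftCLM ℂ b φ) := by
      rw [Finset.sum_eq_single α]
      · rw [symbolIterate, Pi.single_eq_same, hbφ]
      · intro β _ hβ
        rw [symbolIterate, Pi.single_eq_of_ne hβ, map_zero, map_zero]
      · simp
    simp only [sum_taylorKernel_mul_apply] at htaylor
    rw [h0] at htaylor
    rw [htaylor]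
    have hI : ‖∑ β, V 0 β (SchwartzMap.smulLeftCLM ℂ b
          (propagatorSum g α φc t (n + 1) 0 β))‖ₑ
        ≤ ∑ β, N₀ β * ((ENNReal.ofReal (k β t) + ENNReal.ofReal ε) * X) := by
      refine (enorm_sum_le _ _).trans (Finset.sum_le_sum fun β _ => ?_)
      refine (hN₀ β _).trans ?_
      gcongr
      simpa using hnorm 0 ⟨le_rfl, ht⟩ β
    have hII : ‖∫ s in (0 : ℝ)..t, ∑ β, H s β (SchwartzMap.smulLeftCLM ℂ b
          (propagatorSum g α φc t (n + 1) s β))‖ₑ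
        ≤ ∑ β, ∫⁻ s, M β s * ((ENNReal.ofReal (k β (t - s)) + ENNReal.ofReal ε) * X) ∂μ := by
      rw [intervalIntegral.integral_of_le ht]
      refine (enorm_integral_le_lintegral_enorm _).trans ?_
      rw [← lintegral_finsetSum' _ fun β _ => ?_]
      · refine lintegral_mono_ae ?_
        have hall : ∀ β, ∀ᵐ s ∂μ, ‖H s β (SchwartzMap.smulLeftCLM ℂ b
            (propagatorSum g α φc t (n + 1) s β))‖ₑ
            ≤ M β s * ((ENNReal.ofReal (k β (t - s)) + ENNReal.ofReal ε) * X) := by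
          intro β
          set m : ℝ → ℝ≥0∞ := fun s => (ENNReal.ofReal (k β (t - s)) + ENNReal.ofReal ε) * X
            with hm
          have hmm : Measurable m := by
            have := (hkm β).comp (measurable_const.sub measurable_id : Measurable fun s => t - s)
            exact (this.ennreal_ofReal.add_const _).mul_const _
          have hmf : ∀ s, m s ≠ ⊤ := fun s => ENNReal.mul_ne_top
            (ENNReal.add_ne_top.mpr ⟨ENNReal.ofReal_ne_top, ENNReal.ofReal_ne_top⟩) hXf
          have hfm : AEMeasurable (fun s => ‖H s β (SchwartzMap.smulLeftCLM ℂ b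
              (propagatorSum g α φc t (n + 1) s β))‖ₑ) μ := by
            simp only [propagatorSum, map_sum, map_smul]
            refine AEMeasurable.enorm ?_
            refine Finset.aemeasurable_fun_sum _ fun i _ => ?_
            exact (continuous_taylorKernel t i).measurable.aemeasurable.smul
              (hH β _).1.aestronglyMeasurable.aemeasurable
          have hle : ∀ᵐ s ∂μ, ‖H s β (SchwartzMap.smulLeftCLM ℂ b
              (propagatorSum g α φc t (n + 1) s β))‖ₑ ≤ N β s * m s := by
            filter_upwards [ae_restrict_mem measurableSet_Ioc] with s hs
            refine (hN β s _).trans ?_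
            gcongr
            exact hnorm s ⟨hs.1.le, hs.2⟩ β
          -- Dividing by `m` gives a measurable function below `N β`, which passes below the
          -- minorant `M β`. Where `m` vanishes, the original bound already gives zero.
          have := hM β _ (hfm.div hmm.aemeasurable)
            (by filter_upwards [hle] with s hs using ENNReal.div_le_of_le_mul hs)
          filter_upwards [this, hle] with s h1 h2
          by_cases hz : m s = 0
          · rw [hz, mul_zero] at h2
            exact h2.trans zero_le
          · exact (ENNReal.div_le_iff hz (hmf s)).mp h1
        filter_upwards [Filter.eventually_all.mpr hall] with s hs
        exact (enorm_sum_le _ _).trans (Finset.sum_le_sum fun β _ => hs β)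
      · have := (hkm β).comp (measurable_const.sub measurable_id : Measurable fun s => t - s)
        exact ((hMm β).mul ((this.ennreal_ofReal.add_const _).mul_const _)).aemeasurable
    have hIII : ‖∫ s in (0 : ℝ)..t, taylorKernel t n s * ∑ β, V s β
        (SchwartzMap.smulLeftCLM ℂ b (symbolIterate g α φc (n + 1) β))‖ₑ ≤ ENNReal.ofReal ε := by
      rw [← ofReal_norm]
      exact ENNReal.ofReal_le_ofReal hn1.le
    refine (enorm_add_le _ _).trans ((add_le_add ((enorm_add_le _ _).trans
      (add_le_add hI hII)) hIII).trans (le_of_eq ?_))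
    have hsplit : ∀ β, ∫⁻ s, M β s * ((ENNReal.ofReal (k β (t - s)) + ENNReal.ofReal ε) * X) ∂μ
        = (∫⁻ s, M β s * ENNReal.ofReal (k β (t - s)) ∂μ) * X
          + ENNReal.ofReal ε * ((∫⁻ s, M β s ∂μ) * X) := by
      intro β
      have hk' : Measurable fun s => k β (t - s) :=
        (hkm β).comp (measurable_const.sub measurable_id)
      have hMk : Measurable fun s => M β s * ENNReal.ofReal (k β (t - s)) :=
        (hMm β).mul hk'.ennreal_ofReal
      rw [← lintegral_mul_const _ hMk, ← lintegral_mul_const _ (hMm β),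
        ← lintegral_const_mul _ ((hMm β).mul_const _), ← lintegral_add_left (hMk.mul_const _)]
      refine lintegral_congr fun s => ?_
      ring
    simp only [hsplit]
    rw [hD, mul_add, mul_one, ← add_assoc]
    congr 1
    rw [Finset.sum_mul, Finset.sum_mul, Finset.mul_sum, ← Finset.sum_add_distrib,
      ← Finset.sum_add_distrib]
    refine Finset.sum_congr rfl fun β _ => ?_
    ring
  have hlim : Filter.Tendsto (fun ε : ℝ => (∑ β, (N₀ β * ENNReal.ofReal (k β t)
          + ∫⁻ s, M β s * ENNReal.ofReal (k β (t - s)) ∂μ)) * X + ENNReal.ofReal ε * D)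
      (nhdsWithin 0 (Set.Ioi 0)) (nhds ((∑ β, (N₀ β * ENNReal.ofReal (k β t)
          + ∫⁻ s, M β s * ENNReal.ofReal (k β (t - s)) ∂μ)) * X + ENNReal.ofReal 0 * D)) := by
    refine Filter.Tendsto.mono_left ?_ nhdsWithin_le_nhds
    refine Filter.Tendsto.const_add _ ?_
    exact ENNReal.Tendsto.mul_const ((ENNReal.continuous_ofReal.tendsto 0)) (Or.inr hDf)
  have := ge_of_tendsto hlim (by
    filter_upwards [self_mem_nhdsWithin] with ε hε using key ε hε)
  simpa using this

end DuhamelBound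

/-! ### Decay of a damped two-dimensional system -/

section DampedSystem

variable {E : Type*} [NormedAddCommGroup E] [InnerProductSpace ℝ E] {x v : ℝ → E} {c θ : ℝ}

theorem hasDerivAt_exp_mul {f : ℝ → ℝ} {f' a t : ℝ} (hf : HasDerivAt f f' t) :
    HasDerivAt (fun t => Real.exp (a * t) * f t) (Real.exp (a * t) * (a * f t + f')) t := by
  have h1 : HasDerivAt (fun t => Real.exp (a * t)) (Real.exp (a * t) * a) t := by
    simpa using ((hasDerivAt_id t).const_mul a).exp
  convert! h1.mul hf using 1
  ring

/-- The cross term `-⟨x, v⟩` makes the quadratic form an exact eigenvector of the flow: its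
derivative is `-c` times itself. -/
theorem damped_energy_eq (hx : ∀ t, HasDerivAt x (-(c • v t)) t)
    (hv : ∀ t, HasDerivAt v (-(c • v t) + (c * θ) • x t) t) (t : ℝ) :
    Real.exp (c * t) * (θ * ‖x t‖ ^ 2 + ‖v t‖ ^ 2 - inner ℝ (x t) (v t))
      = θ * ‖x 0‖ ^ 2 + ‖v 0‖ ^ 2 - inner ℝ (x 0) (v 0) := by
  have hd : ∀ t, HasDerivAt (fun t => Real.exp (c * t) *
      (θ * ‖x t‖ ^ 2 + ‖v t‖ ^ 2 - inner ℝ (x t) (v t))) 0 t := by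
    intro t
    have h1 := (((hx t).norm_sq.const_mul θ).add (hv t).norm_sq).sub ((hx t).inner ℝ (hv t))
    convert! hasDerivAt_exp_mul (a := c) h1 using 1
    simp only [Pi.sub_apply, Pi.add_apply, inner_add_right, inner_neg_right, inner_neg_left,
      inner_smul_right, real_inner_smul_left, real_inner_self_eq_norm_sq, real_inner_comm (v t) (x t)]
    ring
  have := is_const_of_deriv_eq_zero (fun t => (hd t).differentiableAt) (fun t => (hd t).deriv) t 0
  simpa using this

theorem damped_norm_le_of_half_le (hθ : 1 / 2 ≤ θ) (hx : ∀ t, HasDerivAt x (-(c • v t)) t)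
    (hv : ∀ t, HasDerivAt v (-(c • v t) + (c * θ) • x t) t) (t : ℝ) :
    ‖v t‖ ≤ 3 * Real.exp (-(c * t / 2)) * (√θ * ‖x 0‖ + ‖v 0‖) ∧
      √θ * ‖x t‖ ≤ 3 * Real.exp (-(c * t / 2)) * (√θ * ‖x 0‖ + ‖v 0‖) := by
  have hE := damped_energy_eq hx hv t
  have hs : √θ ^ 2 = θ := Real.sq_sqrt (by linarith)
  have h0 := abs_le.mp (abs_real_inner_le_norm (x 0) (v 0))
  have h1 := abs_le.mp (abs_real_inner_le_norm (x t) (v t))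
  have hexp : Real.exp (c * t) * Real.exp (-(c * t / 2)) ^ 2 = 1 := by
    rw [← Real.exp_nat_mul, ← Real.exp_add]
    simp
    ring
  have hp := Real.exp_pos (c * t)
  set e := Real.exp (-(c * t / 2)) with he
  have hep : 0 < e := Real.exp_pos _
  have hnx := norm_nonneg (x 0)
  have hnv := norm_nonneg (v 0)
  have hsθ := Real.sqrt_nonneg θ
  -- For `θ ≥ 1/2` the cross term is absorbed: the energy lies between `1/4` and `2` times `θ|x|² +
  -- |v|²`. The ratio `8 ≤ 3²` explains the constant `3`.
  have hlow : ∀ X V : ℝ, 0 ≤ X → 0 ≤ V → X * V ≤ 3 / 4 * (θ * X ^ 2 + V ^ 2) := by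
    intro X V hX hV
    nlinarith [mul_nonneg (sub_nonneg.mpr hθ) (sq_nonneg X), sq_nonneg (X - 4 / 3 * V),
      sq_nonneg X, sq_nonneg V]
  have hA : θ * ‖x t‖ ^ 2 + ‖v t‖ ^ 2 ≤ 8 * (e ^ 2 * (θ * ‖x 0‖ ^ 2 + ‖v 0‖ ^ 2)) := by
    have h2 := hlow _ _ (norm_nonneg (x t)) (norm_nonneg (v t))
    have h3 := hlow _ _ hnx hnv
    have h4 : Real.exp (c * t) * (1 / 4 * (θ * ‖x t‖ ^ 2 + ‖v t‖ ^ 2))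
        ≤ 2 * (θ * ‖x 0‖ ^ 2 + ‖v 0‖ ^ 2) := by
      refine (mul_le_mul_of_nonneg_left ?_ hp.le).trans (hE.le.trans ?_)
      · linarith
      · linarith
    have h5 := mul_le_mul_of_nonneg_left h4 (sq_nonneg e)
    have h6 : e ^ 2 * (Real.exp (c * t) * (1 / 4 * (θ * ‖x t‖ ^ 2 + ‖v t‖ ^ 2)))
        = 1 / 4 * (θ * ‖x t‖ ^ 2 + ‖v t‖ ^ 2) := by
      linear_combination (1 / 4 * (θ * ‖x t‖ ^ 2 + ‖v t‖ ^ 2)) * hexp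
    linarith
  have hB : (√θ * ‖x t‖) ^ 2 + ‖v t‖ ^ 2 ≤ (3 * e * (√θ * ‖x 0‖ + ‖v 0‖)) ^ 2 := by
    have h7 : θ * ‖x 0‖ ^ 2 + ‖v 0‖ ^ 2 ≤ (√θ * ‖x 0‖ + ‖v 0‖) ^ 2 := by
      have : 0 ≤ √θ * ‖x 0‖ * ‖v 0‖ := by positivity
      nlinarith
    have h8 := mul_le_mul_of_nonneg_left h7 (sq_nonneg e)
    have h9 : 0 ≤ e ^ 2 * (√θ * ‖x 0‖ + ‖v 0‖) ^ 2 := by positivity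
    rw [mul_pow, hs]
    nlinarith
  have hR : 0 ≤ 3 * e * (√θ * ‖x 0‖ + ‖v 0‖) := by positivity
  constructor
  · exact abs_le_of_sq_le_sq (by nlinarith [sq_nonneg (√θ * ‖x t‖)]) hR |> (le_abs_self _).trans
  · exact abs_le_of_sq_le_sq (by nlinarith [sq_nonneg ‖v t‖]) hR |> (le_abs_self _).trans

/-- With the effective unknown `z = x - v` the system reads `z' = -cθ(z + v)`, `v' = -c(1 - θ) v +
cθ z`. The cross terms cancel in the derivative of `|z|² + |v|²`, leaving the damping `-2cθ|z|² -
2c(1 - θ)|v|²`, and `θ ≤ 1 - θ`. -/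
theorem damped_norm_le_of_le_half (hc : 0 < c) (hθ0 : 0 < θ) (hθ : θ ≤ 1 / 2)
    (hx : ∀ t, HasDerivAt x (-(c • v t)) t)
    (hv : ∀ t, HasDerivAt v (-(c • v t) + (c * θ) • x t) t) {t : ℝ} (ht : 0 ≤ t) :
    ‖x t - v t‖ ≤ Real.exp (-(c * θ * t)) * (‖x 0‖ + 2 * ‖v 0‖) ∧
      ‖v t‖ ≤ Real.exp (-(c * θ * t)) * (‖x 0‖ + 2 * ‖v 0‖) := by
  set N : ℝ → ℝ := fun t => Real.exp (2 * c * θ * t) * (‖x t - v t‖ ^ 2 + ‖v t‖ ^ 2) with hN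
  have hd : ∀ t, HasDerivAt N (Real.exp (2 * c * θ * t) * (-(2 * c * (1 - 2 * θ) * ‖v t‖ ^ 2))) t := by
    intro t
    have h1 := ((hx t).sub (hv t)).norm_sq.add (hv t).norm_sq
    convert! hasDerivAt_exp_mul (a := 2 * c * θ) h1 using 1
    have hz : ‖x t - v t‖ ^ 2 = ‖x t‖ ^ 2 - 2 * inner ℝ (x t) (v t) + ‖v t‖ ^ 2 :=
      norm_sub_sq_real _ _
    simp only [Pi.sub_apply, Pi.add_apply, hz, inner_add_right, inner_sub_right, inner_sub_left,
      inner_neg_right, inner_smul_right, real_inner_self_eq_norm_sq,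
      real_inner_comm (v t) (x t)]
    ring
  have hanti : Antitone N := by
    refine antitone_of_deriv_nonpos (fun t => (hd t).differentiableAt) fun t => ?_
    rw [(hd t).deriv]
    have : 0 ≤ 2 * c * (1 - 2 * θ) * ‖v t‖ ^ 2 := by
      have : 0 ≤ 1 - 2 * θ := by linarith
      positivity
    nlinarith [Real.exp_pos (2 * c * θ * t)]
  have h := hanti ht
  simp only [hN, mul_zero, Real.exp_zero, one_mul] at h
  set e := Real.exp (-(c * θ * t)) with he
  have hep : 0 < e := Real.exp_pos _
  have hexp : Real.exp (2 * c * θ * t) * e ^ 2 = 1 := by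
    rw [he, ← Real.exp_nat_mul, ← Real.exp_add]
    simp
    ring
  have hnx := norm_nonneg (x 0)
  have hnv := norm_nonneg (v 0)
  have hz0 : ‖x 0 - v 0‖ ^ 2 + ‖v 0‖ ^ 2 ≤ (‖x 0‖ + 2 * ‖v 0‖) ^ 2 := by
    have := norm_sub_le (x 0) (v 0)
    nlinarith [norm_nonneg (x 0 - v 0)]
  have hB : ‖x t - v t‖ ^ 2 + ‖v t‖ ^ 2 ≤ (e * (‖x 0‖ + 2 * ‖v 0‖)) ^ 2 := by
    have h5 := mul_le_mul_of_nonneg_left (h.trans hz0) (sq_nonneg e)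
    calc _ = e ^ 2 * (Real.exp (2 * c * θ * t) * (‖x t - v t‖ ^ 2 + ‖v t‖ ^ 2)) := by
          linear_combination -(‖x t - v t‖ ^ 2 + ‖v t‖ ^ 2) * hexp
      _ ≤ _ := h5.trans (le_of_eq (by ring))
  have hR : 0 ≤ e * (‖x 0‖ + 2 * ‖v 0‖) := by positivity
  constructor
  · exact abs_le_of_sq_le_sq (by nlinarith [sq_nonneg ‖v t‖]) hR |> (le_abs_self _).trans
  · exact abs_le_of_sq_le_sq (by nlinarith [sq_nonneg ‖x t - v t‖]) hR |> (le_abs_self _).trans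

/-- Duhamel for `v' = -c(1 - θ) v + cθ (x - v)`: the slow mode enters `v` only through the source,
hence with a factor `θ`. That factor compensates the slow rate `cθ` when `v` is integrated in time.
-/
theorem damped_norm_right_le (hc : 0 < c) (hθ0 : 0 < θ) (hθ : θ ≤ 1 / 2)
    (hx : ∀ t, HasDerivAt x (-(c • v t)) t)
    (hv : ∀ t, HasDerivAt v (-(c • v t) + (c * θ) • x t) t) {t : ℝ} (ht : 0 ≤ t) :
    ‖v t‖ ≤ Real.exp (-(c * t / 2)) * ‖v 0‖
      + 4 * θ * Real.exp (-(c * θ * t)) * (‖x 0‖ + 2 * ‖v 0‖) := by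
  set n₀ := ‖x 0‖ + 2 * ‖v 0‖ with hn₀
  have hn₀' : 0 ≤ n₀ := by positivity
  -- Up to `1/4` the fast rate `c(1 - θ)` stays away from `cθ`. Beyond, `4θ ≥ 1` and the previous
  -- lemma suffices.
  rcases le_total θ (1 / 4) with h4 | h4
  · have h12 : 0 < 1 - 2 * θ := by linarith
    set w : ℝ → E := fun t => Real.exp (c * (1 - θ) * t) • v t with hw
    have hwd : ∀ t, HasDerivAt w ((c * θ * Real.exp (c * (1 - θ) * t)) • (x t - v t)) t := by
      intro t
      have h1 : HasDerivAt (fun t => Real.exp (c * (1 - θ) * t))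
          (Real.exp (c * (1 - θ) * t) * (c * (1 - θ))) t := by
        simpa using ((hasDerivAt_id t).const_mul (c * (1 - θ))).exp
      convert! h1.smul (hv t) using 1
      module
    set B : ℝ → ℝ := fun t => ‖v 0‖ + θ * n₀ / (1 - 2 * θ) * Real.exp (c * (1 - 2 * θ) * t) with hB
    have hBd : ∀ t, HasDerivAt B (c * θ * n₀ * Real.exp (c * (1 - 2 * θ) * t)) t := by
      intro t
      have h1 : HasDerivAt (fun t => Real.exp (c * (1 - 2 * θ) * t))
          (Real.exp (c * (1 - 2 * θ) * t) * (c * (1 - 2 * θ))) t := by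
        simpa using ((hasDerivAt_id t).const_mul (c * (1 - 2 * θ))).exp
      convert! (h1.const_mul (θ * n₀ / (1 - 2 * θ))).const_add ‖v 0‖ using 1
      rw [div_mul_eq_mul_div, eq_div_iff h12.ne']
      ring
    have hle := image_norm_le_of_norm_deriv_right_le_deriv_boundary (a := 0) (b := t)
      (f := w) (f' := fun t => (c * θ * Real.exp (c * (1 - θ) * t)) • (x t - v t)) (B := B)
      (B' := fun t => c * θ * n₀ * Real.exp (c * (1 - 2 * θ) * t))
      (fun t _ => (hwd t).continuousAt.continuousWithinAt)
      (fun t _ => (hwd t).hasDerivWithinAt)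
      (by
        simp only [hw, hB, mul_zero, Real.exp_zero, one_smul, mul_one]
        have : 0 ≤ θ * n₀ / (1 - 2 * θ) := by positivity
        linarith)
      hBd
      (fun s hs => by
        rw [norm_smul, Real.norm_eq_abs, abs_of_nonneg (by positivity)]
        have h2 := (damped_norm_le_of_le_half hc hθ0 hθ hx hv hs.1).1
        calc c * θ * Real.exp (c * (1 - θ) * s) * ‖x s - v s‖
            ≤ c * θ * Real.exp (c * (1 - θ) * s) * (Real.exp (-(c * θ * s)) * n₀) := by gcongr
          _ = c * θ * n₀ * (Real.exp (c * (1 - θ) * s) * Real.exp (-(c * θ * s))) := by ring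
          _ = _ := by
            rw [← Real.exp_add]
            congr 2
            ring)
      (Set.right_mem_Icc.mpr ht)
    have hval : ‖v t‖ = Real.exp (-(c * (1 - θ) * t)) * ‖w t‖ := by
      rw [hw, norm_smul, Real.norm_eq_abs, Real.abs_exp, ← mul_assoc, ← Real.exp_add]
      simp
    rw [hval]
    refine (mul_le_mul_of_nonneg_left hle (Real.exp_pos _).le).trans ?_
    rw [hB, mul_add]
    have e1 : Real.exp (-(c * (1 - θ) * t)) ≤ Real.exp (-(c * t / 2)) := by
      rw [Real.exp_le_exp]
      have : 0 ≤ c * t := by positivity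
      nlinarith
    have e2 : Real.exp (-(c * (1 - θ) * t)) *
        (θ * n₀ / (1 - 2 * θ) * Real.exp (c * (1 - 2 * θ) * t))
        = θ / (1 - 2 * θ) * Real.exp (-(c * θ * t)) * n₀ := by
      have : Real.exp (-(c * θ * t))
          = Real.exp (-(c * (1 - θ) * t)) * Real.exp (c * (1 - 2 * θ) * t) := by
        rw [← Real.exp_add]
        congr 1
        ring
      rw [this]
      ring
    have e3 : θ / (1 - 2 * θ) ≤ 4 * θ := by
      rw [div_le_iff₀ h12]
      nlinarith
    simp only [e2]
    gcongr
  · have h1 := (damped_norm_le_of_le_half hc hθ0 hθ hx hv ht).2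
    have h2 : Real.exp (-(c * θ * t)) * n₀ ≤ 4 * θ * Real.exp (-(c * θ * t)) * n₀ := by
      have : 0 ≤ Real.exp (-(c * θ * t)) * n₀ := by positivity
      nlinarith
    have h3 : 0 ≤ Real.exp (-(c * t / 2)) * ‖v 0‖ := by positivity
    linarith

end DampedSystem

/-! ### The linearized system at a fixed frequency -/

theorem one_le_max_sqrt {p : ℝ} (hp : 0 < p) : 1 ≤ max (√p) (1 / √p) := by
  have hs : 0 < √p := Real.sqrt_pos.mpr hp
  rcases le_total 1 (√p) with h | h
  · exact le_max_of_le_left h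
  · exact le_max_of_le_right ((one_le_div hs).mpr h)

theorem one_le_max_sqrt_mul_sqrt {p : ℝ} (hp : 0 < p) : 1 ≤ max (√p) (1 / √p) * √p := by
  have hs : 0 < √p := Real.sqrt_pos.mpr hp
  calc 1 = 1 / √p * √p := by field_simp
    _ ≤ _ := by gcongr; exact le_max_right _ _

/-- With `a = 4κ/ν²` and `K = max(a, a⁻²)` the claims are `K ≥ 1`, `a ≤ K²` and `1 ≤ aK`. The second
controls `√P` by `1 + νρ`; the third controls `ν²/κ` in the time integral of the density. -/
theorem max_ratio_bounds {κ ν : ℝ} (hκ : 0 < κ) (hν : 0 < ν) :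
    1 ≤ max (4 * κ / ν ^ 2) ((ν ^ 2 / (4 * κ)) ^ 2) ∧
      4 * κ ≤ ν ^ 2 * max (4 * κ / ν ^ 2) ((ν ^ 2 / (4 * κ)) ^ 2) ^ 2 ∧
      ν ^ 2 ≤ 4 * κ * max (4 * κ / ν ^ 2) ((ν ^ 2 / (4 * κ)) ^ 2) := by
  set a := 4 * κ / ν ^ 2 with ha
  have ha0 : 0 < a := by positivity
  have hinv : ν ^ 2 / (4 * κ) = a⁻¹ := by rw [ha, inv_div]
  have h4κ : 4 * κ = a * ν ^ 2 := by rw [ha]; field_simp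
  rw [hinv]
  set K := max a (a⁻¹ ^ 2) with hK
  have h1 : a ≤ K := le_max_left _ _
  have h2 : a⁻¹ ^ 2 ≤ K := le_max_right _ _
  have hprod : a * a⁻¹ = 1 := mul_inv_cancel₀ ha0.ne'
  have hi0 : 0 < a⁻¹ := inv_pos.mpr ha0
  have hone : 1 ≤ K := by
    rcases le_total 1 a with h | h
    · exact h.trans h1
    · have : 1 ≤ a⁻¹ := (one_le_inv₀ ha0).mpr h
      nlinarith
  have hinvK : a⁻¹ ≤ K := by
    rcases le_total 1 a with h | h
    · exact (inv_le_one_of_one_le₀ h).trans hone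
    · have : 1 ≤ a⁻¹ := (one_le_inv₀ ha0).mpr h
      nlinarith
  refine ⟨hone, ?_, ?_⟩
  · rw [h4κ, mul_comm]
    gcongr
    nlinarith
  · rw [h4κ]
    have : 1 ≤ a * K := by
      calc 1 = a * a⁻¹ := hprod.symm
        _ ≤ _ := by gcongr
    nlinarith [sq_nonneg ν]

section Frequency

variable {d : ℕ} {q : ℝ → ℂ} {u : ℝ → Fin d → ℂ} {ξ : Fin d → ℝ} {r P μ lam ν : ℝ}

/-- The compressible component of a velocity at frequency `ξ`. -/
noncomputable def longitudinal (ξ : Fin d → ℝ) (r : ℝ) (U : Fin d → ℂ) : ℂ :=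
  Complex.I / r * ∑ k, (ξ k : ℂ) * U k

theorem sum_mul_eq_longitudinal (hr : 0 < r) (U : Fin d → ℂ) :
    ∑ k, (ξ k : ℂ) * U k = -Complex.I * r * longitudinal ξ r U := by
  have : (r : ℂ) ≠ 0 := by exact_mod_cast hr.ne'
  rw [longitudinal]
  field_simp
  rw [Complex.I_sq]
  ring

/-- Contracting with `ξ` merges the two viscous terms into `ν r²`, so density and longitudinal
velocity decouple from the rest. -/
theorem hasDerivAt_longitudinal (hr : 0 < r) (hξ : ∑ k, ξ k ^ 2 = r ^ 2) (hν : ν = lam + 2 * μ)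
    (hu : ∀ i t, HasDerivAt (fun t => u t i) (-(Complex.I * P * ξ i * q t) - μ * r ^ 2 * u t i
      - (lam + μ) * ξ i * ∑ k, (ξ k : ℂ) * u t k) t) (t : ℝ) :
    HasDerivAt (fun t => longitudinal ξ r (u t))
      (r * P * q t - ν * r ^ 2 * longitudinal ξ r (u t)) t := by
  have h := (HasDerivAt.fun_sum (u := Finset.univ) fun k _ => (hu k t).const_mul (ξ k : ℂ)).const_mul
    (Complex.I / r)
  convert! h using 1
  have hr' : (r : ℂ) ≠ 0 := by exact_mod_cast hr.ne'
  have hξ' : ∑ k, (ξ k : ℂ) ^ 2 = (r : ℂ) ^ 2 := by exact_mod_cast hξ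
  have hsum : ∀ S : ℂ, ∑ k, (ξ k : ℂ) * (-(Complex.I * P * ξ k * q t) - μ * r ^ 2 * u t k
      - (lam + μ) * ξ k * S)
      = -(Complex.I * P * q t) * (∑ k, (ξ k : ℂ) ^ 2) - μ * r ^ 2 * (∑ k, (ξ k : ℂ) * u t k)
        - (lam + μ) * S * ∑ k, (ξ k : ℂ) ^ 2 := by
    intro S
    simp only [Finset.mul_sum, ← Finset.sum_sub_distrib]
    exact Finset.sum_congr rfl fun k _ => by ring
  rw [hsum, hξ', sum_mul_eq_longitudinal hr, hν]
  push_cast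
  field_simp
  linear_combination (P * q t - (lam + 2 * μ) * r * longitudinal ξ r (u t)) * Complex.I_sq

theorem hasDerivAt_density (hr : 0 < r)
    (hq : ∀ t, HasDerivAt q (-(Complex.I * ∑ k, (ξ k : ℂ) * u t k)) t) (t : ℝ) :
    HasDerivAt q (-(r * longitudinal ξ r (u t))) t := by
  convert! hq t using 1
  rw [sum_mul_eq_longitudinal hr]
  linear_combination (-r * longitudinal ξ r (u t)) * Complex.I_sq

/-- Removing the component along `ξ` eliminates the pressure and the `λ + μ` term; what is left
solves `w' = -μ r² w`. -/
theorem norm_transversal_eq (hr : 0 < r) (hξ : ∑ k, ξ k ^ 2 = r ^ 2) (hν : ν = lam + 2 * μ)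
    (hu : ∀ i t, HasDerivAt (fun t => u t i) (-(Complex.I * P * ξ i * q t) - μ * r ^ 2 * u t i
      - (lam + μ) * ξ i * ∑ k, (ξ k : ℂ) * u t k) t) (i : Fin d) (t : ℝ) :
    ‖u t i + Complex.I * (ξ i / r) * longitudinal ξ r (u t)‖
      = Real.exp (-(μ * r ^ 2 * t))
        * ‖u 0 i + Complex.I * (ξ i / r) * longitudinal ξ r (u 0)‖ := by
  set w : ℝ → ℂ := fun t => u t i + Complex.I * (ξ i / r) * longitudinal ξ r (u t) with hw
  have hr' : (r : ℂ) ≠ 0 := by exact_mod_cast hr.ne'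
  have hwd : ∀ t, HasDerivAt w (-(μ * r ^ 2 * w t)) t := by
    intro t
    have h := (hu i t).add ((hasDerivAt_longitudinal hr hξ hν hu t).const_mul
      (Complex.I * (ξ i / r)))
    convert! h using 1
    rw [hw, sum_mul_eq_longitudinal hr, hν]
    push_cast
    field_simp
    ring
  have hd : ∀ t, HasDerivAt (fun t : ℝ => Complex.exp ((μ * r ^ 2 * t : ℝ)) * w t) 0 t := by
    intro t
    have h1 : HasDerivAt (fun t : ℝ => Complex.exp ((μ * r ^ 2 * t : ℝ)))
        (Complex.exp ((μ * r ^ 2 * t : ℝ)) * ((μ * r ^ 2 : ℝ) : ℂ)) t := by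
      have h2 : HasDerivAt (fun t : ℝ => μ * r ^ 2 * t) (μ * r ^ 2) t := by
        simpa using (hasDerivAt_id t).const_mul (μ * r ^ 2)
      exact h2.ofReal_comp.cexp
    convert! h1.mul (hwd t) using 1
    push_cast
    ring
  have hconst := is_const_of_deriv_eq_zero (fun t => (hd t).differentiableAt)
    (fun t => (hd t).deriv) t 0
  simp only [mul_zero, Complex.ofReal_zero, Complex.exp_zero, one_mul] at hconst
  have hn := congrArg norm hconst
  rw [norm_mul, ← Complex.ofReal_exp, Complex.norm_real, Real.norm_eq_abs, Real.abs_exp] at hn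
  change ‖w t‖ = _ * ‖w 0‖
  rw [← hn, ← mul_assoc, ← Real.exp_add]
  simp

theorem norm_velocity_le (hr : 0 < r) (hξ : ∑ k, ξ k ^ 2 = r ^ 2) (hν : ν = lam + 2 * μ)
    (hu : ∀ i t, HasDerivAt (fun t => u t i) (-(Complex.I * P * ξ i * q t) - μ * r ^ 2 * u t i
      - (lam + μ) * ξ i * ∑ k, (ξ k : ℂ) * u t k) t) (i : Fin d) (t : ℝ) :
    ‖u t i‖ ≤ Real.exp (-(μ * r ^ 2 * t)) * (‖u 0 i‖ + ‖longitudinal ξ r (u 0)‖)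
      + ‖longitudinal ξ r (u t)‖ := by
  have hc : ‖Complex.I * ((ξ i : ℂ) / r)‖ ≤ 1 := by
    rw [norm_mul, Complex.norm_I, one_mul, norm_div, Complex.norm_real, Complex.norm_real,
      Real.norm_eq_abs, Real.norm_eq_abs, abs_of_pos hr, div_le_one hr]
    refine abs_le_of_sq_le_sq ?_ hr.le
    rw [← hξ]
    exact Finset.single_le_sum (f := fun k => ξ k ^ 2) (fun _ _ => sq_nonneg _) (Finset.mem_univ i)
  have hle : ∀ s, ‖Complex.I * ((ξ i : ℂ) / r) * longitudinal ξ r (u s)‖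
      ≤ ‖longitudinal ξ r (u s)‖ := by
    intro s
    rw [norm_mul]
    exact mul_le_of_le_one_left (norm_nonneg _) hc
  have h := norm_transversal_eq hr hξ hν hu i t
  have h1 : ‖u t i‖ ≤ ‖u t i + Complex.I * (ξ i / r) * longitudinal ξ r (u t)‖
      + ‖Complex.I * ((ξ i : ℂ) / r) * longitudinal ξ r (u t)‖ := by
    have := norm_sub_le (u t i + Complex.I * (ξ i / r) * longitudinal ξ r (u t))
      (Complex.I * ((ξ i : ℂ) / r) * longitudinal ξ r (u t))
    rwa [add_sub_cancel_right] at this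
  rw [h] at h1
  refine h1.trans (add_le_add ?_ (hle t))
  gcongr
  exact (norm_add_le _ _).trans (add_le_add le_rfl (hle 0))

end Frequency

/-! ### Decay at one frequency, uniformly over a dyadic annulus. -/

/-- The decay rate profile of the density in a dyadic block at frequency `ρ`. -/
noncomputable def densityDecay (ν ρ Q t : ℝ) : ℝ :=
  Real.exp (-(ν * ρ ^ 2 / 18 * t)) + Real.exp (-(Q / (18 * ν) * t))

/-- The decay rate profile of the velocity in a dyadic block at frequency `ρ`. -/
noncomputable def velocityDecay (ν ν₀ ρ Q t : ℝ) : ℝ :=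
  Real.exp (-(ν₀ * ρ ^ 2 / 18 * t))
    + min 1 (Q / (ν ^ 2 * ρ ^ 2)) * Real.exp (-(Q / (18 * ν) * t))

section FrequencyBound

variable {d : ℕ} {q : ℝ → ℂ} {u : ℝ → Fin d → ℂ} {ξ : Fin d → ℝ} {r P p μ lam κ ν ν₀ ρ Q : ℝ}

theorem damped_of_frequency (hr : 0 < r) (hξ : ∑ k, ξ k ^ 2 = r ^ 2) (hν : ν = lam + 2 * μ)
    (hν0 : 0 < ν) (hq : ∀ t, HasDerivAt q (-(Complex.I * ∑ k, (ξ k : ℂ) * u t k)) t)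
    (hu : ∀ i t, HasDerivAt (fun t => u t i) (-(Complex.I * P * ξ i * q t) - μ * r ^ 2 * u t i
      - (lam + μ) * ξ i * ∑ k, (ξ k : ℂ) * u t k) t) :
    (∀ t, HasDerivAt (fun t => (ν * r) • q t) (-((ν * r ^ 2) • longitudinal ξ r (u t))) t) ∧
    (∀ t, HasDerivAt (fun t => longitudinal ξ r (u t)) (-((ν * r ^ 2) • longitudinal ξ r (u t))
      + (ν * r ^ 2 * (P / (ν ^ 2 * r ^ 2))) • ((ν * r) • q t)) t) := by
  constructor
  · intro t
    convert! (hasDerivAt_density hr hq t).const_smul (ν * r) using 1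
    simp only [Complex.real_smul]
    push_cast
    ring
  · intro t
    convert! hasDerivAt_longitudinal hr hξ hν hu t using 1
    have : ν * r ^ 2 * (P / (ν ^ 2 * r ^ 2)) * (ν * r) = r * P := by
      field_simp
    rw [smul_smul, this]
    simp only [Complex.real_smul]
    push_cast
    ring

theorem sqrt_symbol_le (hp : 0 < p) (hκ : 0 < κ) (hρ : 0 < ρ) (hr : 0 < r)
    (hrρ' : r ≤ 6 * ρ) (hPp : P ≤ p + κ * r ^ 2) (hν0 : 0 < ν)
    {M K : ℝ} (hM1 : 1 ≤ M) (hMp : √p ≤ M)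
    (hK1 : 1 ≤ K) (hKκ : 4 * κ ≤ ν ^ 2 * K ^ 2) : √P ≤ 9 * (M * K) * (1 + ν * ρ) := by
  have hK0 : 0 ≤ K := by linarith
  have hM0 : 0 ≤ M := by linarith
  have e1 : p ≤ M ^ 2 := by
    calc p = √p ^ 2 := (Real.sq_sqrt hp.le).symm
      _ ≤ M ^ 2 := by gcongr
  have e2 : κ * r ^ 2 ≤ (3 * (ν * ρ) * K) ^ 2 := by
    calc κ * r ^ 2 ≤ κ * (6 * ρ) ^ 2 := by gcongr
      _ = 4 * κ * (9 * ρ ^ 2) := by ring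
      _ ≤ ν ^ 2 * K ^ 2 * (9 * ρ ^ 2) := by gcongr
      _ = _ := by ring
  have e3 : 0 ≤ M * (3 * (ν * ρ) * K) := by positivity
  have hb : P ≤ (M + 3 * (ν * ρ) * K) ^ 2 := by
    have : (M + 3 * (ν * ρ) * K) ^ 2
        = M ^ 2 + 2 * (M * (3 * (ν * ρ) * K)) + (3 * (ν * ρ) * K) ^ 2 := by ring
    linarith
  have hb' : √P ≤ M + 3 * (ν * ρ) * K := Real.sqrt_le_iff.mpr ⟨by positivity, hb⟩
  have hMK : M ≤ M * K := le_mul_of_one_le_right hM0 hK1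
  have hKM : ν * ρ * K ≤ ν * ρ * (M * K) := by
    gcongr
    exact le_mul_of_one_le_left hK0 hM1
  have h0 : 0 ≤ ν * ρ * (M * K) := by positivity
  have h1 : 0 ≤ M * K := by positivity
  have : 9 * (M * K) * (1 + ν * ρ) = 9 * (M * K) + 9 * (ν * ρ * (M * K)) := by ring
  linarith

/-- Here `√θ |x| = √P |q|`, so `√P` must be compared with `1 + νρ`. The bound `1 + νρ ≤ 6M√P`
follows from `θ ≥ 1/2` and costs only `M`; the reverse `√P ≤ 9MK(1 + νρ)` costs `K` and is used for
the velocity alone. Keeping `K` out of the density bound leaves room for the factor `K` lost in its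
time integral. -/
theorem frequency_bound_of_half_le (hp : 0 < p) (hκ : 0 < κ) (hρ : 0 < ρ)
    (hrρ : ρ / 3 ≤ r) (hrρ' : r ≤ 6 * ρ) (hpP : p ≤ P) (hPp : P ≤ p + κ * r ^ 2)
    (hξ : ∑ k, ξ k ^ 2 = r ^ 2) (hν : ν = lam + 2 * μ) (hν0 : 0 < ν)
    (hq : ∀ t, HasDerivAt q (-(Complex.I * ∑ k, (ξ k : ℂ) * u t k)) t)
    (hu : ∀ i t, HasDerivAt (fun t => u t i) (-(Complex.I * P * ξ i * q t) - μ * r ^ 2 * u t i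
      - (lam + μ) * ξ i * ∑ k, (ξ k : ℂ) * u t k) t)
    (hθ : 1 / 2 ≤ P / (ν ^ 2 * r ^ 2)) {U : ℝ} (hU : ‖longitudinal ξ r (u 0)‖ ≤ U)
    {M K : ℝ} (hM1 : 1 ≤ M) (hMp : √p ≤ M) (hMp' : 1 ≤ M * √p)
    (hK1 : 1 ≤ K) (hKκ : 4 * κ ≤ ν ^ 2 * K ^ 2) (t : ℝ) :
    (1 + ν * ρ) * ‖q t‖
        ≤ 18 * M * Real.exp (-(ν * r ^ 2 * t / 2)) * ((1 + ν * ρ) * ‖q 0‖ + U) ∧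
      ‖longitudinal ξ r (u t)‖
        ≤ 27 * (M * K) * Real.exp (-(ν * r ^ 2 * t / 2)) * ((1 + ν * ρ) * ‖q 0‖ + U) := by
  have hr : 0 < r := by linarith
  have hP : 0 < P := by linarith
  obtain ⟨hx, hv⟩ := damped_of_frequency hr hξ hν hν0 hq hu
  obtain ⟨h1, h2⟩ := damped_norm_le_of_half_le hθ hx hv t
  have hνr : 0 < ν * r := by positivity
  have hsθ : √(P / (ν ^ 2 * r ^ 2)) = √P / (ν * r) := by
    rw [Real.sqrt_div hP.le, ← mul_pow, Real.sqrt_sq hνr.le]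
  have hsx : ∀ t, √(P / (ν ^ 2 * r ^ 2)) * ‖(ν * r) • q t‖ = √P * ‖q t‖ := by
    intro t
    rw [hsθ, norm_smul, Real.norm_eq_abs, abs_of_pos hνr]
    field_simp
  rw [hsx] at h1 h2
  rw [hsx] at h2
  set e := Real.exp (-(ν * r ^ 2 * t / 2)) with he
  have hep : 0 < e := Real.exp_pos _
  have hsP : 0 < √P := Real.sqrt_pos.mpr hP
  have hsP2 : √P ^ 2 = P := Real.sq_sqrt hP.le
  have hνr2 : (ν * r) ^ 2 ≤ 2 * √P ^ 2 := by
    rw [hsP2]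
    rw [le_div_iff₀ (by positivity)] at hθ
    rw [mul_pow]
    linarith
  have hνr3 : ν * r ≤ 3 / 2 * √P := by
    refine (pow_le_pow_iff_left₀ hνr.le (by positivity) two_ne_zero).mp ?_
    rw [mul_pow]
    linarith [sq_nonneg (√P)]
  have hνρ : ν * ρ ≤ 5 * √P := by
    have : ν * ρ ≤ ν * (3 * r) := by
      gcongr
      linarith
    linarith
  have hpP' : √p ≤ √P := Real.sqrt_le_sqrt hpP
  have h1ρ : 1 + ν * ρ ≤ 6 * M * √P := by
    have : M * √p ≤ M * √P := by gcongr
    have : √P ≤ M * √P := le_mul_of_one_le_left hsP.le hM1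
    linarith
  have hQ := norm_nonneg (q 0)
  have hV := norm_nonneg (longitudinal ξ r (u 0))
  have hνρ0 : 0 < ν * ρ := by positivity
  have hsPu : √P ≤ 9 * (M * K) * (1 + ν * ρ) :=
    sqrt_symbol_le hp hκ hρ hr hrρ' hPp hν0 hM1 hMp hK1 hKκ
  constructor
  · have h3 : (1 + ν * ρ) * (√P * ‖q t‖)
        ≤ (18 * M * e * ((1 + ν * ρ) * ‖q 0‖ + U)) * √P := by
      have ha : (1 + ν * ρ) * ‖longitudinal ξ r (u 0)‖ ≤ 6 * M * √P * U := by gcongr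
      have hb : (1 + ν * ρ) * ‖q 0‖ * √P ≤ 6 * M * ((1 + ν * ρ) * ‖q 0‖ * √P) :=
        le_mul_of_one_le_left (by positivity) (by linarith)
      calc (1 + ν * ρ) * (√P * ‖q t‖)
          ≤ (1 + ν * ρ) * (3 * e * (√P * ‖q 0‖ + ‖longitudinal ξ r (u 0)‖)) := by gcongr
        _ = 3 * e * ((1 + ν * ρ) * ‖q 0‖ * √P + (1 + ν * ρ) * ‖longitudinal ξ r (u 0)‖) := by ring
        _ ≤ 3 * e * (6 * M * ((1 + ν * ρ) * ‖q 0‖ * √P) + 6 * M * √P * U) := by gcongr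
        _ = _ := by ring
    refine le_of_mul_le_mul_right ?_ hsP
    calc _ = (1 + ν * ρ) * (√P * ‖q t‖) := by ring
      _ ≤ _ := h3
  · have hMK1 : 1 ≤ 9 * (M * K) := by linarith [one_le_mul_of_one_le_of_one_le hM1 hK1]
    have hU0 : 0 ≤ U := hV.trans hU
    calc _ ≤ 3 * e * (√P * ‖q 0‖ + ‖longitudinal ξ r (u 0)‖) := h1
      _ ≤ 3 * e * (9 * (M * K) * (1 + ν * ρ) * ‖q 0‖ + 9 * (M * K) * U) := by
          gcongr
          exact hU.trans (le_mul_of_one_le_left hU0 hMK1)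
      _ = _ := by ring

theorem frequency_bound_of_le_half (hp : 0 < p) (hρ : 0 < ρ)
    (hrρ : ρ / 3 ≤ r) (hrρ' : r ≤ 6 * ρ) (hpP : p ≤ P)
    (hξ : ∑ k, ξ k ^ 2 = r ^ 2) (hν : ν = lam + 2 * μ) (hν0 : 0 < ν)
    (hq : ∀ t, HasDerivAt q (-(Complex.I * ∑ k, (ξ k : ℂ) * u t k)) t)
    (hu : ∀ i t, HasDerivAt (fun t => u t i) (-(Complex.I * P * ξ i * q t) - μ * r ^ 2 * u t i
      - (lam + μ) * ξ i * ∑ k, (ξ k : ℂ) * u t k) t)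
    (hθ : P / (ν ^ 2 * r ^ 2) ≤ 1 / 2) {U : ℝ} (hU : ‖longitudinal ξ r (u 0)‖ ≤ U)
    {M : ℝ} (hM1 : 1 ≤ M) (hMp' : 1 ≤ M * √p) {t : ℝ} (ht : 0 ≤ t) :
    (1 + ν * ρ) * ‖q t‖ ≤ 16 * M * Real.exp (-(P / ν * t)) * ((1 + ν * ρ) * ‖q 0‖ + U) ∧
      ‖longitudinal ξ r (u t)‖ ≤ Real.exp (-(ν * r ^ 2 * t / 2)) * U
        + 24 * (P / (ν ^ 2 * r ^ 2)) * Real.exp (-(P / ν * t))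
          * ((1 + ν * ρ) * ‖q 0‖ + U) := by
  have hr : 0 < r := by linarith
  have hP : 0 < P := by linarith
  have hνr : 0 < ν * r := by positivity
  obtain ⟨hx, hv⟩ := damped_of_frequency hr hξ hν hν0 hq hu
  have hc : 0 < ν * r ^ 2 := by positivity
  have hθ0 : 0 < P / (ν ^ 2 * r ^ 2) := by positivity
  obtain ⟨h1, h2⟩ := damped_norm_le_of_le_half hc hθ0 hθ hx hv ht
  have h3 := damped_norm_right_le hc hθ0 hθ hx hv ht
  have hcθ : ν * r ^ 2 * (P / (ν ^ 2 * r ^ 2)) * t = P / ν * t := by field_simp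
  rw [hcθ] at h1 h2 h3
  have hx0 : ∀ t, ‖(ν * r) • q t‖ = ν * r * ‖q t‖ := by
    intro t
    rw [norm_smul, Real.norm_eq_abs, abs_of_pos hνr]
  simp only [hx0] at h1 h2 h3
  set e := Real.exp (-(P / ν * t)) with he
  have hep : 0 < e := Real.exp_pos _
  have hQ := norm_nonneg (q 0)
  have hV := norm_nonneg (longitudinal ξ r (u 0))
  have hU0 : 0 ≤ U := hV.trans hU
  have hνρ0 : 0 < ν * ρ := by positivity
  have hsp : √p ≤ ν * r := by
    refine Real.sqrt_le_iff.mpr ⟨hνr.le, ?_⟩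
    rw [div_le_iff₀ (by positivity)] at hθ
    rw [mul_pow]
    linarith [mul_pos (pow_pos hν0 2) (pow_pos hr 2)]
  have h1ρ : 1 + ν * ρ ≤ 4 * M * (ν * r) := by
    have e1 : M * √p ≤ M * (ν * r) := by gcongr
    have e2 : ν * r ≤ M * (ν * r) := le_mul_of_one_le_left hνr.le hM1
    have e3 : ν * ρ ≤ ν * (3 * r) := by
      gcongr
      linarith
    linarith
  constructor
  · have h4 : ν * r * ‖q t‖ ≤ 2 * e * (ν * r * ‖q 0‖ + 2 * ‖longitudinal ξ r (u 0)‖) := by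
      have := norm_sub_norm_le ((ν * r) • q t) (longitudinal ξ r (u t))
      rw [hx0] at this
      linarith
    refine le_of_mul_le_mul_right ?_ hνr
    have hb : (1 + ν * ρ) * ‖q 0‖ * (ν * r) ≤ M * ((1 + ν * ρ) * ‖q 0‖ * (ν * r)) := by
      exact le_mul_of_one_le_left (by positivity) hM1
    have hb0 : 0 ≤ M * ((1 + ν * ρ) * ‖q 0‖ * (ν * r)) := by positivity
    calc (1 + ν * ρ) * ‖q t‖ * (ν * r) = (1 + ν * ρ) * (ν * r * ‖q t‖) := by ring
      _ ≤ (1 + ν * ρ) * (2 * e * (ν * r * ‖q 0‖ + 2 * ‖longitudinal ξ r (u 0)‖)) := by gcongr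
      _ = 2 * e * ((1 + ν * ρ) * ‖q 0‖ * (ν * r)
            + 2 * ((1 + ν * ρ) * ‖longitudinal ξ r (u 0)‖)) := by ring
      _ ≤ 2 * e * (8 * (M * ((1 + ν * ρ) * ‖q 0‖ * (ν * r))) + 2 * (4 * M * (ν * r) * U)) := by
          have h6 : (1 + ν * ρ) * ‖longitudinal ξ r (u 0)‖ ≤ 4 * M * (ν * r) * U := by gcongr
          exact mul_le_mul_of_nonneg_left (by linarith) (by positivity)
      _ = _ := by ring
  · have h5 : ν * r * ‖q 0‖ + 2 * ‖longitudinal ξ r (u 0)‖ ≤ 6 * ((1 + ν * ρ) * ‖q 0‖ + U) := by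
      have : ν * r * ‖q 0‖ ≤ 6 * (ν * ρ) * ‖q 0‖ := by
        refine mul_le_mul_of_nonneg_right ?_ hQ
        calc ν * r ≤ ν * (6 * ρ) := by gcongr
          _ = _ := by ring
      linarith
    calc _ ≤ _ := h3
      _ ≤ Real.exp (-(ν * r ^ 2 * t / 2)) * U
          + 4 * (P / (ν ^ 2 * r ^ 2)) * e * (6 * ((1 + ν * ρ) * ‖q 0‖ + U)) := by gcongr
      _ = _ := by ring

theorem frequency_bound (hp : 0 < p) (hκ : 0 < κ) (hμ : 0 < μ) (hρ : 0 < ρ)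
    (hrρ : ρ / 3 ≤ r) (hrρ' : r ≤ 6 * ρ) (hpP : p ≤ P) (hPp : P ≤ p + κ * r ^ 2)
    (hQP : Q / 18 ≤ P) (hPQ : P ≤ 36 * Q)
    (hξ : ∑ k, ξ k ^ 2 = r ^ 2) (hν : ν = lam + 2 * μ) (hν0 : 0 < ν) (hν₀ : ν₀ = min ν μ)
    (hq : ∀ t, HasDerivAt q (-(Complex.I * ∑ k, (ξ k : ℂ) * u t k)) t)
    (hu : ∀ i t, HasDerivAt (fun t => u t i) (-(Complex.I * P * ξ i * q t) - μ * r ^ 2 * u t i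
      - (lam + μ) * ξ i * ∑ k, (ξ k : ℂ) * u t k) t)
    {U : ℝ} (hU : ‖longitudinal ξ r (u 0)‖ ≤ U) (hU' : ∀ i, ‖u 0 i‖ ≤ U)
    {M K : ℝ} (hM1 : 1 ≤ M) (hMp : √p ≤ M) (hMp' : 1 ≤ M * √p)
    (hK1 : 1 ≤ K) (hKκ : 4 * κ ≤ ν ^ 2 * K ^ 2) {t : ℝ} (ht : 0 ≤ t) :
    (1 + ν * ρ) * ‖q t‖ ≤ 10000 * M * densityDecay ν ρ Q t * ((1 + ν * ρ) * ‖q 0‖ + U) ∧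
      ∀ i, ‖u t i‖
        ≤ 10000 * (M * K) * velocityDecay ν ν₀ ρ Q t * ((1 + ν * ρ) * ‖q 0‖ + U) := by
  have hr : 0 < r := by linarith
  have hP : 0 < P := by linarith
  have hQ0 : 0 < Q := by linarith
  have hU0 : 0 ≤ U := (norm_nonneg _).trans hU
  have hνρ0 : 0 < ν * ρ := by positivity
  have hY : 0 ≤ (1 + ν * ρ) * ‖q 0‖ + U := by positivity
  have hUY : U ≤ (1 + ν * ρ) * ‖q 0‖ + U := by
    have : 0 ≤ (1 + ν * ρ) * ‖q 0‖ := by positivity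
    linarith
  set Y := (1 + ν * ρ) * ‖q 0‖ + U with hYdef
  have hν₀0 : 0 < ν₀ := by rw [hν₀]; exact lt_min hν0 hμ
  have hν₀ν : ν₀ ≤ ν := hν₀ ▸ min_le_left _ _
  have hν₀μ : ν₀ ≤ μ := hν₀ ▸ min_le_right _ _
  have hr2 : ρ ^ 2 / 9 ≤ r ^ 2 := by
    calc ρ ^ 2 / 9 = (ρ / 3) ^ 2 := by ring
      _ ≤ r ^ 2 := by gcongr
  have hMK : 1 ≤ M * K := one_le_mul_of_one_le_of_one_le hM1 hK1
  set D1 := Real.exp (-(ν * ρ ^ 2 / 18 * t)) with hD1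
  set D2 := Real.exp (-(Q / (18 * ν) * t)) with hD2
  set D3 := Real.exp (-(ν₀ * ρ ^ 2 / 18 * t)) with hD3
  set m := min 1 (Q / (ν ^ 2 * ρ ^ 2)) with hm
  have hD1p : 0 < D1 := Real.exp_pos _
  have hD2p : 0 < D2 := Real.exp_pos _
  have hD3p : 0 < D3 := Real.exp_pos _
  have hm0 : 0 < m := lt_min one_pos (by positivity)
  -- The number `18` in the profiles has two sources: `r ≥ ρ/3` in the rate `ν r²/2`, and `P ≥ Q/18`
  -- in the rate `P/ν`.
  have he1 : Real.exp (-(ν * r ^ 2 * t / 2)) ≤ D1 := by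
    rw [hD1, Real.exp_le_exp]
    have : ν * (ρ ^ 2 / 9) * t ≤ ν * r ^ 2 * t := by gcongr
    linarith
  have hD13 : D1 ≤ D3 := by
    rw [hD1, hD3, Real.exp_le_exp]
    have : ν₀ * ρ ^ 2 / 18 * t ≤ ν * ρ ^ 2 / 18 * t := by gcongr
    linarith
  have he3 : Real.exp (-(μ * r ^ 2 * t)) ≤ D3 := by
    rw [hD3, Real.exp_le_exp]
    have h1 : ν₀ * (ρ ^ 2 / 9) * t ≤ μ * r ^ 2 * t := by gcongr
    have h2 : 0 ≤ ν₀ * ρ ^ 2 * t := by positivity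
    linarith
  have he2 : Real.exp (-(P / ν * t)) ≤ D2 := by
    rw [hD2, Real.exp_le_exp]
    have h1 : Q / (18 * ν) = Q / 18 / ν := by field_simp
    have h2 : Q / 18 / ν * t ≤ P / ν * t := by gcongr
    rw [h1]
    linarith
  have hlong : (1 + ν * ρ) * ‖q t‖ ≤ 10000 * M * (D1 + D2) * Y ∧
      ‖longitudinal ξ r (u t)‖ ≤ 27 * (M * K) * D3 * Y + 7776 * (m * D2) * Y := by
    rcases le_total (1 / 2) (P / (ν ^ 2 * r ^ 2)) with hθ | hθ
    · obtain ⟨h1, h2⟩ := frequency_bound_of_half_le hp hκ hρ hrρ hrρ' hpP hPp hξ hν hν0 hq hu hθ hU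
        hM1 hMp hMp' hK1 hKκ t
      constructor
      · refine h1.trans ?_
        have : Real.exp (-(ν * r ^ 2 * t / 2)) ≤ D1 + D2 := by linarith
        gcongr
        norm_num
      · refine h2.trans (le_add_of_le_of_nonneg ?_ (by positivity))
        gcongr
        exact he1.trans hD13
    · obtain ⟨h1, h2⟩ := frequency_bound_of_le_half hp hρ hrρ hrρ' hpP hξ hν hν0 hq hu hθ hU
        hM1 hMp' ht
      -- `324 = 36 · 9`, from `P ≤ 36 Q` and `ρ² ≤ 9 r²`; then `24 · 324 = 7776`, which the crude
      -- constant `10000` covers.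
      have hθm : P / (ν ^ 2 * r ^ 2) ≤ 324 * m := by
        rw [hm, mul_min_of_nonneg _ _ (by norm_num)]
        refine le_min (by linarith) ?_
        rw [← mul_div_assoc, div_le_div_iff₀ (by positivity) (by positivity)]
        calc P * (ν ^ 2 * ρ ^ 2) ≤ 36 * Q * (ν ^ 2 * (9 * r ^ 2)) := by
              gcongr
              linarith
          _ = _ := by ring
      constructor
      · refine h1.trans ?_
        have : Real.exp (-(P / ν * t)) ≤ D1 + D2 := by linarith
        gcongr
        norm_num
      · refine h2.trans (add_le_add ?_ ?_)
        · calc _ ≤ D3 * Y := by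
                gcongr
                exact he1.trans hD13
            _ ≤ 27 * (M * K) * (D3 * Y) := le_mul_of_one_le_left (by positivity) (by linarith)
            _ = _ := by ring
        · calc _ ≤ 24 * (324 * m) * D2 * Y := by gcongr
            _ = _ := by ring
  refine ⟨hlong.1, fun i => ?_⟩
  have h := norm_velocity_le hr hξ hν hu i t
  have h1 : Real.exp (-(μ * r ^ 2 * t)) * (‖u 0 i‖ + ‖longitudinal ξ r (u 0)‖) ≤ D3 * (2 * Y) := by
    gcongr
    linarith [hU' i]
  have h2 : D3 * (2 * Y) ≤ 2 * (M * K) * D3 * Y := by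
    have : D3 * Y ≤ M * K * (D3 * Y) := le_mul_of_one_le_left (by positivity) hMK
    linarith
  have h3 : 7776 * (m * D2) * Y ≤ 7776 * (M * K) * (m * D2) * Y := by
    have : m * D2 * Y ≤ M * K * (m * D2 * Y) := le_mul_of_one_le_left (by positivity) hMK
    linarith
  have h4 : 0 ≤ (M * K) * D3 * Y := by positivity
  have h5 : 0 ≤ (M * K) * (m * D2) * Y := by positivity
  calc ‖u t i‖ ≤ 2 * (M * K) * D3 * Y + (27 * (M * K) * D3 * Y + 7776 * (M * K) * (m * D2) * Y) := by
        linarith [hlong.2]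
    _ ≤ 10000 * (M * K) * (D3 + m * D2) * Y := by
        have : 10000 * (M * K) * (D3 + m * D2) * Y
          = 10000 * ((M * K) * D3 * Y) + 10000 * ((M * K) * (m * D2) * Y) := by ring
        linarith

end FrequencyBound

/-! ### Cut-off functions as Schwartz functions -/

section Cutoff

variable {d : ℕ} {χ : Space d → ℝ}

theorem IsCutoff.apply_eq_one (hχ : IsCutoff χ) {x : Space d} (hx : ‖x‖ ≤ 3 / 4) : χ x = 1 :=
  (Filter.Eventually.self_of_nhdsSet hχ.eq_one) x (by simpa using hx)

theorem IsCutoff.apply_eq_zero (hχ : IsCutoff χ) {x : Space d} (hx : 4 / 3 < ‖x‖) : χ x = 0 := by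
  by_contra h
  have : x ∈ Metric.closedBall (0 : Space d) (4 / 3) := hχ.support (subset_tsupport χ h)
  rw [mem_closedBall_zero_iff] at this
  linarith

theorem IsCutoff.apply_le_one (hχ : IsCutoff χ) (x : Space d) : χ x ≤ 1 := by
  rw [← hχ.apply_eq_one (x := 0) (by norm_num)]
  exact hχ.antitone _ _ (by simp)

theorem IsCutoff.apply_nonneg (hχ : IsCutoff χ) (x : Space d) : 0 ≤ χ x := by
  by_cases hx : ‖x‖ ≤ 3 / 4
  · rw [hχ.apply_eq_one hx]
    exact zero_le_one
  · have h2 : ‖(2 : ℝ) • x‖ = 2 * ‖x‖ := by simp [norm_smul]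
    rw [← hχ.apply_eq_zero (x := (2 : ℝ) • x) (by linarith)]
    exact hχ.antitone _ _ (by linarith [norm_nonneg x])

theorem IsCutoff.hasCompactSupport (hχ : IsCutoff χ) : HasCompactSupport χ :=
  HasCompactSupport.of_support_subset_isCompact (isCompact_closedBall (0 : Space d) (4 / 3))
    ((subset_tsupport χ).trans hχ.support)

/-- The function `x ↦ χ (a x)` as a Schwartz function. -/
noncomputable def IsCutoff.dilate (hχ : IsCutoff χ) (a : ℝ) (ha : a ≠ 0) : 𝓢(Space d, ℂ) :=
  HasCompactSupport.toSchwartzMap (f := fun x => (χ (a • x) : ℂ))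
    ((hχ.hasCompactSupport.comp_smul ha).comp_left Complex.ofReal_zero)
    (Complex.ofRealCLM.contDiff.comp (hχ.smooth.comp (contDiff_const_smul a)))

theorem IsCutoff.dilate_apply (hχ : IsCutoff χ) {a : ℝ} (ha : a ≠ 0) (x : Space d) :
    hχ.dilate a ha x = χ (a • x) := rfl

/-- The function `χ (a x) - χ (b x)` as a Schwartz function. -/
noncomputable def IsCutoff.annulus (hχ : IsCutoff χ) (a b : ℝ) (ha : 0 < a) (hb : 0 < b) :
    𝓢(Space d, ℂ) :=
  hχ.dilate a ha.ne' - hχ.dilate b hb.ne'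

theorem IsCutoff.annulus_apply (hχ : IsCutoff χ) {a b : ℝ} (ha : 0 < a) (hb : 0 < b)
    (x : Space d) : hχ.annulus a b ha hb x = χ (a • x) - χ (b • x) := rfl

theorem IsCutoff.norm_annulus_le (hχ : IsCutoff χ) {a b : ℝ} (ha : 0 < a) (hb : 0 < b)
    (x : Space d) : ‖hχ.annulus a b ha hb x‖ ≤ 1 := by
  rw [hχ.annulus_apply, ← Complex.ofReal_sub, Complex.norm_real, Real.norm_eq_abs, abs_le]
  constructor <;> linarith [hχ.apply_nonneg (a • x), hχ.apply_nonneg (b • x),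
    hχ.apply_le_one (a • x), hχ.apply_le_one (b • x)]

theorem IsCutoff.annulus_eq_one (hχ : IsCutoff χ) {a b : ℝ} (ha : 0 < a) (hb : 0 < b)
    {x : Space d} (h1 : a * ‖x‖ ≤ 3 / 4) (h2 : 4 / 3 < b * ‖x‖) :
    hχ.annulus a b ha hb x = 1 := by
  rw [hχ.annulus_apply, hχ.apply_eq_one, hχ.apply_eq_zero]
  · simp
  · rwa [norm_smul, Real.norm_eq_abs, abs_of_pos hb]
  · rwa [norm_smul, Real.norm_eq_abs, abs_of_pos ha]

theorem IsCutoff.bounds_of_annulus_ne_zero (hχ : IsCutoff χ) {a b : ℝ} (ha : 0 < a) (hb : 0 < b)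
    (hab : a ≤ b) {x : Space d} (h : hχ.annulus a b ha hb x ≠ 0) :
    a * ‖x‖ ≤ 4 / 3 ∧ 3 / 4 ≤ b * ‖x‖ := by
  rw [hχ.annulus_apply] at h
  have hna : ‖a • x‖ = a * ‖x‖ := by rw [norm_smul, Real.norm_eq_abs, abs_of_pos ha]
  have hnb : ‖b • x‖ = b * ‖x‖ := by rw [norm_smul, Real.norm_eq_abs, abs_of_pos hb]
  have hle : a * ‖x‖ ≤ b * ‖x‖ := by gcongr
  constructor
  · by_contra! hlt
    rw [hχ.apply_eq_zero (by rwa [hna]), hχ.apply_eq_zero (by rw [hnb]; linarith)] at h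
    simp at h
  · by_contra! hlt
    rw [hχ.apply_eq_one (by rw [hna]; linarith), hχ.apply_eq_one (by rw [hnb]; linarith)] at h
    simp at h

end Cutoff

/-! ### The symbols of the linear system -/

section Symbol

variable {d : ℕ}

/-- The symbol of the matrix of the linear system in the unknowns `(q, u_1, …, u_d)`. -/
noncomputable def systemSymbol (d : ℕ) (p μ lam κ ε : ℝ) :
    Option (Fin d) → Option (Fin d) → Space d → ℂ
  | none, none => fun _ => 0
  | none, some k => fun η => -(2 * Real.pi * Complex.I * η k)
  | some i, none => fun η =>
      -((p + κ / ε ^ 2 * (1 - kernelSymbol d ε η)) * (2 * Real.pi * Complex.I * η i))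
  | some i, some k => fun η =>
      (if i = k then -(μ * (2 * Real.pi) ^ 2 * (‖η‖ ^ 2 : ℝ) : ℂ) else 0)
        + (lam + μ) * ((2 * Real.pi * Complex.I * η i) * (2 * Real.pi * Complex.I * η k))

theorem hasTemperateGrowth_coord (k : Fin d) :
    (fun η : Space d => (η k : ℂ)).HasTemperateGrowth :=
  Function.Complex.hasTemperateGrowth_ofReal.comp
    (EuclideanSpace.proj (𝕜 := ℝ) k).hasTemperateGrowth

theorem hasTemperateGrowth_deriv_symbol (k : Fin d) :
    (fun η : Space d => 2 * Real.pi * Complex.I * (η k : ℂ)).HasTemperateGrowth :=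
  (Function.HasTemperateGrowth.const _).mul (hasTemperateGrowth_coord k)

theorem hasTemperateGrowth_ofReal_norm_sq :
    (fun η : Space d => ((‖η‖ ^ 2 : ℝ) : ℂ)).HasTemperateGrowth :=
  Function.Complex.hasTemperateGrowth_ofReal.comp (Function.hasTemperateGrowth_norm_sq _)

theorem systemSymbol_hasTemperateGrowth (p μ lam κ : ℝ) {ε : ℝ} (hε : 0 < ε)
    (i j : Option (Fin d)) : (systemSymbol d p μ lam κ ε i j).HasTemperateGrowth := by
  match i, j with
  | none, none => exact Function.HasTemperateGrowth.const 0
  | none, some k => exact (hasTemperateGrowth_deriv_symbol k).neg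
  | some i, none =>
    exact (((Function.HasTemperateGrowth.const _).add ((Function.HasTemperateGrowth.const _).mul
      ((Function.HasTemperateGrowth.const _).sub (kernelSymbol_hasTemperateGrowth d hε)))).mul
      (hasTemperateGrowth_deriv_symbol i)).neg
  | some i, some k =>
    refine Function.HasTemperateGrowth.add ?_ ((Function.HasTemperateGrowth.const _).mul
      ((hasTemperateGrowth_deriv_symbol i).mul (hasTemperateGrowth_deriv_symbol k)))
    by_cases h : i = k
    · simp only [h, if_true]
      exact ((Function.HasTemperateGrowth.const _).mul hasTemperateGrowth_ofReal_norm_sq).neg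
    · simp only [h, if_false]
      exact Function.HasTemperateGrowth.const 0

theorem fourier_partialD_apply (i : Fin d) (T : Distr d) (ψ : 𝓢(Space d, ℂ)) :
    𝓕 (partialD i T) ψ
      = 𝓕 T (SchwartzMap.smulLeftCLM ℂ (fun η => 2 * Real.pi * Complex.I * (η i : ℂ)) ψ) := by
  rw [partialD, TemperedDistribution.lineDeriv_eq_fourierMultiplierCLM,
    ← FourierTransform.fourierCLM_apply (R := ℂ), map_smul]
  change (2 * Real.pi * Complex.I) • 𝓕 (TemperedDistribution.fourierMultiplierCLM ℂ _ T) ψ = _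
  rw [fourier_fourierMultiplier_apply, ← map_smul]
  congr 1
  ext x
  have h : (fun x : Space d => ((inner ℝ x (EuclideanSpace.single i (1 : ℝ)) : ℝ) : ℂ))
      = fun x => (x i : ℂ) := by
    ext x
    simp [EuclideanSpace.inner_single_right]
  rw [h, SchwartzMap.smulLeftCLM_apply_apply (hasTemperateGrowth_deriv_symbol i),
    smul_apply, SchwartzMap.smulLeftCLM_apply_apply (hasTemperateGrowth_coord i)]
  simp only [smul_eq_mul]
  ring

theorem fourier_laplacian_apply (T : Distr d) (ψ : 𝓢(Space d, ℂ)) :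
    𝓕 (Δ T) ψ = -((2 * Real.pi) ^ 2 : ℂ)
      * 𝓕 T (SchwartzMap.smulLeftCLM ℂ (fun η => ((‖η‖ ^ 2 : ℝ) : ℂ)) ψ) := by
  rw [TemperedDistribution.laplacian_eq_fourierMultiplierCLM,
    ← fourier_fourierMultiplier_apply]
  have h : ∀ (c : ℝ) (S : Distr d), 𝓕 (c • S) ψ = (c : ℂ) * 𝓕 S ψ := fun c S => by
    rw [← Complex.real_smul]
    rfl
  rw [h]
  push_cast
  rfl

theorem fourier_divergence_apply (u : Fin d → Distr d) (ψ : 𝓢(Space d, ℂ)) :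
    𝓕 (divergence u) ψ = ∑ k, 𝓕 (u k)
      (SchwartzMap.smulLeftCLM ℂ (fun η => 2 * Real.pi * Complex.I * (η k : ℂ)) ψ) := by
  simp only [← fourier_partialD_apply]
  exact map_sum (M := Distr d) (PointwiseConvergenceCLM.evalCLM (RingHom.id ℂ) ℂ (𝓕 ψ)) _ _

/-- Tested against `𝓕 ψ`, the equation becomes one for the Fourier transforms of the unknowns, with
the symbols multiplying the test function. This is the form `enorm_apply_le_of_duhamel` expects,
with `none` indexing the density. -/
theorem fourier_mass_apply (p μ lam κ : ℝ) {ε : ℝ} (hε : 0 < ε) (F q : Distr d)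
    (u : Fin d → Distr d) (ψ : 𝓢(Space d, ℂ)) :
    (F - divergence u) (𝓕 ψ) = 𝓕 F ψ
      + ∑ j : Option (Fin d), 𝓕 (j.elim q u)
        (SchwartzMap.smulLeftCLM ℂ (systemSymbol d p μ lam κ ε none j) ψ) := by
  have hz : SchwartzMap.smulLeftCLM ℂ (systemSymbol d p μ lam κ ε none none) ψ = 0 := by
    ext x
    rw [SchwartzMap.smulLeftCLM_apply_apply (systemSymbol_hasTemperateGrowth p μ lam κ hε _ _)]
    simp [systemSymbol]
  have hk : ∀ k, SchwartzMap.smulLeftCLM ℂ (systemSymbol d p μ lam κ ε none (some k)) ψ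
      = -SchwartzMap.smulLeftCLM ℂ (fun η => 2 * Real.pi * Complex.I * (η k : ℂ)) ψ := by
    intro k
    ext x
    rw [neg_apply,
      SchwartzMap.smulLeftCLM_apply_apply (systemSymbol_hasTemperateGrowth p μ lam κ hε _ _),
      SchwartzMap.smulLeftCLM_apply_apply (hasTemperateGrowth_deriv_symbol k)]
    simp [systemSymbol]
  rw [Fintype.sum_option, hz, map_zero, zero_add]
  simp only [hk, map_neg, Option.elim, Finset.sum_neg_distrib]
  rw [← fourier_divergence_apply, ← sub_eq_add_neg]
  rfl

theorem fourier_momentum_apply (p μ lam κ : ℝ) {ε : ℝ} (hε : 0 < ε) (G q : Distr d)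
    (u : Fin d → Distr d) (i : Fin d) (ψ : 𝓢(Space d, ℂ)) :
    (G + diffusion μ lam u i - (p : ℂ) • partialD i q + capillary κ ε q i) (𝓕 ψ) = 𝓕 G ψ
      + ∑ j : Option (Fin d), 𝓕 (j.elim q u)
        (SchwartzMap.smulLeftCLM ℂ (systemSymbol d p μ lam κ ε (some i) j) ψ) := by
  set m : Fin d → Space d → ℂ := fun k η => 2 * Real.pi * Complex.I * (η k : ℂ) with hm
  have hmt : ∀ k, (m k).HasTemperateGrowth := hasTemperateGrowth_deriv_symbol
  have hKt := kernelSymbol_hasTemperateGrowth d hε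
  have hq : SchwartzMap.smulLeftCLM ℂ (systemSymbol d p μ lam κ ε (some i) none) ψ
      = -(p : ℂ) • SchwartzMap.smulLeftCLM ℂ (m i) ψ + ((κ / ε ^ 2 : ℝ) : ℂ) •
        (SchwartzMap.smulLeftCLM ℂ (kernelSymbol d ε) (SchwartzMap.smulLeftCLM ℂ (m i) ψ)
          - SchwartzMap.smulLeftCLM ℂ (m i) ψ) := by
    ext x
    simp only [add_apply, smul_apply, sub_apply, SchwartzMap.smulLeftCLM_apply_apply (hmt i),
      SchwartzMap.smulLeftCLM_apply_apply hKt, smul_eq_mul,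
      SchwartzMap.smulLeftCLM_apply_apply (systemSymbol_hasTemperateGrowth p μ lam κ hε _ _)]
    simp only [systemSymbol, hm]
    push_cast
    ring
  have hu : ∀ k, SchwartzMap.smulLeftCLM ℂ (systemSymbol d p μ lam κ ε (some i) (some k)) ψ
      = (if i = k then -((μ : ℂ) * (2 * Real.pi) ^ 2) else 0) •
          SchwartzMap.smulLeftCLM ℂ (fun η => ((‖η‖ ^ 2 : ℝ) : ℂ)) ψ
        + ((lam + μ : ℝ) : ℂ) •
          SchwartzMap.smulLeftCLM ℂ (m k) (SchwartzMap.smulLeftCLM ℂ (m i) ψ) := by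
    intro k
    ext x
    simp only [add_apply, smul_apply, SchwartzMap.smulLeftCLM_apply_apply (hmt _),
      SchwartzMap.smulLeftCLM_apply_apply hasTemperateGrowth_ofReal_norm_sq, smul_eq_mul,
      SchwartzMap.smulLeftCLM_apply_apply (systemSymbol_hasTemperateGrowth p μ lam κ hε _ _)]
    simp only [systemSymbol, hm]
    split_ifs <;> push_cast <;> ring
  have hL : (G + diffusion μ lam u i - (p : ℂ) • partialD i q + capillary κ ε q i) (𝓕 ψ)
      = 𝓕 G ψ + ((μ : ℂ) * 𝓕 (Δ (u i)) ψ
        + ((lam + μ : ℝ) : ℂ) * 𝓕 (partialD i (divergence u)) ψ)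
        - (p : ℂ) * 𝓕 (partialD i q) ψ
        + ((κ / ε ^ 2 : ℝ) : ℂ) * 𝓕 (partialD i (kernelConv d ε q - q)) ψ := rfl
  have hC : ∀ φ, 𝓕 (kernelConv d ε q - q) φ
      = 𝓕 q (SchwartzMap.smulLeftCLM ℂ (kernelSymbol d ε) φ) - 𝓕 q φ := fun φ => by
    rw [← fourier_fourierMultiplier_apply]
    rfl
  rw [hL, fourier_laplacian_apply, fourier_partialD_apply, fourier_partialD_apply,
    fourier_partialD_apply, fourier_divergence_apply, hC, Fintype.sum_option, hq]
  simp only [hu, map_add, map_smul, map_sub, Option.elim, smul_eq_mul, Finset.sum_add_distrib,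
    ite_mul, zero_mul, Finset.sum_ite_eq, Finset.mem_univ, if_true, ← Finset.mul_sum]
  ring

end Symbol

/-! ### Bounds for the propagator in a dyadic block -/

/-! ### Comparison of the effective pressure with `p + κ min(1/ε², ρ²)`. -/

section Pressure

variable {p κ ε r ρ : ℝ}

/-- The effective pressure coefficient at the frequency `r`. -/
noncomputable def pressureSymbol (p κ ε r : ℝ) : ℝ :=
  p + κ / ε ^ 2 * (1 - Real.exp (-(ε ^ 2 * r ^ 2)))

theorem le_pressureSymbol (hκ : 0 < κ) : p ≤ pressureSymbol p κ ε r := by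
  have h : Real.exp (-(ε ^ 2 * r ^ 2)) ≤ 1 := Real.exp_le_one_iff.mpr (by nlinarith [sq_nonneg (ε * r)])
  have : 0 ≤ κ / ε ^ 2 * (1 - Real.exp (-(ε ^ 2 * r ^ 2))) :=
    mul_nonneg (by positivity) (by linarith)
  rw [pressureSymbol]
  linarith

theorem pressureSymbol_le_of_le (hκ : 0 < κ) (hε : 0 < ε) :
    pressureSymbol p κ ε r ≤ p + κ * r ^ 2 := by
  have h := Real.add_one_le_exp (-(ε ^ 2 * r ^ 2))
  have : κ / ε ^ 2 * (1 - Real.exp (-(ε ^ 2 * r ^ 2))) ≤ κ / ε ^ 2 * (ε ^ 2 * r ^ 2) := by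
    gcongr
    linarith
  have h2 : κ / ε ^ 2 * (ε ^ 2 * r ^ 2) = κ * r ^ 2 := by field_simp
  rw [pressureSymbol]
  linarith

theorem pressureSymbol_le (hp : 0 < p) (hκ : 0 < κ) (hε : 0 < ε) (hr : 0 < r)
    (hrρ' : r ≤ 6 * ρ) :
    pressureSymbol p κ ε r ≤ 36 * (p + κ * min (1 / ε ^ 2) (ρ ^ 2)) := by
  rcases le_total (1 / ε ^ 2) (ρ ^ 2) with h | h
  · rw [min_eq_left h, pressureSymbol]
    have h1 := Real.exp_pos (-(ε ^ 2 * r ^ 2))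
    have h2 : κ / ε ^ 2 * (1 - Real.exp (-(ε ^ 2 * r ^ 2))) ≤ κ / ε ^ 2 * 1 := by
      gcongr
      linarith
    have h3 : κ * (1 / ε ^ 2) = κ / ε ^ 2 := by ring
    have h4 : 0 < κ / ε ^ 2 := by positivity
    rw [h3]
    linarith
  · rw [min_eq_right h]
    have h2 : κ * r ^ 2 ≤ κ * (6 * ρ) ^ 2 := by gcongr
    have := pressureSymbol_le_of_le (p := p) (r := r) hκ hε
    linarith

theorem le_pressureSymbol_of_le (hp : 0 < p) (hκ : 0 < κ) (hε : 0 < ε) (hρ : 0 < ρ)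
    (hrρ : ρ / 3 ≤ r) :
    (p + κ * min (1 / ε ^ 2) (ρ ^ 2)) / 18 ≤ pressureSymbol p κ ε r := by
  have hr2 : ρ ^ 2 / 9 ≤ r ^ 2 := by
    calc ρ ^ 2 / 9 = (ρ / 3) ^ 2 := by ring
      _ ≤ r ^ 2 := by gcongr
  -- Follows from `exp(-y) ≤ 1/(1 + y)`. The factor `1/2` and the `1/9` of `r² ≥ ρ²/9` together give
  -- `1/18`.
  have key : ∀ y : ℝ, 0 ≤ y → min 1 y / 2 ≤ 1 - Real.exp (-y) := by
    intro y hy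
    have h1 := Real.add_one_le_exp y
    have h2 : Real.exp (-y) ≤ 1 / (1 + y) := by
      rw [Real.exp_neg, ← one_div]
      exact one_div_le_one_div_of_le (by linarith) (by linarith)
    have h3 : 1 - 1 / (1 + y) = y / (1 + y) := by
      field_simp
      ring
    have h4 : min 1 y / 2 ≤ y / (1 + y) := by
      rcases le_total 1 y with h | h
      · rw [min_eq_left h, div_le_div_iff₀ (by norm_num) (by linarith)]
        linarith
      · rw [min_eq_right h]
        gcongr
        linarith
    linarith
  have hk := key (ε ^ 2 * r ^ 2) (by positivity)
  have hmin : min (1 / ε ^ 2) (ρ ^ 2) / 9 ≤ 1 / ε ^ 2 * min 1 (ε ^ 2 * r ^ 2) := by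
    rw [mul_min_of_nonneg _ _ (by positivity)]
    refine le_min ?_ ?_
    · have : 0 < 1 / ε ^ 2 := by positivity
      linarith [min_le_left (1 / ε ^ 2) (ρ ^ 2)]
    · have : 1 / ε ^ 2 * (ε ^ 2 * r ^ 2) = r ^ 2 := by field_simp
      linarith [min_le_right (1 / ε ^ 2) (ρ ^ 2)]
  have h5 : κ / ε ^ 2 * (min 1 (ε ^ 2 * r ^ 2) / 2)
      ≤ κ / ε ^ 2 * (1 - Real.exp (-(ε ^ 2 * r ^ 2))) := by gcongr
  have h6 : κ * (min (1 / ε ^ 2) (ρ ^ 2) / 9) ≤ κ * (1 / ε ^ 2 * min 1 (ε ^ 2 * r ^ 2)) := by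
    gcongr
  have h7 : κ / ε ^ 2 * (min 1 (ε ^ 2 * r ^ 2) / 2)
      = κ * (1 / ε ^ 2 * min 1 (ε ^ 2 * r ^ 2)) / 2 := by ring
  rw [pressureSymbol]
  linarith

end Pressure

/-! ### Entrywise bounds for the exponential of the symbol matrix. -/

section Propagator

variable {d : ℕ}

/-- The decay profiles of the components of the solution in a dyadic block. -/
noncomputable def blockDecay (M K ν ν₀ ρ Q : ℝ) : Option (Fin d) → ℝ → ℝ
  | none => fun t => 10000 * M * densityDecay ν ρ Q t
  | some _ => fun t => 10000 * (M * K) * velocityDecay ν ν₀ ρ Q t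

/-- The weights of the components of the solution in a dyadic block. -/
noncomputable def blockWeight (ν ρ : ℝ) : Option (Fin d) → ℝ
  | none => 1 + ν * ρ
  | some _ => 1

open scoped Matrix.Norms.Operator in
theorem hasDerivAt_exp_smul_apply {ι : Type*} [Fintype ι] [DecidableEq ι] (A : Matrix ι ι ℂ)
    (i j : ι) (t : ℝ) :
    HasDerivAt (fun t : ℝ => NormedSpace.exp (t • A) i j)
      (∑ k, A i k * NormedSpace.exp (t • A) k j) t := by
  have h := hasDerivAt_exp_smul_const' (𝕂 := ℝ) A t
  exact (LinearMap.toContinuousLinearMap (Matrix.entryLinearMap ℝ ℂ i j)).hasFDerivAt.comp_hasDerivAt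
    t h

/-- Column `β` of the exponential is the solution of the ODE at frequency `2πx` with initial datum
the basis vector `β`, so `frequency_bound` applies to it. -/
theorem norm_exp_systemSymbol_le {p μ lam κ ε ν ν₀ ρ M K : ℝ} (hp : 0 < p) (hκ : 0 < κ)
    (hμ : 0 < μ) (hε : 0 < ε) (hρ : 0 < ρ) (hν : ν = lam + 2 * μ) (hν0 : 0 < ν)
    (hν₀ : ν₀ = min ν μ) (hM1 : 1 ≤ M) (hMp : √p ≤ M) (hMp' : 1 ≤ M * √p) (hK1 : 1 ≤ K)
    (hKκ : 4 * κ ≤ ν ^ 2 * K ^ 2) {x : Space d} (hx1 : ρ / 3 ≤ 2 * Real.pi * ‖x‖)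
    (hx2 : 2 * Real.pi * ‖x‖ ≤ 6 * ρ) {A : Matrix (Option (Fin d)) (Option (Fin d)) ℂ}
    (hA : ∀ i j, A i j = systemSymbol d p μ lam κ ε i j x) {τ : ℝ} (hτ : 0 ≤ τ)
    (α β : Option (Fin d)) :
    blockWeight ν ρ α * ‖NormedSpace.exp (τ • A) α β‖
      ≤ blockDecay M K ν ν₀ ρ (p + κ * min (1 / ε ^ 2) (ρ ^ 2)) α τ * blockWeight ν ρ β := by
  set r := 2 * Real.pi * ‖x‖ with hrdef
  have hr : 0 < r := by linarith
  set P := pressureSymbol p κ ε r with hPdef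
  set ξ : Fin d → ℝ := fun k => 2 * Real.pi * x k with hξdef
  have hξ : ∑ k, ξ k ^ 2 = r ^ 2 := by
    rw [hrdef, mul_pow, EuclideanSpace.norm_sq_eq, Finset.mul_sum]
    refine Finset.sum_congr rfl fun k _ => ?_
    rw [hξdef, Real.norm_eq_abs, sq_abs, mul_pow]
  have hks : kernelSymbol d ε x = (Real.exp (-(ε ^ 2 * r ^ 2)) : ℂ) := by
    rw [kernelSymbol_apply d hε, norm_smul, Real.norm_eq_abs, abs_of_pos Real.two_pi_pos]
  set y : Option (Fin d) → ℝ → ℂ := fun γ t => NormedSpace.exp (t • A) γ β with hy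
  have hd : ∀ γ t, HasDerivAt (y γ) (∑ k, A γ k * y k t) t := fun γ t =>
    hasDerivAt_exp_smul_apply A γ β t
  have hq : ∀ t, HasDerivAt (y none) (-(Complex.I * ∑ k, (ξ k : ℂ) * y (some k) t)) t := by
    intro t
    convert! hd none t using 1
    rw [Fintype.sum_option, hA, Finset.mul_sum, ← Finset.sum_neg_distrib]
    simp only [hA, systemSymbol, zero_mul, zero_add]
    refine Finset.sum_congr rfl fun k _ => ?_
    simp only [hξdef]
    push_cast
    ring
  have hu : ∀ i t, HasDerivAt (fun t => y (some i) t)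
      (-(Complex.I * P * ξ i * y none t) - μ * r ^ 2 * y (some i) t
      - (lam + μ) * ξ i * ∑ k, (ξ k : ℂ) * y (some k) t) t := by
    intro i t
    convert! hd (some i) t using 1
    rw [Fintype.sum_option, hA]
    simp only [hA, systemSymbol, hks, add_mul, Finset.sum_add_distrib, ite_mul, zero_mul,
      Finset.sum_ite_eq, Finset.mem_univ, if_true]
    have h1 : ∑ k, ((lam : ℂ) + μ) * (2 * Real.pi * Complex.I * (x i : ℂ)
        * (2 * Real.pi * Complex.I * (x k : ℂ))) * y (some k) t
        = -((lam + μ) * ξ i * ∑ k, (ξ k : ℂ) * y (some k) t) := by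
      rw [Finset.mul_sum, ← Finset.sum_neg_distrib]
      refine Finset.sum_congr rfl fun k _ => ?_
      simp only [hξdef]
      push_cast
      linear_combination (4 * (Real.pi : ℂ) ^ 2 * (lam + μ) * x i * x k * y (some k) t)
        * Complex.I_sq
    simp only [add_mul] at h1
    simp only [Finset.sum_add_distrib] at h1
    rw [h1, hPdef, pressureSymbol, hrdef]
    simp only [hξdef]
    push_cast
    ring
  have hy0 : ∀ γ, y γ 0 = if γ = β then 1 else 0 := by
    intro γ
    simp only [hy, zero_smul, NormedSpace.exp_zero, Matrix.one_apply]
  -- A density datum has no velocity, so `U = 0`; for a velocity datum `U = 1`, as `|ξ k| ≤ r`. In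
  -- both cases the size of the datum is exactly the weight of `β`.
  have hY : ∃ U, ‖longitudinal ξ r (fun i => y (some i) 0)‖ ≤ U ∧ (∀ i, ‖y (some i) 0‖ ≤ U) ∧
      (1 + ν * ρ) * ‖y none 0‖ + U = blockWeight ν ρ β := by
    match β with
    | none => exact ⟨0, by simp [hy0, longitudinal], by simp [hy0], by simp [hy0, blockWeight]⟩
    | some k =>
      refine ⟨1, ?_, fun i => ?_, by simp [hy0, blockWeight]⟩
      · have : longitudinal ξ r (fun i => y (some i) 0) = Complex.I * ((ξ k / r : ℝ) : ℂ) := by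
          simp [longitudinal, hy0]
          ring
        rw [this, norm_mul, Complex.norm_I, one_mul, Complex.norm_real, Real.norm_eq_abs, abs_div,
          abs_of_pos hr, div_le_one hr]
        refine abs_le_of_sq_le_sq ?_ hr.le
        rw [← hξ]
        exact Finset.single_le_sum (f := fun k => ξ k ^ 2) (fun _ _ => sq_nonneg _)
          (Finset.mem_univ k)
      · rw [hy0]
        split_ifs <;> simp
  obtain ⟨U, hU, hU', hUw⟩ := hY
  obtain ⟨h1, h2⟩ := frequency_bound hp hκ hμ hρ hx1 hx2 (le_pressureSymbol hκ)
    (pressureSymbol_le_of_le hκ hε) (le_pressureSymbol_of_le hp hκ hε hρ hx1)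
    (pressureSymbol_le hp hκ hε hr hx2) hξ hν hν0 hν₀ hq hu hU hU' hM1 hMp hMp' hK1 hKκ hτ
  rw [hUw] at h1 h2
  match α with
  | none => exact h1
  | some i =>
    rw [blockWeight, one_mul]
    exact h2 i

end Propagator

/-! ### The Duhamel estimate in a dyadic block -/

theorem normL2_fourierMultiplier_le_of_enorm {d : ℕ} {b : Space d → ℂ} {T : Distr d} {S : ℝ≥0∞}
    (h : ∀ φ : 𝓢(Space d, ℂ), ‖𝓕 T (SchwartzMap.smulLeftCLM ℂ b φ)‖ₑ ≤ S * ‖φ.toLp 2‖ₑ) :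
    normL2 (TemperedDistribution.fourierMultiplierCLM ℂ b T) ≤ S := by
  rcases eq_or_ne S ⊤ with rfl | hS
  · exact le_top
  · rw [← ENNReal.ofReal_toReal hS]
    refine normL2_fourierMultiplier_le ENNReal.toReal_nonneg fun φ => ?_
    have := h φ
    rw [← ENNReal.ofReal_toReal hS, ← ofReal_norm, ← ofReal_norm,
      ← ENNReal.ofReal_mul ENNReal.toReal_nonneg] at this
    exact (ENNReal.ofReal_le_ofReal_iff (by positivity)).mp this

/-- Extension by zero lets one minorant, chosen on the longest interval, serve for all earlier
times. -/
theorem ae_le_minorant_mono {s t : ℝ} (hst : s ≤ t) {N M : ℝ → ℝ≥0∞}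
    (hM : ∀ f : ℝ → ℝ≥0∞, AEMeasurable f (volume.restrict (Set.Ioc 0 t)) →
      (∀ᵐ x ∂(volume.restrict (Set.Ioc 0 t)), f x ≤ N x) →
      f ≤ᵐ[volume.restrict (Set.Ioc 0 t)] M)
    {f : ℝ → ℝ≥0∞} (hf : AEMeasurable f (volume.restrict (Set.Ioc 0 s)))
    (hfN : ∀ᵐ x ∂(volume.restrict (Set.Ioc 0 s)), f x ≤ N x) :
    f ≤ᵐ[volume.restrict (Set.Ioc 0 s)] M := by
  have hsub : Set.Ioc 0 s ⊆ Set.Ioc 0 t := Set.Ioc_subset_Ioc_right hst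
  have h1 := hM ((Set.Ioc 0 s).indicator f)
    (((aemeasurable_indicator_iff measurableSet_Ioc).mpr hf).mono_measure Measure.restrict_le_self)
    (by
      rw [ae_restrict_iff' measurableSet_Ioc] at hfN
      refine ae_restrict_of_ae ?_
      filter_upwards [hfN] with x hx
      by_cases h : x ∈ Set.Ioc 0 s
      · rw [Set.indicator_of_mem h]
        exact hx h
      · rw [Set.indicator_of_notMem h]
        exact zero_le)
  have h2 := ae_mono (Measure.restrict_mono hsub le_rfl) h1
  filter_upwards [h2, ae_restrict_mem measurableSet_Ioc] with x hx hxs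
  simpa [Set.indicator_of_mem hxs] using hx

section Block

variable {d : ℕ} {χ : Space d → ℝ} {p μ lam κ ε ν ν₀ M K : ℝ} {I : Set ℝ}
  {q : ℝ → Distr d} {u : ℝ → Fin d → Distr d} {F : ℝ → Distr d} {G : ℝ → Fin d → Distr d}

theorem dilation_pos (j : ℤ) : (0 : ℝ) < 2 ^ (-j) * (2 * Real.pi) := by positivity

theorem blockSymbol_eq_annulus (hχ : IsCutoff χ) (j : ℤ) :
    blockSymbol χ j = hχ.annulus (2 ^ (-j) * (2 * Real.pi) / 2) (2 ^ (-j) * (2 * Real.pi))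
      (half_pos (dilation_pos j)) (dilation_pos j) := by
  ext η
  rw [hχ.annulus_apply, blockSymbol, annulusFun, Complex.ofReal_sub]
  simp only [smul_smul]
  rw [show (2 : ℝ)⁻¹ * (2 ^ (-j) * (2 * Real.pi)) = 2 ^ (-j) * (2 * Real.pi) / 2 by ring]

theorem blockWeight_pos {ρ : ℝ} (hν0 : 0 < ν) (hρ : 0 < ρ) (β : Option (Fin d)) :
    0 < blockWeight ν ρ β := by
  match β with
  | none =>
    rw [blockWeight]
    positivity
  | some _ => exact one_pos

theorem continuous_densityDecay (ν ρ Q : ℝ) : Continuous (densityDecay ν ρ Q) := by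
  unfold densityDecay
  fun_prop

theorem continuous_velocityDecay (ν ν₀ ρ Q : ℝ) : Continuous (velocityDecay ν ν₀ ρ Q) := by
  unfold velocityDecay
  fun_prop

theorem continuous_blockDecay (M K ν ν₀ ρ Q : ℝ) (α : Option (Fin d)) :
    Continuous (blockDecay M K ν ν₀ ρ Q α) := by
  match α with
  | none => exact (continuous_densityDecay ν ρ Q).const_mul _
  | some _ => exact (continuous_velocityDecay ν ν₀ ρ Q).const_mul _

theorem blockDecay_nonneg {ρ Q : ℝ} (hM : 0 ≤ M) (hK : 0 ≤ K) (hQ : 0 ≤ Q)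
    (α : Option (Fin d)) (t : ℝ) : 0 ≤ blockDecay M K ν ν₀ ρ Q α t := by
  match α with
  | none =>
    have : 0 ≤ densityDecay ν ρ Q t := by
      unfold densityDecay
      positivity
    rw [blockDecay]
    positivity
  | some _ =>
    have : 0 ≤ velocityDecay ν ν₀ ρ Q t := by
      have : 0 ≤ min 1 (Q / (ν ^ 2 * ρ ^ 2)) := le_min zero_le_one (by positivity)
      unfold velocityDecay
      positivity
    rw [blockDecay]
    positivity

theorem IsSolution.blockWeight_mul_normL2_le (hχ : IsCutoff χ) (hp : 0 < p) (hκ : 0 < κ)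
    (hμ : 0 < μ) (hε : 0 < ε) (hν : ν = lam + 2 * μ) (hν0 : 0 < ν)
    (hν₀ : ν₀ = min ν μ) (hM1 : 1 ≤ M) (hMp : √p ≤ M) (hMp' : 1 ≤ M * √p) (hK1 : 1 ≤ K)
    (hKκ : 4 * κ ≤ ν ^ 2 * K ^ 2) (hsol : IsSolution p μ lam κ ε I q u F G) (j : ℤ)
    {t : ℝ} (ht : 0 ≤ t) (hI : Set.Icc 0 t ⊆ I)
    (hN₀ : ∀ β : Option (Fin d), normL2 (block χ j (β.elim (q 0) (u 0))) ≠ ⊤)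
    {Y : Option (Fin d) → ℝ → ℝ≥0∞} (hYm : ∀ β, Measurable (Y β))
    (hYf : ∀ β, ∫⁻ s in Set.Ioc 0 t, Y β s ≠ ⊤)
    (hY : ∀ β (f : ℝ → ℝ≥0∞), AEMeasurable f (volume.restrict (Set.Ioc 0 t)) →
      (∀ᵐ s ∂(volume.restrict (Set.Ioc 0 t)),
        f s ≤ normL2 (block χ j (β.elim (F s) (G s)))) →
      f ≤ᵐ[volume.restrict (Set.Ioc 0 t)] Y β) (α : Option (Fin d)) :
    ENNReal.ofReal (blockWeight ν (2 ^ j) α) * normL2 (block χ j (α.elim (q t) (u t)))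
      ≤ (∑ β : Option (Fin d), ENNReal.ofReal (blockWeight ν (2 ^ j) β)
            * normL2 (block χ j (β.elim (q 0) (u 0))))
          * ENNReal.ofReal (blockDecay M K ν ν₀ (2 ^ j)
              (p + κ * min (1 / ε ^ 2) ((2 ^ j) ^ 2)) α t)
        + ∫⁻ s in Set.Ioc 0 t, (∑ β, ENNReal.ofReal (blockWeight ν (2 ^ j) β) * Y β s)
          * ENNReal.ofReal (blockDecay M K ν ν₀ (2 ^ j)
              (p + κ * min (1 / ε ^ 2) ((2 ^ j) ^ 2)) α (t - s)) := by
  set ρ : ℝ := 2 ^ j with hρdef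
  have hρ : 0 < ρ := by positivity
  set D := blockDecay M K ν ν₀ ρ (p + κ * min (1 / ε ^ 2) (ρ ^ 2)) α with hD
  have hD0 : ∀ t, 0 ≤ D t := fun t => by
    have : 0 ≤ min (1 / ε ^ 2) (ρ ^ 2) := le_min (by positivity) (by positivity)
    exact blockDecay_nonneg (by linarith) (by linarith) (by positivity) α t
  have hDc : Continuous D := continuous_blockDecay _ _ _ _ _ _ _
  set w : Option (Fin d) → ℝ := blockWeight ν ρ with hw
  have hw0 : ∀ β, 0 < w β := blockWeight_pos hν0 hρ
  set a : ℝ := 2 ^ (-j) * (2 * Real.pi) with ha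
  have ha0 : 0 < a := dilation_pos j
  have haρ : ρ * a = 2 * Real.pi := by
    rw [ha, hρdef, ← mul_assoc, ← zpow_add₀ two_ne_zero]
    simp
  set b : 𝓢(Space d, ℂ) := hχ.annulus (a / 2) a (half_pos ha0) ha0 with hb
  have hbs : blockSymbol χ j = b := blockSymbol_eq_annulus hχ j
  -- Here `a‖x‖ = |ξ|/ρ`. The block symbol `b` lives on `3/4 ≤ a‖x‖ ≤ 8/3`; the wider `c` is `1`
  -- there and lives on `3/8 ≤ a‖x‖ ≤ 16/3`, inside the range `ρ/3 ≤ |ξ| ≤ 6ρ` of the frequency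
  -- bounds; `θ` is `1` for `a‖x‖ ≤ 12`, so that `A θ` is Schwartz and equals `A` on both supports.
  set c : 𝓢(Space d, ℂ) := hχ.annulus (a / 4) (2 * a) (by positivity) (by positivity) with hc
  set θ : 𝓢(Space d, ℂ) := hχ.dilate (a / 16) (by positivity) with hθ
  set A := systemSymbol d p μ lam κ ε with hA
  have hAt : ∀ i j, (A i j).HasTemperateGrowth := systemSymbol_hasTemperateGrowth p μ lam κ hε
  set g : Option (Fin d) → Option (Fin d) → 𝓢(Space d, ℂ) :=
    fun i j => SchwartzMap.smulLeftCLM ℂ (A i j) θ with hg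
  have hgx : ∀ i j x, g i j x = A i j x * θ x := fun i j x => by
    rw [hg, SchwartzMap.smulLeftCLM_apply_apply (hAt i j), smul_eq_mul]
  have hθ1 : ∀ x, a * ‖x‖ ≤ 12 → θ x = 1 := by
    intro x hx
    rw [hθ, hχ.dilate_apply, hχ.apply_eq_one, Complex.ofReal_one]
    rw [norm_smul, Real.norm_eq_abs, abs_of_pos (by positivity)]
    linarith
  have hbx : ∀ x, b x ≠ 0 → 3 / 4 ≤ a * ‖x‖ ∧ a * ‖x‖ ≤ 8 / 3 := by
    intro x hx
    obtain ⟨h1, h2⟩ := hχ.bounds_of_annulus_ne_zero (half_pos ha0) ha0 (by linarith) hx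
    exact ⟨h2, by linarith⟩
  have hcx : ∀ x, c x ≠ 0 → 3 / 8 ≤ a * ‖x‖ ∧ a * ‖x‖ ≤ 16 / 3 := by
    intro x hx
    obtain ⟨h1, h2⟩ := hχ.bounds_of_annulus_ne_zero (by positivity) (by positivity)
      (by linarith) hx
    constructor <;> linarith
  have hVN : ∀ (T : Distr d) (φ : 𝓢(Space d, ℂ)),
      ‖𝓕 T (SchwartzMap.smulLeftCLM ℂ b φ)‖ₑ ≤ normL2 (block χ j T) * ‖φ.toLp 2‖ₑ := by
    intro T φ
    rw [block, hbs]
    exact enorm_fourier_apply_smul_le b T φ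
  have key : normL2 (block χ j (α.elim (q t) (u t)))
      ≤ ∑ β, (normL2 (block χ j (β.elim (q 0) (u 0))) * ENNReal.ofReal (D t * w β / w α)
        + ∫⁻ s in Set.Ioc 0 t, Y β s * ENNReal.ofReal (D (t - s) * w β / w α)) := by
    rw [block, hbs]
    refine normL2_fourierMultiplier_le_of_enorm fun φ => ?_
    refine enorm_apply_le_of_duhamel ht (V := fun s β => 𝓕 (β.elim (q s) (u s)))
      (H := fun s β => 𝓕 (β.elim (F s) (G s))) (A := A) (g := g) (b := b) (c := c)
      (k := fun β τ => D τ * w β / w α) (N₀ := fun β => normL2 (block χ j (β.elim (q 0) (u 0))))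
      (N := fun β s => normL2 (block χ j (β.elim (F s) (G s)))) (M := Y)
      hAt ?_ ?_ ?_ ?_ ?_ (hχ.norm_annulus_le _ _) α ?_ ?_ ?_ (fun β φ => hVN _ φ) hN₀
      (fun β s φ => hVN _ φ) hYm hYf hY φ
    · intro i ψ
      match i with
      | none => exact (hsol.continuous_q (𝓕 ψ)).mono hI
      | some i => exact (hsol.continuous_u i (𝓕 ψ)).mono hI
    · intro i ψ
      have htI : t ∈ I := hI ⟨ht, le_rfl⟩
      match i with
      | none => exact hsol.integrable_F (𝓕 ψ) t htI
      | some i => exact hsol.integrable_G i (𝓕 ψ) t htI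
    · intro i ψ s hs
      match i with
      | none =>
        simp only [hA, Option.elim_none, ← fourier_mass_apply p μ lam κ hε]
        exact hsol.mass (𝓕 ψ) s (hI hs)
      | some i =>
        simp only [hA, Option.elim_some, ← fourier_momentum_apply p μ lam κ hε]
        exact hsol.momentum i (𝓕 ψ) s (hI hs)
    · intro i j x
      by_cases hx : b x = 0
      · rw [hx, zero_mul, zero_mul]
      · rw [hgx, hθ1 x (by linarith [(hbx x hx).2]), mul_one]
    · intro x
      by_cases hx : b x = 0
      · rw [hx, zero_mul]
      · have hcx1 : c x = 1 := by
          obtain ⟨h1, h2⟩ := hbx x hx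
          exact hχ.annulus_eq_one _ _ (by linarith) (by linarith)
        rw [hcx1, mul_one]
    · intro β
      exact ((hDc.mul_const _).div_const _).measurable
    · intro β τ _
      have := hD0 τ
      have := hw0 β
      have := hw0 α
      positivity
    · intro x hx τ hτ β
      obtain ⟨h1, h2⟩ := hcx x hx
      have hr : 2 * Real.pi * ‖x‖ = ρ * (a * ‖x‖) := by rw [← mul_assoc, haρ]
      rw [le_div_iff₀ (hw0 α), mul_comm]
      refine norm_exp_systemSymbol_le hp hκ hμ hε hρ hν hν0 hν₀ hM1 hMp hMp' hK1 hKκ (x := x)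
        ?_ ?_ ?_ hτ.1 α β
      · rw [hr]
        calc ρ / 3 = ρ * (1 / 3) := by ring
          _ ≤ ρ * (a * ‖x‖) := by
            gcongr
            linarith
      · rw [hr]
        calc ρ * (a * ‖x‖) ≤ ρ * 6 := by
              gcongr
              linarith
          _ = 6 * ρ := by ring
      · intro i j
        rw [symbolMatrix, Matrix.of_apply, hgx, hθ1 x (by linarith), mul_one]
  have hkw : ∀ τ β, ENNReal.ofReal (w α) * ENNReal.ofReal (D τ * w β / w α)
      = ENNReal.ofReal (w β) * ENNReal.ofReal (D τ) := by
    intro τ β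
    rw [← ENNReal.ofReal_mul (hw0 α).le, ← ENNReal.ofReal_mul (hw0 β).le]
    congr 1
    field_simp [(hw0 α).ne']
  refine (mul_le_mul_right key (ENNReal.ofReal (w α))).trans (le_of_eq ?_)
  have hDm : Measurable fun s => ENNReal.ofReal (D (t - s)) :=
    (hDc.comp (continuous_const.sub continuous_id)).measurable.ennreal_ofReal
  simp only [Finset.sum_mul]
  rw [lintegral_finsetSum (f := fun β s => ENNReal.ofReal (w β) * Y β s
    * ENNReal.ofReal (D (t - s))) _ fun β _ => ((hYm β).const_mul _).mul hDm, Finset.mul_sum,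
    ← Finset.sum_add_distrib]
  refine Finset.sum_congr rfl fun β _ => ?_
  rw [mul_add]
  congr 1
  · rw [mul_left_comm, hkw]
    ring
  · rw [← lintegral_const_mul' _ _ ENNReal.ofReal_ne_top]
    refine lintegral_congr fun s => ?_
    rw [mul_left_comm, hkw]
    ring

end Block

/-! ### Time integrals of the decay profiles -/

section Convolution

theorem lintegral_exp_neg_le {a : ℝ} (ha : 0 < a) :
    ∫⁻ s in Set.Ioi (0 : ℝ), ENNReal.ofReal (Real.exp (-(a * s))) ≤ ENNReal.ofReal (1 / a) := by
  have hi : IntegrableOn (fun s => Real.exp (-a * s)) (Set.Ioi 0) :=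
    integrableOn_exp_mul_Ioi (by linarith) 0
  simp only [← neg_mul]
  rw [← ofReal_integral_eq_lintegral_ofReal hi (ae_of_all _ fun _ => (Real.exp_pos _).le),
    integral_exp_mul_Ioi (by linarith) 0]
  refine ENNReal.ofReal_le_ofReal (le_of_eq ?_)
  simp [neg_div_neg_eq]

theorem lintegral_densityDecay_le {ν ρ Q : ℝ} (hν : 0 < ν) (hρ : 0 < ρ) (hQ : 0 < Q) :
    ∫⁻ s in Set.Ioi (0 : ℝ), ENNReal.ofReal (densityDecay ν ρ Q s)
      ≤ ENNReal.ofReal (18 / (ν * ρ ^ 2) + 18 * ν / Q) := by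
  have h1 := lintegral_exp_neg_le (a := ν * ρ ^ 2 / 18) (by positivity)
  have h2 := lintegral_exp_neg_le (a := Q / (18 * ν)) (by positivity)
  simp only [densityDecay, ENNReal.ofReal_add (Real.exp_pos _).le (Real.exp_pos _).le]
  rw [lintegral_add_left (by fun_prop), ENNReal.ofReal_add (by positivity) (by positivity)]
  refine add_le_add (h1.trans (le_of_eq ?_)) (h2.trans (le_of_eq ?_)) <;> rw [one_div_div]

/-- In the slow term the amplitude `Q/(ν²ρ²)` cancels the `1/Q` of the integrated exponential,
leaving a purely parabolic `1/(νρ²)`. -/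
theorem lintegral_velocityDecay_le {ν ν₀ ρ Q : ℝ} (hν : 0 < ν) (hν₀ : 0 < ν₀) (hρ : 0 < ρ)
    (hQ : 0 < Q) :
    ∫⁻ s in Set.Ioi (0 : ℝ), ENNReal.ofReal (velocityDecay ν ν₀ ρ Q s)
      ≤ ENNReal.ofReal (18 / (ν₀ * ρ ^ 2) + 18 / (ν * ρ ^ 2)) := by
  have h1 := lintegral_exp_neg_le (a := ν₀ * ρ ^ 2 / 18) (by positivity)
  have h2 := lintegral_exp_neg_le (a := Q / (18 * ν)) (by positivity)
  have hm : 0 ≤ min 1 (Q / (ν ^ 2 * ρ ^ 2)) := le_min zero_le_one (by positivity)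
  simp only [velocityDecay, ENNReal.ofReal_add (Real.exp_pos _).le
    (mul_nonneg hm (Real.exp_pos _).le), ENNReal.ofReal_mul hm]
  rw [lintegral_add_left (by fun_prop), ENNReal.ofReal_add (by positivity) (by positivity),
    lintegral_const_mul' _ _ ENNReal.ofReal_ne_top]
  refine add_le_add (h1.trans (le_of_eq ?_)) ?_
  · rw [one_div_div]
  · refine (mul_le_mul_right h2 _).trans ?_
    rw [← ENNReal.ofReal_mul hm]
    refine ENNReal.ofReal_le_ofReal ?_
    calc _ ≤ Q / (ν ^ 2 * ρ ^ 2) * (1 / (Q / (18 * ν))) := by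
          gcongr
          exact min_le_right _ _
      _ = 18 / (ν * ρ ^ 2) := by field_simp

theorem timeNorm_top_le {t : ℝ} {N : ℝ → ℝ≥0∞} {B : ℝ≥0∞} (h : ∀ s ∈ Set.Icc 0 t, N s ≤ B) :
    timeNorm ⊤ t N ≤ B := by
  rw [timeNorm, eLpNorm_exponent_top]
  refine eLpNormEssSup_le_of_ae_enorm_bound ?_
  filter_upwards [ae_restrict_mem measurableSet_Icc] with s hs
  simpa using h s hs

theorem timeNorm_one_eq (t : ℝ) (N : ℝ → ℝ≥0∞) :
    timeNorm 1 t N = ∫⁻ s in Set.Ioc 0 t, N s := by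
  rw [timeNorm, eLpNorm_one_eq_lintegral_enorm, restrict_Ioc_eq_restrict_Icc]
  simp

theorem timeNorm_top_le_of_convolution {t : ℝ} {N Y k : ℝ → ℝ≥0∞} {Y₀ B : ℝ≥0∞}
    (hk : ∀ s, 0 ≤ s → k s ≤ B) (hYm : Measurable Y)
    (h : ∀ s ∈ Set.Icc 0 t, N s ≤ Y₀ * k s + ∫⁻ r in Set.Ioc 0 s, Y r * k (s - r)) :
    timeNorm ⊤ t N ≤ B * (Y₀ + ∫⁻ r in Set.Ioc 0 t, Y r) := by
  refine timeNorm_top_le fun s hs => (h s hs).trans ?_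
  rw [mul_add, mul_comm Y₀]
  refine add_le_add (mul_le_mul_left (hk s hs.1) _) ?_
  rw [← lintegral_const_mul _ hYm]
  refine (setLIntegral_mono' measurableSet_Ioc fun r hr => ?_).trans
    (lintegral_mono_set (Set.Ioc_subset_Ioc_right hs.2))
  rw [mul_comm]
  exact mul_le_mul_left (hk _ (by linarith [hr.2])) _

/-- Young's inequality `L¹ * L¹ ⊂ L¹` by Tonelli. Only the majorant has to be measurable, not `N`.
-/
theorem timeNorm_one_le_of_convolution {t : ℝ} {N Y k : ℝ → ℝ≥0∞} {Y₀ J : ℝ≥0∞}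
    (hkm : Measurable k) (hk : ∫⁻ s in Set.Ioi 0, k s ≤ J) (hYm : Measurable Y)
    (h : ∀ s ∈ Set.Icc 0 t, N s ≤ Y₀ * k s + ∫⁻ r in Set.Ioc 0 s, Y r * k (s - r)) :
    timeNorm 1 t N ≤ J * (Y₀ + ∫⁻ r in Set.Ioc 0 t, Y r) := by
  have hmeas : Measurable (Function.uncurry fun s r : ℝ =>
      (Set.Ioi (0 : ℝ)).indicator k (s - r)) :=
    (hkm.indicator measurableSet_Ioi).comp (measurable_fst.sub measurable_snd)
  have hkI : ∫⁻ s, (Set.Ioi (0 : ℝ)).indicator k s ≤ J := by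
    rwa [lintegral_indicator measurableSet_Ioi]
  rw [timeNorm_one_eq]
  have hle : ∀ s ∈ Set.Ioc 0 t, N s ≤ Y₀ * k s
      + ∫⁻ r in Set.Ioc 0 t, Y r * (Set.Ioi (0 : ℝ)).indicator k (s - r) := by
    intro s hs
    refine (h s ⟨hs.1.le, hs.2⟩).trans (add_le_add le_rfl ?_)
    -- Dropping the endpoint `r = s` makes `s - r` positive, where the truncated kernel equals `k`.
    rw [← restrict_Ioo_eq_restrict_Ioc]
    refine (setLIntegral_mono' measurableSet_Ioo fun r hr => ?_).trans
      (lintegral_mono_set (Set.Ioo_subset_Ioc_self.trans (Set.Ioc_subset_Ioc_right hs.2)))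
    rw [Set.indicator_of_mem (Set.mem_Ioi.mpr (by linarith [hr.2]))]
  calc ∫⁻ s in Set.Ioc 0 t, N s
      ≤ ∫⁻ s in Set.Ioc 0 t, (Y₀ * k s
        + ∫⁻ r in Set.Ioc 0 t, Y r * (Set.Ioi (0 : ℝ)).indicator k (s - r)) :=
        setLIntegral_mono' measurableSet_Ioc hle
    _ = Y₀ * (∫⁻ s in Set.Ioc 0 t, k s) + ∫⁻ r in Set.Ioc 0 t, Y r *
        ∫⁻ s in Set.Ioc 0 t, (Set.Ioi (0 : ℝ)).indicator k (s - r) := by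
      rw [lintegral_add_left (hkm.const_mul _), lintegral_const_mul _ hkm, lintegral_lintegral_swap]
      · congr 1
        refine lintegral_congr fun r => ?_
        exact lintegral_const_mul _ (hmeas.comp (measurable_id.prodMk measurable_const))
      · exact ((hYm.comp measurable_snd).mul hmeas).aemeasurable
    _ ≤ Y₀ * J + ∫⁻ r in Set.Ioc 0 t, Y r * J := by
      refine add_le_add (mul_le_mul_right ((lintegral_mono_set Set.Ioc_subset_Ioi_self).trans hk) _)
        (lintegral_mono fun r => mul_le_mul_right ?_ _)
      refine (setLIntegral_le_lintegral _ _).trans ?_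
      rw [lintegral_sub_right_eq_self (fun s => (Set.Ioi (0 : ℝ)).indicator k s) r]
      exact hkI
    _ = J * (Y₀ + ∫⁻ r in Set.Ioc 0 t, Y r) := by
      rw [lintegral_mul_const _ hYm]
      ring

theorem normL2_le_normL2Vec {d : ℕ} (U : Fin d → Distr d) (i : Fin d) :
    normL2 (U i) ≤ normL2Vec U := by
  rw [normL2Vec, one_div, ENNReal.le_rpow_inv_iff two_pos]
  rw [ENNReal.rpow_two]
  exact Finset.single_le_sum (f := fun i => normL2 (U i) ^ 2) (fun _ _ => zero_le) (Finset.mem_univ i)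

theorem normL2Vec_le_sum {d : ℕ} (U : Fin d → Distr d) : normL2Vec U ≤ ∑ i, normL2 (U i) := by
  rw [normL2Vec, one_div, ENNReal.rpow_inv_le_iff two_pos, ENNReal.rpow_two]
  exact Finset.sum_sq_le_sq_sum_of_nonneg fun _ _ => zero_le

end Convolution

/-! ### The estimate of a dyadic block -/

section Estimate

theorem timeNorm_top_const_mul (t : ℝ) (a : ℝ≥0∞) (N : ℝ → ℝ≥0∞) :
    timeNorm ⊤ t (fun s => a * N s) = a * timeNorm ⊤ t N := by
  simp only [timeNorm, eLpNorm_exponent_top, eLpNormEssSup, enorm_eq_self]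
  exact ENNReal.essSup_const_mul

theorem timeNorm_one_const_mul (t : ℝ) {a : ℝ≥0∞} (ha : a ≠ ⊤) (N : ℝ → ℝ≥0∞) :
    timeNorm 1 t (fun s => a * N s) = a * timeNorm 1 t N := by
  rw [timeNorm_one_eq, timeNorm_one_eq, lintegral_const_mul' _ _ ha]

theorem timeNorm_one_mono {t : ℝ} {N N' : ℝ → ℝ≥0∞} (h : ∀ s, N s ≤ N' s) :
    timeNorm 1 t N ≤ timeNorm 1 t N' := by
  rw [timeNorm_one_eq, timeNorm_one_eq]
  exact lintegral_mono h

theorem densityDecay_le_two {ν ρ Q t : ℝ} (hν : 0 < ν) (hQ : 0 < Q) (ht : 0 ≤ t) :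
    densityDecay ν ρ Q t ≤ 2 := by
  have h1 : Real.exp (-(ν * ρ ^ 2 / 18 * t)) ≤ 1 :=
    Real.exp_le_one_iff.mpr (neg_nonpos.mpr (by positivity))
  have h2 : Real.exp (-(Q / (18 * ν) * t)) ≤ 1 :=
    Real.exp_le_one_iff.mpr (neg_nonpos.mpr (by positivity))
  unfold densityDecay
  linarith

theorem velocityDecay_le_two {ν ν₀ ρ Q t : ℝ} (hν : 0 < ν) (hν₀ : 0 < ν₀) (hQ : 0 < Q)
    (ht : 0 ≤ t) : velocityDecay ν ν₀ ρ Q t ≤ 2 := by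
  have h1 : Real.exp (-(ν₀ * ρ ^ 2 / 18 * t)) ≤ 1 :=
    Real.exp_le_one_iff.mpr (neg_nonpos.mpr (by positivity))
  have h2 : Real.exp (-(Q / (18 * ν) * t)) ≤ 1 :=
    Real.exp_le_one_iff.mpr (neg_nonpos.mpr (by positivity))
  have h3 : min 1 (Q / (ν ^ 2 * ρ ^ 2)) * Real.exp (-(Q / (18 * ν) * t)) ≤ 1 :=
    mul_le_one₀ (min_le_left _ _) (Real.exp_pos _).le h2
  unfold velocityDecay
  linarith

/-- The parabolic mode contributes `18` because `σ ≤ ρ²`. The slow mode contributes at most `18 ν²/κ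
≤ 72 K`, the place where `ν² ≤ 4κK` is needed. -/
theorem mul_density_integral_le {ν ρ p κ σ K : ℝ} (hν : 0 < ν) (hρ : 0 < ρ) (hp : 0 < p)
    (hκ : 0 < κ) (hσ : 0 < σ) (hσρ : σ ≤ ρ ^ 2) (hK1 : 1 ≤ K) (hKν : ν ^ 2 ≤ 4 * κ * K) :
    ν * σ * (18 / (ν * ρ ^ 2) + 18 * ν / (p + κ * σ)) ≤ 90 * K := by
  have h1 : ν * σ * (18 / (ν * ρ ^ 2)) ≤ 18 := by
    rw [← mul_div_assoc, div_le_iff₀ (by positivity)]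
    have : ν * σ ≤ ν * ρ ^ 2 := by gcongr
    linarith
  have h2 : ν * σ * (18 * ν / (p + κ * σ)) ≤ 72 * K := by
    rw [← mul_div_assoc, div_le_iff₀ (by positivity)]
    have h3 : ν ^ 2 * (18 * σ) ≤ 4 * κ * K * (18 * σ) := by gcongr
    have h4 : 0 ≤ 72 * K * p := by positivity
    linarith
  linarith

theorem mul_velocity_integral_le {ν ν₀ ρ : ℝ} (hν₀ : 0 < ν₀) (hν : ν₀ ≤ ν) (hρ : 0 < ρ) :
    ν₀ * ρ ^ 2 * (18 / (ν₀ * ρ ^ 2) + 18 / (ν * ρ ^ 2)) ≤ 36 := by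
  have hν' : 0 < ν := by linarith
  have h1 : ν₀ * ρ ^ 2 * (18 / (ν₀ * ρ ^ 2)) = 18 := by field_simp
  have h2 : ν₀ * ρ ^ 2 * (18 / (ν * ρ ^ 2)) ≤ 18 := by
    rw [← mul_div_assoc, div_le_iff₀ (by positivity)]
    have : ν₀ * ρ ^ 2 ≤ ν * ρ ^ 2 := by gcongr
    linarith
  linarith

variable {d : ℕ} {χ : Space d → ℝ} {p μ lam κ ε ν ν₀ M K : ℝ} {I : Set ℝ}
  {q : ℝ → Distr d} {u : ℝ → Fin d → Distr d} {F : ℝ → Distr d} {G : ℝ → Fin d → Distr d}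

theorem IsSolution.block_estimate (hχ : IsCutoff χ) (hp : 0 < p) (hκ : 0 < κ)
    (hμ : 0 < μ) (hε : 0 < ε) (hν : ν = lam + 2 * μ) (hν0 : 0 < ν)
    (hν₀ : ν₀ = min ν μ) (hM1 : 1 ≤ M) (hMp : √p ≤ M) (hMp' : 1 ≤ M * √p) (hK1 : 1 ≤ K)
    (hKκ : 4 * κ ≤ ν ^ 2 * K ^ 2) (hKν : ν ^ 2 ≤ 4 * κ * K)
    (hsol : IsSolution p μ lam κ ε I q u F G) (j : ℤ)
    {t : ℝ} (hI : Set.Icc 0 t ⊆ I)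
    (hN₀ : ∀ β : Option (Fin d), normL2 (block χ j (β.elim (q 0) (u 0))) ≠ ⊤)
    (hN : ∀ β : Option (Fin d),
      timeNorm 1 t (fun s => normL2 (block χ j (β.elim (F s) (G s)))) ≠ ⊤) :
    timeNorm ⊤ t (fun s => normL2Vec fun i => block χ j (u s i))
        + ENNReal.ofReal (ν₀ * 2 ^ (2 * j))
          * timeNorm 1 t (fun s => normL2Vec fun i => block χ j (u s i))
        + ENNReal.ofReal (1 + ν * 2 ^ j)
          * (timeNorm ⊤ t (fun s => normL2 (block χ j (q s)))
            + ENNReal.ofReal (ν * min (1 / ε ^ 2) (2 ^ (2 * j)))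
              * timeNorm 1 t (fun s => normL2 (block χ j (q s))))
      ≤ ENNReal.ofReal ((d * 380000 + 920000) * (M * K))
        * ∑ β : Option (Fin d), ENNReal.ofReal (blockWeight ν (2 ^ j) β)
          * (normL2 (block χ j (β.elim (q 0) (u 0)))
            + timeNorm 1 t (fun s => normL2 (block χ j (β.elim (F s) (G s))))) := by
  simp only [timeNorm_one_eq t (fun s => normL2 (block χ j (Option.elim _ (F s) (G s))))] at hN ⊢
  have h2j : (2 : ℝ) ^ (2 * j) = (2 ^ j) ^ 2 := by
    rw [mul_comm, zpow_mul]
    norm_cast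
  rw [h2j]
  -- The minorants have the same integrals as the block norms of the forces, so the final bound is
  -- expressed by the norms themselves.
  choose Y hYm hYi hY using fun β : Option (Fin d) =>
    exists_measurable_minorant (volume.restrict (Set.Ioc 0 t)) (hN β)
  set ρ : ℝ := 2 ^ j with hρdef
  have hρ : 0 < ρ := by positivity
  set σ : ℝ := min (1 / ε ^ 2) (ρ ^ 2) with hσdef
  have hσ : 0 < σ := lt_min (by positivity) (by positivity)
  have hν₀0 : 0 < ν₀ := by rw [hν₀]; exact lt_min hν0 hμ
  set w : Option (Fin d) → ℝ := blockWeight ν ρ with hw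
  set Q : ℝ := p + κ * σ with hQdef
  have hQ : 0 < Q := by positivity
  set Y₀ : ℝ≥0∞ := ∑ β : Option (Fin d), ENNReal.ofReal (w β)
    * normL2 (block χ j (β.elim (q 0) (u 0))) with hY₀
  set Yt : ℝ → ℝ≥0∞ := fun s => ∑ β, ENNReal.ofReal (w β) * Y β s with hYt
  have hYtm : Measurable Yt := Finset.measurable_fun_sum _ fun β _ => (hYm β).const_mul _
  have hM0 : 0 < M := by linarith
  have hK0 : 0 < K := by linarith
  have main : ∀ α : Option (Fin d), ∀ s ∈ Set.Icc 0 t,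
      ENNReal.ofReal (w α) * normL2 (block χ j (α.elim (q s) (u s)))
        ≤ Y₀ * ENNReal.ofReal (blockDecay M K ν ν₀ ρ Q α s)
          + ∫⁻ r in Set.Ioc 0 s, Yt r * ENNReal.ofReal (blockDecay M K ν ν₀ ρ Q α (s - r)) := by
    intro α s hs
    refine hsol.blockWeight_mul_normL2_le hχ hp hκ hμ hε hν hν0 hν₀ hM1 hMp hMp' hK1 hKκ j hs.1
      ((Set.Icc_subset_Icc_right hs.2).trans hI) hN₀ hYm (fun β => ?_)
      (fun β f hf hfN => ae_le_minorant_mono hs.2 (hY β) hf hfN) α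
    refine ((lintegral_mono_set (Set.Ioc_subset_Ioc_right hs.2)).trans_lt ?_).ne
    rw [hYi]
    exact (hN β).lt_top
  have hZ : Y₀ + ∫⁻ r in Set.Ioc 0 t, Yt r = ∑ β : Option (Fin d), ENNReal.ofReal (w β)
      * (normL2 (block χ j (β.elim (q 0) (u 0)))
        + ∫⁻ s in Set.Ioc 0 t, normL2 (block χ j (β.elim (F s) (G s)))) := by
    rw [hY₀, hYt, lintegral_finsetSum _ fun β _ => (hYm β).const_mul _, ← Finset.sum_add_distrib]
    refine Finset.sum_congr rfl fun β _ => ?_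
    rw [lintegral_const_mul _ (hYm β), hYi, mul_add]
  rw [← hZ]
  set Z := Y₀ + ∫⁻ r in Set.Ioc 0 t, Yt r with hZdef
  set kq : ℝ → ℝ≥0∞ := fun s => ENNReal.ofReal (10000 * M * densityDecay ν ρ Q s) with hkq
  set kv : ℝ → ℝ≥0∞ :=
    fun s => ENNReal.ofReal (d * (10000 * (M * K)) * velocityDecay ν ν₀ ρ Q s) with hkv
  have hkqm : Measurable kq := ((continuous_densityDecay ν ρ Q).const_mul _).measurable.ennreal_ofReal
  have hkvm : Measurable kv :=
    ((continuous_velocityDecay ν ν₀ ρ Q).const_mul _).measurable.ennreal_ofReal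
  have hq : ∀ s ∈ Set.Icc 0 t, ENNReal.ofReal (1 + ν * ρ) * normL2 (block χ j (q s))
      ≤ Y₀ * kq s + ∫⁻ r in Set.Ioc 0 s, Yt r * kq (s - r) := main none
  have hu : ∀ s ∈ Set.Icc 0 t, normL2Vec (fun i => block χ j (u s i))
      ≤ Y₀ * kv s + ∫⁻ r in Set.Ioc 0 s, Yt r * kv (s - r) := by
    intro s hs
    have hkv' : ∀ τ, kv τ
        = d * ENNReal.ofReal (10000 * (M * K) * velocityDecay ν ν₀ ρ Q τ) := by
      intro τ
      rw [hkv, ← ENNReal.ofReal_natCast, ← ENNReal.ofReal_mul (by positivity)]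
      simp only [mul_assoc]
    refine (normL2Vec_le_sum _).trans ((Finset.sum_le_card_nsmul _ _
      (Y₀ * ENNReal.ofReal (10000 * (M * K) * velocityDecay ν ν₀ ρ Q s) + ∫⁻ r in Set.Ioc 0 s,
        Yt r * ENNReal.ofReal (10000 * (M * K) * velocityDecay ν ν₀ ρ Q (s - r)))
      fun i _ => ?_).trans_eq ?_)
    · have := main (some i) s hs
      rwa [hw, blockWeight, ENNReal.ofReal_one, one_mul] at this
    · simp only [hkv', mul_left_comm _ (d : ℝ≥0∞)]
      rw [Finset.card_univ, Fintype.card_fin, nsmul_eq_mul, mul_add,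
        lintegral_const_mul' _ _ (ENNReal.natCast_ne_top d)]
  have e1 : timeNorm ⊤ t (fun s => normL2Vec fun i => block χ j (u s i))
      ≤ ENNReal.ofReal (d * 20000 * (M * K)) * Z := by
    refine timeNorm_top_le_of_convolution (fun s hs => ENNReal.ofReal_le_ofReal ?_) hYtm hu
    calc d * (10000 * (M * K)) * velocityDecay ν ν₀ ρ Q s ≤ d * (10000 * (M * K)) * 2 := by
          gcongr
          exact velocityDecay_le_two hν0 hν₀0 hQ hs
      _ = _ := by ring
  have e2 : ENNReal.ofReal (ν₀ * ρ ^ 2)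
      * timeNorm 1 t (fun s => normL2Vec fun i => block χ j (u s i))
      ≤ ENNReal.ofReal (d * 360000 * (M * K)) * Z := by
    have h := timeNorm_one_le_of_convolution (J := ENNReal.ofReal (d * (10000 * (M * K)))
      * ENNReal.ofReal (18 / (ν₀ * ρ ^ 2) + 18 / (ν * ρ ^ 2))) hkvm (by
        simp only [hkv, ENNReal.ofReal_mul (show 0 ≤ d * (10000 * (M * K)) by positivity)]
        rw [lintegral_const_mul' _ _ ENNReal.ofReal_ne_top]
        exact mul_le_mul_right (lintegral_velocityDecay_le hν0 hν₀0 hρ hQ) _) hYtm hu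
    refine (mul_le_mul_right h _).trans ?_
    rw [← mul_assoc, ← ENNReal.ofReal_mul (by positivity), ← ENNReal.ofReal_mul (by positivity)]
    refine mul_le_mul_left (ENNReal.ofReal_le_ofReal ?_) _
    have hν₀ν : ν₀ ≤ ν := hν₀ ▸ min_le_left _ _
    calc _ = d * (10000 * (M * K))
          * (ν₀ * ρ ^ 2 * (18 / (ν₀ * ρ ^ 2) + 18 / (ν * ρ ^ 2))) := by ring
      _ ≤ d * (10000 * (M * K)) * 36 := by
          gcongr
          exact mul_velocity_integral_le hν₀0 hν₀ν hρ
      _ = _ := by ring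
  have e3 : ENNReal.ofReal (1 + ν * ρ) * timeNorm ⊤ t (fun s => normL2 (block χ j (q s)))
      ≤ ENNReal.ofReal (20000 * (M * K)) * Z := by
    rw [← timeNorm_top_const_mul]
    refine timeNorm_top_le_of_convolution (fun s hs => ENNReal.ofReal_le_ofReal ?_) hYtm hq
    calc 10000 * M * densityDecay ν ρ Q s ≤ 10000 * M * 2 := by
          gcongr
          exact densityDecay_le_two hν0 hQ hs
      _ = 20000 * (M * 1) := by ring
      _ ≤ _ := by gcongr
  have e4 : ENNReal.ofReal (1 + ν * ρ) * (ENNReal.ofReal (ν * σ)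
      * timeNorm 1 t (fun s => normL2 (block χ j (q s))))
      ≤ ENNReal.ofReal (900000 * (M * K)) * Z := by
    have h := timeNorm_one_le_of_convolution (J := ENNReal.ofReal (10000 * M)
      * ENNReal.ofReal (18 / (ν * ρ ^ 2) + 18 * ν / Q)) hkqm (by
        simp only [hkq, ENNReal.ofReal_mul (show 0 ≤ 10000 * M by positivity)]
        rw [lintegral_const_mul' _ _ ENNReal.ofReal_ne_top]
        exact mul_le_mul_right (lintegral_densityDecay_le hν0 hρ hQ) _) hYtm hq
    rw [mul_left_comm, ← timeNorm_one_const_mul t ENNReal.ofReal_ne_top]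
    refine (mul_le_mul_right h _).trans ?_
    rw [← mul_assoc, ← ENNReal.ofReal_mul (by positivity), ← ENNReal.ofReal_mul (by positivity)]
    refine mul_le_mul_left (ENNReal.ofReal_le_ofReal ?_) _
    calc _ = 10000 * M * (ν * σ * (18 / (ν * ρ ^ 2) + 18 * ν / Q)) := by ring
      _ ≤ 10000 * M * (90 * K) := by
          refine mul_le_mul_of_nonneg_left ?_ (by positivity)
          exact mul_density_integral_le hν0 hρ hp hκ hσ (min_le_right _ _) hK1 hKν
      _ = _ := by ring
  -- The four constants add up: `20000 d + 360000 d` for the velocity and `20000 + 900000` for the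
  -- density.
  rw [mul_add]
  refine (add_le_add (add_le_add e1 e2) (add_le_add e3 e4)).trans (le_of_eq ?_)
  rw [← add_mul, ← add_mul, ← add_mul, ← ENNReal.ofReal_add (by positivity) (by positivity),
    ← ENNReal.ofReal_add (by positivity) (by positivity),
    ← ENNReal.ofReal_add (by positivity) (by positivity)]
  congr 2
  ring

theorem sum_blockWeight_le (hd : 1 ≤ d) {ρ : ℝ} (n₀ n₁ : Option (Fin d) → ℝ≥0∞) {U₀ U₁ : ℝ≥0∞}
    (h0 : ∀ i, n₀ (some i) ≤ U₀) (h1 : ∀ i, n₁ (some i) ≤ U₁) :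
    ∑ β, ENNReal.ofReal (blockWeight ν ρ β) * (n₀ β + n₁ β)
      ≤ ENNReal.ofReal d * (ENNReal.ofReal (1 + ν * ρ) * n₀ none + U₀
        + ENNReal.ofReal (1 + ν * ρ) * n₁ none + U₁) := by
  have hd' : (1 : ℝ≥0∞) ≤ d := by exact_mod_cast hd
  rw [Fintype.sum_option, ENNReal.ofReal_natCast]
  have hs : ∑ i : Fin d, ENNReal.ofReal (blockWeight ν ρ (some i)) * (n₀ (some i) + n₁ (some i))
      ≤ d * (U₀ + U₁) := by
    refine (Finset.sum_le_card_nsmul _ _ (U₀ + U₁) fun i _ => ?_).trans_eq ?_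
    · rw [blockWeight, ENNReal.ofReal_one, one_mul]
      exact add_le_add (h0 i) (h1 i)
    · rw [Finset.card_univ, Fintype.card_fin, nsmul_eq_mul]
  have hn : ENNReal.ofReal (blockWeight ν ρ (none : Option (Fin d))) * (n₀ none + n₁ none)
      ≤ d * (ENNReal.ofReal (1 + ν * ρ) * (n₀ none + n₁ none)) :=
    le_mul_of_one_le_left zero_le hd'
  refine (add_le_add hn hs).trans (le_of_eq ?_)
  ring

end Estimate

end Korteweg

theorem mainTheorem3 (d : ℕ) (hd : 1 ≤ d) :
    ∃ C ε₀ : ℝ, 0 < C ∧ 0 < ε₀ ∧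
      ∀ (χ : Korteweg.Space d → ℝ), Korteweg.IsCutoff χ →
      ∀ (p μ lam κ ν ν₀ : ℝ), 0 < p → 0 < μ → 0 < κ →
        ν = lam + 2 * μ → 0 < ν → ν₀ = min ν μ →
      ∀ ε : ℝ, 0 < ε → ε ≤ ε₀ →
      ∀ I : Set ℝ, ((∃ T : ℝ, 0 < T ∧ I = Set.Ico 0 T) ∨ I = Set.Ici 0) →
      ∀ (q : ℝ → Korteweg.Distr d) (u : ℝ → Fin d → Korteweg.Distr d)
        (F : ℝ → Korteweg.Distr d) (G : ℝ → Fin d → Korteweg.Distr d),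
        Korteweg.IsSolution p μ lam κ ε I q u F G →
      ∀ t ∈ I, ∀ j : ℤ,
        Korteweg.timeNorm ⊤ t (fun s => Korteweg.normL2Vec fun i => Korteweg.block χ j (u s i))
          + ENNReal.ofReal (ν₀ * 2 ^ (2 * j))
            * Korteweg.timeNorm 1 t
                (fun s => Korteweg.normL2Vec fun i => Korteweg.block χ j (u s i))
          + ENNReal.ofReal (1 + ν * 2 ^ j)
            * (Korteweg.timeNorm ⊤ t (fun s => Korteweg.normL2 (Korteweg.block χ j (q s)))
              + ENNReal.ofReal (ν * min (1 / ε ^ 2) (2 ^ (2 * j)))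
                * Korteweg.timeNorm 1 t (fun s => Korteweg.normL2 (Korteweg.block χ j (q s))))
        ≤ ENNReal.ofReal (C * max (Real.sqrt p) (1 / Real.sqrt p)
              * max (4 * κ / ν ^ 2) ((ν ^ 2 / (4 * κ)) ^ 2))
          * (ENNReal.ofReal (1 + ν * 2 ^ j) * Korteweg.normL2 (Korteweg.block χ j (q 0))
            + Korteweg.normL2Vec (fun i => Korteweg.block χ j (u 0 i))
            + ENNReal.ofReal (1 + ν * 2 ^ j)
              * Korteweg.timeNorm 1 t (fun s => Korteweg.normL2 (Korteweg.block χ j (F s)))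
            + Korteweg.timeNorm 1 t
                (fun s => Korteweg.normL2Vec fun i => Korteweg.block χ j (G s i))) := by
  have hd' : (1 : ℝ) ≤ d := by exact_mod_cast hd
  -- One factor `d` bounds the norm of the velocity by the sum over its components, the other sums
  -- the components of the data; `1300000 = 380000 + 920000`.
  refine ⟨1300000 * (d : ℝ) ^ 2, 1, by positivity, one_pos, ?_⟩
  intro χ hχ p μ lam κ ν ν₀ hp hμ hκ hν hν0 hν₀ ε hε _ I hI q u F G hsol t ht j
  set M := max (√p) (1 / √p) with hM
  set K := max (4 * κ / ν ^ 2) ((ν ^ 2 / (4 * κ)) ^ 2) with hK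
  have hM1 : 1 ≤ M := Korteweg.one_le_max_sqrt hp
  obtain ⟨hK1, hKκ, hKν⟩ := Korteweg.max_ratio_bounds hκ hν0
  set R := ENNReal.ofReal (1 + ν * 2 ^ j) * Korteweg.normL2 (Korteweg.block χ j (q 0))
    + Korteweg.normL2Vec (fun i => Korteweg.block χ j (u 0 i))
    + ENNReal.ofReal (1 + ν * 2 ^ j)
      * Korteweg.timeNorm 1 t (fun s => Korteweg.normL2 (Korteweg.block χ j (F s)))
    + Korteweg.timeNorm 1 t
        (fun s => Korteweg.normL2Vec fun i => Korteweg.block χ j (G s i)) with hR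
  -- Infinite data make the right-hand side infinite, as the constant is positive. Otherwise every
  -- block norm of the data and forces is finite, as the Duhamel bound requires.
  rcases eq_or_ne R ⊤ with hRt | hRt
  · have hpos : 0 < 1300000 * (d : ℝ) ^ 2 * M * K := by positivity
    rw [hRt, ENNReal.mul_top (by simpa using hpos)]
    exact le_top
  have hsub : Set.Icc 0 t ⊆ I := by
    rcases hI with ⟨T, -, rfl⟩ | rfl
    · exact Set.Icc_subset_Ico_right ht.2
    · exact Set.Icc_subset_Ici_self
  have hw : ENNReal.ofReal (1 + ν * 2 ^ j) ≠ 0 := by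
    have : (0 : ℝ) < 1 + ν * 2 ^ j := by positivity
    simpa using this
  obtain ⟨h123, h4⟩ := ENNReal.add_ne_top.mp hRt
  obtain ⟨h12, h3⟩ := ENNReal.add_ne_top.mp h123
  obtain ⟨h1, h2⟩ := ENNReal.add_ne_top.mp h12
  have hu0 : ∀ i, Korteweg.normL2 (Korteweg.block χ j (u 0 i))
      ≤ Korteweg.normL2Vec (fun i => Korteweg.block χ j (u 0 i)) :=
    fun i => Korteweg.normL2_le_normL2Vec _ i
  have hG : ∀ i, Korteweg.timeNorm 1 t (fun s => Korteweg.normL2 (Korteweg.block χ j (G s i)))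
      ≤ Korteweg.timeNorm 1 t (fun s => Korteweg.normL2Vec fun i => Korteweg.block χ j (G s i)) :=
    fun i => Korteweg.timeNorm_one_mono fun s => Korteweg.normL2_le_normL2Vec _ i
  refine (hsol.block_estimate hχ hp hκ hμ hε hν hν0 hν₀ hM1 (le_max_left _ _)
    (Korteweg.one_le_max_sqrt_mul_sqrt hp) hK1 hKκ hKν j hsub ?_ ?_).trans ?_
  · intro β
    match β with
    | none => exact fun h => h1 (by rw [Option.elim_none] at h; rw [h, ENNReal.mul_top hw])
    | some i => exact ne_top_of_le_ne_top h2 (hu0 i)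
  · intro β
    match β with
    | none => exact fun h => h3 (by simp only [Option.elim_none] at h; rw [h, ENNReal.mul_top hw])
    | some i => exact ne_top_of_le_ne_top h4 (hG i)
  refine (mul_le_mul_right (Korteweg.sum_blockWeight_le hd _ _ hu0 hG) _).trans ?_
  rw [← mul_assoc, ← ENNReal.ofReal_mul (by positivity)]
  refine mul_le_mul_left (ENNReal.ofReal_le_ofReal ?_) _
  calc (d * 380000 + 920000) * (M * K) * d ≤ (d * 380000 + 920000 * d) * (M * K) * d := by
        gcongr
        linarith
    _ = 1300000 * (d : ℝ) ^ 2 * M * K := by ring
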